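/- **Conventions.** A *simple* $n$-dimensional complex is a finite CW-complex in which the closure of every cell is a closed ball and every cell lies in the closure of an $n$-dimensional cell; isomorphisms are homeomorphisms respecting the cells. Fix $D\ge 0$ and a set $S$ of colors. A *colored complex* is a simple complex whose cells of positive dimension are oriented and colored by elements of $S$ so that different cells of the same dimension in one connected component have different colors. A *cyclic complex* is a colored complex with a cyclic order on the vertices of each component. A *cut* $\gamma$ of a $(D+1)$-dimensional cyclic complex $\Omega$ is a connected $D$-dimensional simple complex $\gamma\subset\Omega$ which splits a component into two connected parts and its vertices into two nonempty groups that do not interleave in the cyclic order; it meets exactly the closed cells with vertices in both groups, each in a closed ball of codimension one (these balls are the closed cells of $\gamma$) whose bounding sphere divides the boundary of the cell into two closed balls. $\Omega$ is a *brane complex* if every division of the vertices of a component into two nonempty non-interleaving groups is realized by a cut. For a vertex $q$ of a brane complex $\Omega$, let $\sigma_q$ be the isomorphism class of the cut separating $q$ from the other vertices (the *vertex complex* of $q$). Here every cell of the cut, **including its zero-dimensional cells**, carries the color of the cell of $\Omega$ that it divides, and is oriented as boundary of the part of that cell away from $q$ (for a zero-dimensional cell the orientation is a sign). Let $\Sigma$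 be the set of isomorphism classes of connected $D$-dimensional simple complexes all of whose cells (of dimensions $0,\dots,D$) are oriented and colored in this way, cells of equal dimension having different colors; $\sigma\mapsto\sigma^*$ reverses all orientations. Write $\Omega(\sigma_1,\dots,\sigma_n)$ for a connected brane complex with vertices enumerated as $q_1,\dots,q_n$ in cyclic order such that $\sigma_{q_i}=\sigma_i$, and $\Omega(\sigma_1,\dots,\sigma_n)=\emptyset$ if there is none. Let $\mathbb K$ be a field of characteristic $0$ and $\{B_\sigma\}_{\sigma\in\Sigma}$ finite-dimensional $\mathbb K$-vector spaces. Put $V_\Omega=\bigotimes_{q}B_{\sigma_q}$ over the vertices of $\Omega$. A *Brane Topological Field Theory* on $\{B_\sigma\}$ consists of tensors $K_\sigma\in B_\sigma\otimes B_{\sigma^*}$ $(\sigma\in\Sigma)$ and linear forms $\Phi_\Omega:V_\Omega\to\mathbb K$ for all $(D+1)$-dimensional brane complexes $\Omega$ such that 1. $\Phi_{\Omega'}(\phi_*x)=\Phi_\Omega(x)$ for every isomorphism $\phi:\Omega\to\Omega'$ preserving cells, orientations, colors and cyclic orders; 2. for every brane complex with exactly two vertices $q_1,q_2$ the bilinear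 form $(x',x'')\mapsto\Phi_\Omega(x'_{q_1}\otimes x''_{q_2})$ on $B_{\sigma_{q_1}}\times B_{\sigma_{q_2}}$ is non-degenerate; 3. $\Phi_{\Omega[\gamma]}(x\otimes K_{\sigma})=\Phi_\Omega(x)$ for every cut $\gamma$ of a connected brane complex $\Omega$, where $\Omega[\gamma]$ is obtained by cutting $\Omega$ along $\gamma$ and contracting the two copies of $\gamma$ to new vertices $q_+,q_-$, and $\sigma=\sigma_{q_+}=\sigma_{q_-}^*$; 4. $\Phi_{\Omega'\sqcup\Omega''}(x'\otimes x'')=\Phi_{\Omega'}(x')\,\Phi_{\Omega''}(x'')$. **Theorem.** (a) If $\Omega(\sigma_1,\sigma_2,\sigma_3,\sigma_4)\ne\emptyset$, there is exactly one $\tau\in\Sigma$ with $\Omega(\sigma_1,\sigma_2,\tau)\neq\emptyset$ and $\Omega(\tau^*,\sigma_3,\sigma_4)\ne\emptyset$; denote it by $\sigma_{(1,2|3,4)}$. In the same way let $\sigma_{(4,1|2,3)}$ be the unique $\upsilon$ with $\Omega(\sigma_4,\sigma_1,\upsilon)\ne\emptyset$ and $\Omega(\upsilon^*,\sigma_2,\sigma_3)\ne\emptyset$.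 Put $\sigma_{(3,4|1,2)}=\sigma_{(1,2|3,4)}^*$ and $\sigma_{(2,3|4,1)}=\sigma_{(4,1|2,3)}^*$. (b) For every Brane Topological Field Theory on finite-dimensional spaces $\{B_\sigma\}$ there are, on $B_\star=\bigoplus_{\sigma\in\Sigma}B_\sigma$, a bilinear form and a trilinear form given, independently of the choice of the complexes, for $x'\in B_{\sigma_1}$, $x''\in B_{\sigma_2}$, $x'''\in B_{\sigma_3}$ by $$(x',x'')=\Phi_{\Omega(\sigma_1,\sigma_2)}(x'_{q_1}\otimes x''_{q_2}),\qquad (x',x'',x''')=\Phi_{\Omega(\sigma_1,\sigma_2,\sigma_3)}(x'_{q_1}\otimes x''_{q_2}\otimes x'''_{q_3}),$$ and by $0$ when $\Omega(\sigma_1,\sigma_2)$, respectively $\Omega(\sigma_1,\sigma_2,\sigma_3)$, is empty. They make $B_\star$ a *Colored Frobenius Algebra*, that is: * $(\cdot,\cdot)$ is non-degenerate; * $(B_{\sigma_1},B_{\sigma_2})=0$ if $\sigma_1\ne\sigma_2^*$; * $(B_{\sigma_1},B_{\sigma_2},B_{\sigma_3})=0$ if $\Omega(\sigma_1,\sigma_2,\sigma_3)=\emptyset$;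 * whenever $\Omega(\sigma_1,\sigma_2,\sigma_3,\sigma_4)\ne\emptyset$ and $x_k\in B_{\sigma_k}$, $$\sum_{i,j}(x_1,x_2,b_i^{(1,2|3,4)})F^{ij}_{(1,2|3,4)}(b_j^{(3,4|1,2)},x_3,x_4)=\sum_{i,j}(x_4,x_1,b_i^{(4,1|2,3)})F^{ij}_{(4,1|2,3)}(b_j^{(2,3|4,1)},x_2,x_3),$$ where $\{b_i^{(s,t|k,r)}\}$ is any basis of $B_{\sigma_{(s,t|k,r)}}$ and $F^{ij}_{(s,t|k,r)}$ is the inverse of the matrix $(b_i^{(s,t|k,r)},b_j^{(k,r|s,t)})$, i.e. $\sum_jF^{ij}_{(s,t|k,r)}\,(b_l^{(s,t|k,r)},b_j^{(k,r|s,t)})=\delta_{il}$. -/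

import Mathlib

open scoped TensorProduct DirectSum

universe u v w

namespace BraneTheory

/-! ### Finite regular CW-complexes, presented by their face posets

A CW-complex in which the closure of every cell is a closed ball is regular, and a finite regular
CW-complex is determined, up to a homeomorphism that respects the cells, by the poset of its cells
(ordered by inclusion of closures): the geometric realization of the order complex of that poset
is the complex itself, barycentrically subdivided, the closed cell of `c` being the realization of
the cells `≤ c` and its boundary the realization of the cells `< c`. Homeomorphisms that respect
the cells correspond to isomorphisms of the posets. -/

/-- The geometric realization (in barycentric coordinates) of the order complex of the subset `T`
of a finite poset: convex combinations of the elements of a chain contained in `T`. -/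
def realization {C : Type} [Fintype C] [PartialOrder C] (T : Set C) : Set (C → ℝ) :=
  {w | (∀ c, 0 ≤ w c) ∧ ∑ c, w c = 1 ∧ (∀ c, w c ≠ 0 → c ∈ T) ∧
    ∀ c d, w c ≠ 0 → w d ≠ 0 → c ≤ d ∨ d ≤ c}

/-- `s` is homeomorphic to the closed `n`-ball by a homeomorphism that takes `s ∩ t` onto the
bounding sphere. -/
def IsBallPair {X : Type} [TopologicalSpace X] (n : ℕ) (s t : Set X) : Prop :=
  ∃ h : s ≃ₜ Metric.closedBall (0 : EuclideanSpace ℝ (Fin n)) 1,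
    ∀ x : s, (x : X) ∈ t ↔ ‖(h x : EuclideanSpace ℝ (Fin n))‖ = 1

/-- A finite poset of cells with dimensions. -/
structure CellComplex where
  Cell : Type
  [finite : Finite Cell]
  [order : PartialOrder Cell]
  dim : Cell → ℕ

attribute [instance] CellComplex.finite CellComplex.order

noncomputable instance (X : CellComplex) : Fintype X.Cell := Fintype.ofFinite _

namespace CellComplex

variable (X : CellComplex)

/-- Vertices: the cells of dimension zero. -/
abbrev Vertex : Type := {c : X.Cell // X.dim c = 0}

/-- `X` is (the face poset of) a simple CW-complex that is the closure of its `n`-dimensional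
cells: the closure of every cell is a closed ball, its boundary is made of cells of smaller
dimension, and every cell lies in the closure of an `n`-dimensional one. -/
structure IsSimple (n : ℕ) : Prop where
  dim_lt : ∀ c d : X.Cell, c < d → X.dim c < X.dim d
  ball : ∀ c : X.Cell, IsBallPair (X.dim c) (realization (Set.Iic c)) (realization (Set.Iio c))
  dim_le : ∀ c : X.Cell, X.dim c ≤ n
  pure : ∀ c : X.Cell, ∃ m : X.Cell, c ≤ m ∧ X.dim m = n

/-- Two cells are linked inside a set `T` of cells: there is a chain of successively incident cells
of `T` that joins them. -/
def Linked (T : Set X.Cell) : X.Cell → X.Cell → Prop :=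
  Relation.ReflTransGen fun c d => c ∈ T ∧ d ∈ T ∧ (c ≤ d ∨ d ≤ c)

/-- Connectedness of (the realization of) a set of cells; the empty set is not connected. -/
def IsConnectedOn (T : Set X.Cell) : Prop :=
  T.Nonempty ∧ ∀ c ∈ T, ∀ d ∈ T, X.Linked T c d

/-- Two cells lie in the same connected component of the complex. -/
def SameComponent (c d : X.Cell) : Prop := X.Linked Set.univ c d

end CellComplex

/-- A cell complex with incidence numbers. Orienting all cells of positive dimension of a regular
CW-complex (vertices carry the positive orientation) is the same thing as choosing a function
`inc` as in `IsOrientation`: `inc c d` is the coefficient of `d` in the boundary of `c`. -/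
structure OrientedComplex extends CellComplex where
  inc : Cell → Cell → ℤ

namespace OrientedComplex

/-- `inc` is a system of incidence numbers of a regular CW-complex. -/
structure IsOrientation (X : OrientedComplex) : Prop where
  facet : ∀ c d : X.Cell, d < c → X.dim d + 1 = X.dim c → X.inc c d = 1 ∨ X.inc c d = -1
  not_facet : ∀ c d : X.Cell, ¬(d < c ∧ X.dim d + 1 = X.dim c) → X.inc c d = 0
  edge : ∀ c : X.Cell, X.dim c = 1 → ∑ d, X.inc c d = 0
  boundary_boundary : ∀ c b : X.Cell, X.dim b + 2 = X.dim c → ∑ d, X.inc c d * X.inc d b = 0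

end OrientedComplex

/-! ### Cut complexes and their isomorphism classes -/

/-- The data of a colored complex of the kind that is cut out of a higher-dimensional colored
complex: every cell is colored and oriented, *including the zero-dimensional cells* (they are
pieces of edges); the orientation of a zero-dimensional cell is the sign `sign`. The incidence
numbers of a one-dimensional cell are those with respect to the positively oriented points. -/
structure SliceData (S : Type u) extends OrientedComplex where
  color : Cell → S
  sign : (c : Cell) → dim c = 0 → ℤ

namespace SliceData

variable {S : Type u}

/-- `X` is a `D`-dimensional connected colored complex. -/
structure IsSlice (D : ℕ) (X : SliceData S) : Prop where
  simple : X.IsSimple D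
  connected : X.IsConnectedOn Set.univ
  orientation : X.IsOrientation
  sign_eq : ∀ (c : X.Cell) (h : X.dim c = 0), X.sign c h = 1 ∨ X.sign c h = -1
  color_inj : ∀ c d : X.Cell, X.dim c = X.dim d → X.color c = X.color d → c = d

/-- Isomorphism: respects incidence, dimensions, orientations and colors. -/
def Iso (X Y : SliceData S) : Prop :=
  ∃ f : X.Cell ≃o Y.Cell, (∀ c, Y.dim (f c) = X.dim c) ∧
    (∀ c d, Y.inc (f c) (f d) = X.inc c d) ∧ (∀ c, Y.color (f c) = X.color c) ∧
    ∀ c h h', Y.sign (f c) h' = X.sign c h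

/-- Inversion of the orientations of all cells. The incidence number of two cells of positive
dimension does not change when both are reversed; against a positively oriented point it does. -/
def reverse (X : SliceData S) : SliceData S where
  toCellComplex := X.toCellComplex
  inc c d := if X.dim c = 1 then -X.inc c d else X.inc c d
  color := X.color
  sign c h := -X.sign c h

theorem Iso.refl (X : SliceData S) : Iso X X :=
  ⟨OrderIso.refl _, fun _ => rfl, fun _ _ => rfl, fun _ => rfl, fun _ _ _ => rfl⟩

theorem Iso.symm {X Y : SliceData S} : Iso X Y → Iso Y X := by
  rintro ⟨f, h1, h2, h3, h4⟩
  refine ⟨f.symm, fun c => ?_, fun c d => ?_, fun c => ?_, fun c h h' => ?_⟩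
  · have := h1 (f.symm c); rw [f.apply_symm_apply] at this; exact this.symm
  · have := h2 (f.symm c) (f.symm d)
    rw [f.apply_symm_apply, f.apply_symm_apply] at this; exact this.symm
  · have := h3 (f.symm c); rw [f.apply_symm_apply] at this; exact this.symm
  · have := h4 (f.symm c) h' (by rw [f.apply_symm_apply]; exact h)
    rw [← this]; congr 1; rw [f.apply_symm_apply]

theorem Iso.trans {X Y Z : SliceData S} : Iso X Y → Iso Y Z → Iso X Z := by
  rintro ⟨f, h1, h2, h3, h4⟩ ⟨g, k1, k2, k3, k4⟩
  refine ⟨f.trans g, fun c => ?_, fun c d => ?_, fun c => ?_, fun c h h' => ?_⟩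
  · exact (k1 _).trans (h1 c)
  · exact (k2 _ _).trans (h2 c d)
  · exact (k3 _).trans (h3 c)
  · exact (k4 (f c) ((h1 c).trans h) h').trans (h4 c h _)

theorem Iso.reverse {X Y : SliceData S} : Iso X Y → Iso X.reverse Y.reverse := by
  rintro ⟨f, h1, h2, h3, h4⟩
  refine ⟨f, h1, fun c d => ?_, h3, fun c h h' => ?_⟩
  · change (if Y.dim (f c) = 1 then -Y.inc (f c) (f d) else Y.inc (f c) (f d)) =
      if X.dim c = 1 then -X.inc c d else X.inc c d
    rw [h1 c, h2 c d]
  · exact congrArg Neg.neg (h4 c h h')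

theorem IsSlice.reverse {D : ℕ} {X : SliceData S} (hX : X.IsSlice D) : X.reverse.IsSlice D where
  simple := hX.simple
  connected := hX.connected
  orientation :=
    { facet := fun c d h h' => by
        change (if X.dim c = 1 then -X.inc c d else X.inc c d) = 1 ∨
          (if X.dim c = 1 then -X.inc c d else X.inc c d) = -1
        have := hX.orientation.facet c d h h'
        split_ifs <;> omega
      not_facet := fun c d h => by
        change (if X.dim c = 1 then -X.inc c d else X.inc c d) = 0
        have := hX.orientation.not_facet c d h
        split_ifs <;> omega
      edge := fun c h => by
        change ∑ d : X.Cell, (if X.dim c = 1 then -X.inc c d else X.inc c d) = 0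
        have h1 : X.dim c = 1 := h
        simp only [h1, if_true, Finset.sum_neg_distrib, hX.orientation.edge c h1, neg_zero]
      boundary_boundary := fun c b h => by
        change ∑ d : X.Cell, (if X.dim c = 1 then -X.inc c d else X.inc c d) *
          (if X.dim d = 1 then -X.inc d b else X.inc d b) = 0
        have h1 : X.dim b + 2 = X.dim c := h
        have h2 := hX.orientation.boundary_boundary c b h1
        have h3 : X.dim c ≠ 1 := by omega
        have h4 : ∀ d : X.Cell, (if X.dim c = 1 then -X.inc c d else X.inc c d) *
            (if X.dim d = 1 then -X.inc d b else X.inc d b) =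
            (if X.dim b = 0 then -1 else 1) * (X.inc c d * X.inc d b) := by
          intro d
          by_cases hd : X.dim d = X.dim b + 1
          · rw [hd]
            by_cases hb : X.dim b = 0 <;> simp [h3, hb]
          · have : X.inc c d = 0 := hX.orientation.not_facet c d (fun hh => hd (by omega))
            simp [this]
        rw [Finset.sum_congr rfl fun d _ => h4 d, ← Finset.mul_sum, h2, mul_zero] }
  sign_eq := fun c h => by
    change -X.sign c h = 1 ∨ -X.sign c h = -1
    have := hX.sign_eq c h
    omega
  color_inj := hX.color_inj

/-- Isomorphism as an equivalence relation on `D`-dimensional connected colored complexes. -/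
def isoSetoid (D : ℕ) (S : Type u) : Setoid {X : SliceData S // X.IsSlice D} where
  r X Y := Iso X.1 Y.1
  iseqv := ⟨fun X => Iso.refl X.1, Iso.symm, Iso.trans⟩

end SliceData

/-- The set `Σ(D, S)` of isomorphism classes of `D`-dimensional connected colored complexes. -/
def CutType (D : ℕ) (S : Type u) : Type (max 1 u) := Quotient (SliceData.isoSetoid D S)

/-- The involution `σ ↦ σ*` of `Σ(D, S)`: inversion of the orientations. -/
def CutType.star {D : ℕ} {S : Type u} : CutType D S → CutType D S :=
  Quotient.map' (s₁ := SliceData.isoSetoid D S) (s₂ := SliceData.isoSetoid D S)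
    (fun X => ⟨X.1.reverse, X.2.reverse⟩) fun _ _ h => SliceData.Iso.reverse h

/-! ### Cyclic complexes, cuts, brane complexes -/

/-- The data of a cyclic complex: incidence numbers, colors of the cells of positive dimension, and
a ternary relation on the vertices: `cyc a b c` says that `a`, `b`, `c` are different vertices of
one component that follow each other in this cyclic order. -/
structure CyclicData (S : Type u) extends OrientedComplex where
  color : (c : Cell) → dim c ≠ 0 → S
  cyc : {c : Cell // dim c = 0} → {c : Cell // dim c = 0} → {c : Cell // dim c = 0} → Prop

namespace CyclicData

variable {S : Type u}

/-- `Ω` is an `n`-dimensional cyclic complex. -/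
structure IsCyclicComplex (Ω : CyclicData S) (n : ℕ) : Prop where
  simple : Ω.IsSimple n
  orientation : Ω.IsOrientation
  color_inj : ∀ (c d : Ω.Cell) (hc : Ω.dim c ≠ 0) (hd : Ω.dim d ≠ 0), Ω.SameComponent c d →
    Ω.dim c = Ω.dim d → Ω.color c hc = Ω.color d hd → c = d
  cyc_component : ∀ a b c, Ω.cyc a b c → Ω.SameComponent a.1 b.1 ∧ Ω.SameComponent b.1 c.1
  cyc_rotate : ∀ a b c, Ω.cyc a b c → Ω.cyc b c a
  cyc_asymm : ∀ a b c, Ω.cyc a b c → ¬Ω.cyc c b a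
  cyc_trans : ∀ a b c d, Ω.cyc a b c → Ω.cyc a c d → Ω.cyc a b d
  cyc_total : ∀ a b c, a ≠ b → b ≠ c → a ≠ c → Ω.SameComponent a.1 b.1 →
    Ω.SameComponent b.1 c.1 → Ω.cyc a b c ∨ Ω.cyc c b a

/-- The cells that have a vertex in `A`. -/
def side (Ω : CyclicData S) (A : Set Ω.Vertex) : Set Ω.Cell := {c | ∃ a ∈ A, a.1 ≤ c}

/-- The cells of positive dimension that have a vertex in `A` and a vertex outside `A`: those that
are met by a cut that separates `A` from the other vertices. -/
def crossing (Ω : CyclicData S) (A : Set Ω.Vertex) : Set Ω.Cell :=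
  {c | Ω.dim c ≠ 0 ∧ c ∈ Ω.side A ∧ c ∈ Ω.side Aᶜ}

open Classical in
/-- The sum of the incidence numbers of `c` with the vertices in `A`. For an edge `c` with exactly
one end in `A` this is the sign of the point in which a cut separating `A` from the other
vertices meets `c`, as a boundary point of the part of `c` that is away from `A`. -/
noncomputable def endSign (Ω : CyclicData S) (A : Set Ω.Vertex) (c : Ω.Cell) : ℤ :=
  ∑ v : Ω.Vertex, if v ∈ A then Ω.inc c v.1 else 0

/-- The cell structure of a cut `γ` that separates the set `A` of vertices from the other ones. Its
cells are the intersections of `γ` with the cells `c` that have vertices on both sides; they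
inherit the color of `c` and are oriented as the boundary of the part of `c` that is away from
`A`. If `F c` is this part and `s c` is the cell of the cut, then
`∂ (F c) = s c + ∑ d, inc c d • F d`, so that `∂ ∂ = 0` gives `∂ (s c) = -∑ d, inc c d • s d`. -/
noncomputable def cutComplex (Ω : CyclicData S) (A : Set Ω.Vertex) : SliceData S where
  Cell := {c : Ω.Cell // c ∈ Ω.crossing A}
  dim c := Ω.dim c.1 - 1
  inc c d := -Ω.inc c.1 d.1 * if Ω.dim d.1 = 1 then Ω.endSign A d.1 else 1
  color c := Ω.color c.1 c.2.1
  sign c _ := Ω.endSign A c.1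

/-- The vertex complex of a vertex `q`: the cut that separates `q` from all other vertices. -/
noncomputable def vertexComplex (Ω : CyclicData S) (q : Ω.Vertex) : SliceData S :=
  Ω.cutComplex {q}

/-- `A` and its complement in the vertex set of some connected component of `Ω` form a division of
the vertices of this component into two nonempty groups, compatible with the cyclic order: two
vertices of one group and two of the other never alternate. -/
structure IsCompatibleDivision (Ω : CyclicData S) (A : Set Ω.Vertex) : Prop where
  nonempty : A.Nonempty
  component : ∀ a ∈ A, ∀ a' ∈ A, Ω.SameComponent a.1 a'.1
  rest : ∃ a ∈ A, ∃ b, b ∉ A ∧ Ω.SameComponent a.1 b.1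
  compatible : ¬∃ a ∈ A, ∃ a' ∈ A, ∃ b, b ∉ A ∧ ∃ b', b' ∉ A ∧ Ω.cyc a b a' ∧ Ω.cyc a' b' a

/-- The division of the vertices given by `A` is realized by a cut of the `(D+1)`-dimensional
complex `Ω`. In the barycentric subdivision of `Ω` the cut `γ` is the full subcomplex spanned by
the barycenters of the cells that have vertices on both sides. It is required that `γ` be a
connected simple `D`-dimensional complex with these cells (so that `γ` meets every such closed
cell `c` in a closed ball of codimension one, and no other closed cell), that the sphere which
bounds this ball divide the boundary of `c` into two closed balls, and that the two parts into
which `γ` divides the component be connected (these parts retract to the subcomplexes of the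
cells all of whose vertices are on the respective side). -/
structure IsCut (Ω : CyclicData S) (D : ℕ) (A : Set Ω.Vertex) : Prop where
  division : Ω.IsCompatibleDivision A
  simple : (Ω.cutComplex A).IsSimple D
  connected : (Ω.cutComplex A).IsConnectedOn Set.univ
  ball_side : ∀ c ∈ Ω.crossing A, IsBallPair (Ω.dim c - 1)
    (realization (Ω.side A ∩ Set.Iio c)) (realization (Ω.crossing A ∩ Set.Iio c))
  ball_other_side : ∀ c ∈ Ω.crossing A, IsBallPair (Ω.dim c - 1)
    (realization (Ω.side Aᶜ ∩ Set.Iio c)) (realization (Ω.crossing A ∩ Set.Iio c))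
  connected_side : Ω.IsConnectedOn {c | c ∉ Ω.side Aᶜ}
  connected_other_side : Ω.IsConnectedOn {c | (∃ a ∈ A, Ω.SameComponent a.1 c) ∧ c ∉ Ω.side A}

/-- `Ω` is a `(D+1)`-dimensional brane complex: a cyclic complex such that any division of the
vertices that is compatible with the cyclic order is realized by a cut. -/
structure IsBrane (Ω : CyclicData S) (D : ℕ) : Prop extends Ω.IsCyclicComplex (D + 1) where
  cut : ∀ A : Set Ω.Vertex, Ω.IsCompatibleDivision A → Ω.IsCut D A

/-- Isomorphisms of cyclic complexes. -/
structure Isom (Ω Ω' : CyclicData S) where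
  toOrderIso : Ω.Cell ≃o Ω'.Cell
  dim_eq : ∀ c, Ω'.dim (toOrderIso c) = Ω.dim c
  inc_eq : ∀ c d, Ω'.inc (toOrderIso c) (toOrderIso d) = Ω.inc c d
  color_eq : ∀ c h h', Ω'.color (toOrderIso c) h' = Ω.color c h
  cyc_iff : ∀ a b c : Ω.Vertex,
    Ω'.cyc ⟨toOrderIso a.1, (dim_eq a.1).trans a.2⟩ ⟨toOrderIso b.1, (dim_eq b.1).trans b.2⟩
      ⟨toOrderIso c.1, (dim_eq c.1).trans c.2⟩ ↔ Ω.cyc a b c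

/-- The map of vertices induced by an isomorphism. -/
def Isom.vertex {Ω Ω' : CyclicData S} (φ : Isom Ω Ω') : Ω.Vertex ≃ Ω'.Vertex where
  toFun v := ⟨φ.toOrderIso v.1, (φ.dim_eq v.1).trans v.2⟩
  invFun v := ⟨φ.toOrderIso.symm v.1, by
    rw [← φ.dim_eq, φ.toOrderIso.apply_symm_apply]; exact v.2⟩
  left_inv v := by simp
  right_inv v := by simp

/-- Disjoint union of complexes. -/
def disjointUnion (Ω₁ Ω₂ : CyclicData S) : CyclicData S where
  Cell := Ω₁.Cell ⊕ Ω₂.Cell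
  dim := Sum.elim Ω₁.dim Ω₂.dim
  inc c d := match c, d with
    | .inl c, .inl d => Ω₁.inc c d
    | .inr c, .inr d => Ω₂.inc c d
    | _, _ => 0
  color c h := match c, h with
    | .inl c, h => Ω₁.color c h
    | .inr c, h => Ω₂.color c h
  cyc a b c := match a, b, c with
    | ⟨.inl a, ha⟩, ⟨.inl b, hb⟩, ⟨.inl c, hc⟩ => Ω₁.cyc ⟨a, ha⟩ ⟨b, hb⟩ ⟨c, hc⟩
    | ⟨.inr a, ha⟩, ⟨.inr b, hb⟩, ⟨.inr c, hc⟩ => Ω₂.cyc ⟨a, ha⟩ ⟨b, hb⟩ ⟨c, hc⟩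
    | _, _, _ => False

/-- The cells of the half of `Ω` on the side of `A` after cutting and contracting the cut to a
point: the cells of `Ω` with a vertex in `A` (or the part of such a cell on this side of the
cut) and the new vertex `apex`. -/
inductive HalfCell (Ω : CyclicData S) (A : Set Ω.Vertex) : Type
  | apex : HalfCell Ω A
  | cell (c : Ω.Cell) (hc : c ∈ Ω.side A) : HalfCell Ω A

namespace HalfCell

variable {Ω : CyclicData S} {A : Set Ω.Vertex}

/-- The new vertex lies exactly on the cells that meet the cut. -/
def le : HalfCell Ω A → HalfCell Ω A → Prop
  | .apex, .apex => True
  | .apex, .cell c _ => c ∈ Ω.side Aᶜ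
  | .cell _ _, .apex => False
  | .cell c _, .cell d _ => c ≤ d

instance : PartialOrder (HalfCell Ω A) where
  le := le
  le_refl x := by cases x <;> simp [le]
  le_trans x y z hxy hyz := by
    cases x <;> cases y <;> cases z <;> simp only [le] at *
    · exact hyz
    · obtain ⟨b, hb, hbc⟩ := hxy
      exact ⟨b, hb, hbc.trans hyz⟩
    · exact hxy.trans hyz
  le_antisymm x y hxy hyx := by
    cases x <;> cases y <;> simp only [le] at *
    rw [HalfCell.cell.injEq]
    exact le_antisymm hxy hyx

/-- The underlying cell, if any. -/
def toOption : HalfCell Ω A → Option Ω.Cell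
  | .apex => none
  | .cell c _ => some c

instance : Finite (HalfCell Ω A) :=
  Finite.of_injective (toOption (Ω := Ω) (A := A)) (by
    intro x y h
    cases x <;> cases y <;> simp_all [toOption])

def dim : HalfCell Ω A → ℕ
  | .apex => 0
  | .cell c _ => Ω.dim c

/-- The vertices of `Ω` represented by a vertex of the half: the vertex itself, or, for the new
vertex, all vertices on the other side of the cut. -/
def reps : HalfCell Ω A → Set Ω.Vertex
  | .apex => Aᶜ
  | .cell c _ => {v | v.1 = c}

end HalfCell

/-- The half of a connected complex `Ω` on the side of `A` after cutting it by a cut that separates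
`A` from the other vertices and contracting the cut to a point. An edge that met the cut now
ends in the new vertex instead of its end outside `A`; in the cyclic order the new vertex takes
the place of the vertices outside `A`. -/
noncomputable def half (Ω : CyclicData S) (A : Set Ω.Vertex) : CyclicData S where
  Cell := HalfCell Ω A
  dim := HalfCell.dim
  inc c d := match c, d with
    | .cell c _, .cell d _ => Ω.inc c d
    | .cell c _, .apex => Ω.endSign Aᶜ c
    | .apex, _ => 0
  color c h := match c, h with
    | .cell c _, h => Ω.color c h
    | .apex, h => absurd rfl h
  cyc x y z := x ≠ y ∧ y ≠ z ∧ x ≠ z ∧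
    ∃ a ∈ x.1.reps, ∃ b ∈ y.1.reps, ∃ c ∈ z.1.reps, Ω.cyc a b c

/-- The complex `Ω[γ]`: a connected complex `Ω` is cut along `γ` and the two copies of `γ` are
contracted to points. -/
noncomputable def cutAlong (Ω : CyclicData S) (A : Set Ω.Vertex) : CyclicData S :=
  (Ω.half A).disjointUnion (Ω.half Aᶜ)

end CyclicData

namespace CyclicData

variable {S : Type u}

/-! ### The vertex complexes of a brane complex are colored complexes -/

theorem realization_nonempty {C : Type} [Fintype C] [PartialOrder C] {T : Set C} {c : C}
    (hc : c ∈ T) : (realization T).Nonempty := by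
  classical
  refine ⟨Pi.single c 1, fun d => ?_, by simp, fun d hd => ?_, fun d e hd he => ?_⟩
  · by_cases h : d = c
    · subst h; simp
    · simp [h]
  · by_cases h : d = c
    · exact h ▸ hc
    · simp [h] at hd
  · by_cases h : d = c
    · by_cases h' : e = c
      · exact Or.inl (h.trans h'.symm).le
      · simp [h'] at he
    · simp [h] at hd

/-- A set of cells whose realization has at most one point bounds no ball of positive dimension. -/
theorem dim_eq_zero_of_subsingleton {X : CellComplex} {n : ℕ} (hX : X.IsSimple n) (c : X.Cell)
    (h : (realization (Set.Iio c)).Subsingleton) : X.dim c = 0 := by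
  by_contra h0
  obtain ⟨f, hf⟩ := hX.ball c
  obtain ⟨k, hk⟩ := Nat.exists_eq_succ_of_ne_zero h0
  have key : ∀ y : EuclideanSpace ℝ (Fin (X.dim c)), ‖y‖ = 1 →
      ∃ w ∈ realization (Set.Iio c), ∃ hw : w ∈ realization (Set.Iic c), (f ⟨w, hw⟩).1 = y := by
    intro y hy
    have hy' : y ∈ Metric.closedBall (0 : EuclideanSpace ℝ (Fin (X.dim c))) 1 := by
      simp [hy]
    refine ⟨(f.symm ⟨y, hy'⟩).1, (hf _).2 (by simp [hy]), (f.symm ⟨y, hy'⟩).2, by simp⟩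
  have i : Fin (X.dim c) := ⟨0, by omega⟩
  obtain ⟨w, hw, hw', e⟩ := key (EuclideanSpace.single i 1) (by simp)
  obtain ⟨w', hv, hv', e'⟩ := key (-EuclideanSpace.single i 1) (by simp)
  have : w = w' := h hw hv
  subst this
  have h2 : (EuclideanSpace.single i (1 : ℝ)) = -EuclideanSpace.single i 1 := e.symm.trans e'
  have h3 := congrArg (fun z : EuclideanSpace ℝ (Fin (X.dim c)) => z i) h2
  simp at h3
  linarith

theorem exists_vertex_le {X : CellComplex} {n : ℕ} (hX : X.IsSimple n) (c : X.Cell) :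
    ∃ v : X.Vertex, v.1 ≤ c := by
  obtain ⟨m, hm, hmin⟩ := (Set.toFinite {d : X.Cell | d ≤ c}).exists_minimal ⟨c, le_rfl⟩
  refine ⟨⟨m, dim_eq_zero_of_subsingleton hX m ?_⟩, hm⟩
  intro w hw
  exfalso
  obtain ⟨_, hs, hT, _⟩ := hw
  have : ∃ d, w d ≠ 0 := by
    by_contra hh
    push Not at hh
    simp [hh] at hs
  obtain ⟨d, hd⟩ := this
  have hdm : d < m := hT d hd
  exact absurd (hmin (le_of_lt (hdm.trans_le hm)) hdm.le) (not_le_of_gt hdm)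

theorem exists_other_vertex {X : CellComplex} {n : ℕ} (hX : X.IsSimple (n + 1)) (q : X.Vertex) :
    ∃ (c : X.Cell) (u : X.Vertex), u ≠ q ∧ q.1 ≤ c ∧ u.1 ≤ c := by
  obtain ⟨m, hqm, hm⟩ := hX.pure q.1
  have hlt : q.1 < m := lt_of_le_of_ne hqm (fun h => by
    have := q.2; rw [h] at this; omega)
  obtain ⟨c, hc, hmin⟩ := (Set.toFinite {d : X.Cell | q.1 < d}).exists_minimal ⟨m, hlt⟩
  by_contra hno
  push Not at hno
  have hall : ∀ u : X.Vertex, u.1 ≤ c → u = q := fun u hu => by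
    by_contra hne
    exact hno c u hne (le_of_lt hc) hu
  have hio : ∀ d, d < c → d = q.1 := by
    intro d hd
    obtain ⟨v, hv⟩ := exists_vertex_le hX d
    have hvq := hall v (hv.trans hd.le)
    subst hvq
    by_contra hne
    have : v.1 < d := lt_of_le_of_ne hv (Ne.symm hne)
    exact absurd (hmin this hd.le) (not_le_of_gt hd)
  have h0 : X.dim c = 0 := dim_eq_zero_of_subsingleton hX c (by
    intro w hw w' hw'
    obtain ⟨_, hs, hT, _⟩ := hw
    obtain ⟨_, hs', hT', _⟩ := hw'
    have e : ∀ f : X.Cell → ℝ, ∑ d, f d = 1 → (∀ d, f d ≠ 0 → d ∈ Set.Iio c) →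
        ∀ d, f d ≠ 0 → d = q.1 := fun f _ h d hd => hio d (h d hd)
    have e' : ∀ f : X.Cell → ℝ, ∑ d, f d = 1 → (∀ d, f d ≠ 0 → d ∈ Set.Iio c) →
        f q.1 = 1 := fun f hf h => by
      rw [← hf]
      symm
      apply Finset.sum_eq_single
      · intro d _ hd
        by_contra hne
        exact hd (e f hf h d hne)
      · simp
    funext d
    by_cases hd : d = q.1
    · rw [hd, e' w hs hT, e' w' hs' hT']
    · have a : w d = 0 := by by_contra hne; exact hd (e w hs hT d hne)
      have b : w' d = 0 := by by_contra hne; exact hd (e w' hs' hT' d hne)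
      rw [a, b])
  have := hX.dim_lt _ _ hc
  omega

theorem sameComponent_of_le {X : CellComplex} {a b c : X.Cell} (ha : a ≤ c) (hb : b ≤ c) :
    X.SameComponent a b :=
  Relation.ReflTransGen.head ⟨trivial, trivial, Or.inl ha⟩
    (Relation.ReflTransGen.single ⟨trivial, trivial, Or.inr hb⟩)

theorem IsBrane.division_singleton {Ω : CyclicData S} {D : ℕ} (h : Ω.IsBrane D) (q : Ω.Vertex) :
    Ω.IsCompatibleDivision {q} where
  nonempty := ⟨q, rfl⟩
  component := by
    rintro a rfl a' rfl
    exact Relation.ReflTransGen.refl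
  rest := by
    obtain ⟨c, u, hu, h1, h2⟩ := exists_other_vertex h.simple q
    exact ⟨q, rfl, u, hu, sameComponent_of_le h1 h2⟩
  compatible := by
    rintro ⟨a, rfl, a', rfl, b, _, b', _, h1, _⟩
    exact h.cyc_asymm _ _ _ h1 h1

theorem endSign_singleton (Ω : CyclicData S) (q : Ω.Vertex) (c : Ω.Cell) :
    Ω.endSign {q} c = Ω.inc c q.1 := by
  classical
  unfold endSign
  rw [Finset.sum_eq_single q]
  · simp
  · intro v _ hv
    simp [hv]
  · simp

theorem le_of_mem_crossing_singleton {Ω : CyclicData S} {q : Ω.Vertex} {c : Ω.Cell}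
    (h : c ∈ Ω.crossing {q}) : q.1 ≤ c := by
  obtain ⟨_, ⟨a, rfl, ha⟩, _⟩ := h
  exact ha

theorem sum_crossing {Ω : CyclicData S} (A : Set Ω.Vertex) (f : Ω.Cell → ℤ)
    (hf : ∀ d, d ∉ Ω.crossing A → f d = 0) :
    ∑ d : (Ω.cutComplex A).Cell, f d.1 = ∑ d, f d := by
  classical
  have h : ∑ d : (Ω.cutComplex A).Cell, f d.1 =
      ∑ d ∈ Finset.univ.filter (fun d => d ∈ Ω.crossing A), f d := by
    symm
    apply Finset.sum_subtype
    simp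
  rw [h]
  apply Finset.sum_subset (Finset.subset_univ _)
  intro d _ hd
  exact hf d (by simpa using hd)

theorem mem_crossing_mono {Ω : CyclicData S} {n : ℕ} (h : Ω.IsSimple n) {A : Set Ω.Vertex}
    {b d : Ω.Cell} (hb : b ∈ Ω.crossing A) (hbd : b ≤ d) : d ∈ Ω.crossing A := by
  obtain ⟨h0, ⟨a, ha, h1⟩, ⟨a', ha', h2⟩⟩ := hb
  refine ⟨?_, ⟨a, ha, h1.trans hbd⟩, ⟨a', ha', h2.trans hbd⟩⟩
  rcases hbd.eq_or_lt with rfl | hlt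
  · exact h0
  · have := h.dim_lt _ _ hlt
    omega

theorem IsBrane.isSlice_vertexComplex {Ω : CyclicData S} {D : ℕ} (h : Ω.IsBrane D)
    (q : Ω.Vertex) : (Ω.vertexComplex q).IsSlice D := by
  have hc := h.cut {q} (h.division_singleton q)
  have ho := h.orientation
  have hsgn : ∀ c : (Ω.vertexComplex q).Cell, (Ω.vertexComplex q).dim c = 0 →
      Ω.endSign {q} c.1 = 1 ∨ Ω.endSign {q} c.1 = -1 := by
    intro c h0
    have h0' : Ω.dim c.1 - 1 = 0 := h0
    have h1 := c.2.1
    rw [endSign_singleton]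
    have hle := le_of_mem_crossing_singleton c.2
    have hq := q.2
    refine ho.facet _ _ (lt_of_le_of_ne hle fun e => ?_) (by omega)
    rw [e] at hq
    exact h1 hq
  refine ⟨hc.simple, hc.connected, ⟨?_, ?_, ?_, ?_⟩, fun c h0 => hsgn c h0, ?_⟩
  · intro c d hdc hdim
    change (-Ω.inc c.1 d.1 * if Ω.dim d.1 = 1 then Ω.endSign {q} d.1 else 1) = 1 ∨
      (-Ω.inc c.1 d.1 * if Ω.dim d.1 = 1 then Ω.endSign {q} d.1 else 1) = -1
    have hdim' : Ω.dim d.1 - 1 + 1 = Ω.dim c.1 - 1 := hdim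
    have h1 := d.2.1
    have hlt : d.1 < c.1 := hdc
    have hs := hsgn d
    change Ω.dim d.1 - 1 = 0 → _ at hs
    rcases ho.facet c.1 d.1 hlt (by omega) with e | e <;> rw [e] <;> split_ifs with h2
    · rcases hs (by omega) with e' | e' <;> rw [e'] <;> norm_num
    · norm_num
    · rcases hs (by omega) with e' | e' <;> rw [e'] <;> norm_num
    · norm_num
  · intro c d hn
    change (-Ω.inc c.1 d.1 * if Ω.dim d.1 = 1 then Ω.endSign {q} d.1 else 1) = 0
    rw [ho.not_facet c.1 d.1, neg_zero, zero_mul]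
    rintro ⟨hlt, hd⟩
    have h1 := d.2.1
    refine hn ⟨hlt, ?_⟩
    change Ω.dim d.1 - 1 + 1 = Ω.dim c.1 - 1
    omega
  · intro c h1
    have h1' : Ω.dim c.1 - 1 = 1 := h1
    change ∑ d : (Ω.cutComplex {q}).Cell,
      (fun d => -Ω.inc c.1 d * if Ω.dim d = 1 then Ω.endSign {q} d else 1) d.1 = 0
    have hb := ho.boundary_boundary c.1 q.1 (by have := q.2; omega)
    classical
    have hz : ∀ d : Ω.Cell, (-Ω.inc c.1 d * if Ω.dim d = 1 then Ω.endSign {q} d else 1) =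
        if d ∈ Ω.crossing {q} then -(Ω.inc c.1 d * Ω.inc d q.1) else
        (-Ω.inc c.1 d * if Ω.dim d = 1 then Ω.endSign {q} d else 1) := by
      intro d
      by_cases h2 : d ∈ Ω.crossing {q}
      · rw [if_pos h2]
        by_cases h3 : Ω.dim d = 1
        · rw [if_pos h3, endSign_singleton]
          ring
        · rw [ho.not_facet c.1 d (fun hh => h3 (by omega))]
          simp
      · rw [if_neg h2]
    have hcr : ∀ d : Ω.Cell, d ∉ Ω.crossing {q} → Ω.inc c.1 d * Ω.inc d q.1 = 0 := by
      intro d hd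
      by_contra hne
      have h3 : d < c.1 ∧ Ω.dim d + 1 = Ω.dim c.1 := by
        by_contra hh; exact hne (by rw [ho.not_facet _ _ hh, zero_mul])
      have h4 : q.1 < d ∧ Ω.dim q.1 + 1 = Ω.dim d := by
        by_contra hh; exact hne (by rw [ho.not_facet _ _ hh, mul_zero])
      have hde : Ω.dim d = 1 := by omega
      apply hd
      refine ⟨by omega, ⟨q, rfl, h4.1.le⟩, ?_⟩
      by_contra hno
      have hedge := ho.edge d hde
      rw [Finset.sum_eq_single q.1] at hedge
      · rw [hedge, mul_zero] at hne
        exact hne rfl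
      · intro v _ hv
        apply ho.not_facet
        rintro ⟨hlt, hdv⟩
        apply hno
        exact ⟨⟨v, by omega⟩, fun e => hv (congrArg Subtype.val e), hlt.le⟩
      · simp
    have hfin : ∑ d : (Ω.cutComplex {q}).Cell,
        (fun d => -Ω.inc c.1 d * if Ω.dim d = 1 then Ω.endSign {q} d else 1) d.1 =
        ∑ d : (Ω.cutComplex {q}).Cell, (fun d => -(Ω.inc c.1 d * Ω.inc d q.1)) d.1 := by
      refine Finset.sum_congr rfl fun d _ => ?_
      have := hz d.1
      rw [if_pos d.2] at this
      exact this
    rw [hfin, sum_crossing {q} (fun d => -(Ω.inc c.1 d * Ω.inc d q.1))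
      (fun d hd => by simp only [hcr d hd, neg_zero])]
    rw [Finset.sum_neg_distrib, hb, neg_zero]
  · intro c b h2
    have h2' : Ω.dim b.1 - 1 + 2 = Ω.dim c.1 - 1 := h2
    have hb0 := b.2.1
    have hb := ho.boundary_boundary c.1 b.1 (by omega)
    change ∑ d : (Ω.cutComplex {q}).Cell,
      (fun d => (-Ω.inc c.1 d * if Ω.dim d = 1 then Ω.endSign {q} d else 1) *
        (-Ω.inc d b.1 * if Ω.dim b.1 = 1 then Ω.endSign {q} b.1 else 1)) d.1 = 0
    have hterm : ∀ d : Ω.Cell,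
        (-Ω.inc c.1 d * if Ω.dim d = 1 then Ω.endSign {q} d else 1) *
          (-Ω.inc d b.1 * if Ω.dim b.1 = 1 then Ω.endSign {q} b.1 else 1) =
        (if Ω.dim b.1 = 1 then Ω.endSign {q} b.1 else 1) * (Ω.inc c.1 d * Ω.inc d b.1) := by
      intro d
      by_cases hd : b.1 < d ∧ Ω.dim b.1 + 1 = Ω.dim d
      · rw [if_neg (show Ω.dim d ≠ 1 by omega)]
        ring
      · rw [ho.not_facet d b.1 hd]
        ring
    rw [sum_crossing {q} (fun d => (-Ω.inc c.1 d * if Ω.dim d = 1 then Ω.endSign {q} d else 1) *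
      (-Ω.inc d b.1 * if Ω.dim b.1 = 1 then Ω.endSign {q} b.1 else 1))]
    · simp only [hterm]
      rw [← Finset.mul_sum, hb, mul_zero]
    · intro d hd
      simp only [hterm]
      by_cases hlt : b.1 < d ∧ Ω.dim b.1 + 1 = Ω.dim d
      · exact absurd (mem_crossing_mono h.simple b.2 hlt.1.le) hd
      · rw [ho.not_facet d b.1 hlt]
        ring
  · intro c d hdim hcol
    have hdim' : Ω.dim c.1 - 1 = Ω.dim d.1 - 1 := hdim
    have hc1 := c.2.1
    have hd1 := d.2.1
    apply Subtype.ext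
    refine h.color_inj c.1 d.1 hc1 hd1 ?_ (by omega) hcol
    exact Relation.ReflTransGen.head
      ⟨trivial, trivial, Or.inr (le_of_mem_crossing_singleton c.2)⟩
      (Relation.ReflTransGen.single
        ⟨trivial, trivial, Or.inl (le_of_mem_crossing_singleton d.2)⟩)

theorem HalfCell.cell_ne_apex {Ω : CyclicData S} {A : Set Ω.Vertex} (c : Ω.Cell)
    (hc : c ∈ Ω.side A) : (HalfCell.cell c hc : HalfCell Ω A) ≠ HalfCell.apex := by
  simp

/-! ### How vertex complexes behave under the three kinds of morphisms -/

theorem mem_crossing_singleton_iff {Ω : CyclicData S} {q : Ω.Vertex} {c : Ω.Cell} :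
    c ∈ Ω.crossing {q} ↔ Ω.dim c ≠ 0 ∧ q.1 ≤ c ∧ ∃ u : Ω.Vertex, u ≠ q ∧ u.1 ≤ c := by
  constructor
  · rintro ⟨h0, ⟨a, rfl, ha⟩, ⟨u, hu, huc⟩⟩
    exact ⟨h0, ha, u, hu, huc⟩
  · rintro ⟨h0, ha, u, hu, huc⟩
    exact ⟨h0, ⟨q, rfl, ha⟩, ⟨u, hu, huc⟩⟩

/-- A criterion for vertex complexes to be isomorphic. -/
theorem vertexComplex_iso {Ω Ω' : CyclicData S} {q : Ω.Vertex} {q' : Ω'.Vertex}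
    (f : {c // c ∈ Ω.crossing {q}} ≃o {c // c ∈ Ω'.crossing {q'}})
    (hdim : ∀ c, Ω'.dim (f c).1 = Ω.dim c.1)
    (hinc : ∀ c d, Ω'.inc (f c).1 (f d).1 = Ω.inc c.1 d.1)
    (hq : ∀ c, Ω'.inc (f c).1 q'.1 = Ω.inc c.1 q.1)
    (hcol : ∀ c, Ω'.color (f c).1 (f c).2.1 = Ω.color c.1 c.2.1) :
    (Ω.vertexComplex q).Iso (Ω'.vertexComplex q') := by
  have hs : ∀ c, Ω'.endSign {q'} (f c).1 = Ω.endSign {q} c.1 := fun c => by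
    rw [endSign_singleton, endSign_singleton, hq]
  have hi : ∀ c d : {c // c ∈ Ω.crossing {q}},
      (-Ω'.inc (f c).1 (f d).1 * if Ω'.dim (f d).1 = 1 then Ω'.endSign {q'} (f d).1 else 1) =
      (-Ω.inc c.1 d.1 * if Ω.dim d.1 = 1 then Ω.endSign {q} d.1 else 1) := fun c d => by
    rw [hinc, hdim, hs]
  exact ⟨f, fun c => congrArg (· - 1) (hdim c), hi, hcol, fun c _ _ => hs c⟩

theorem Isom.vertexComplex_iso {Ω Ω' : CyclicData S} (φ : Isom Ω Ω') (q : Ω.Vertex) :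
    (Ω.vertexComplex q).Iso (Ω'.vertexComplex (φ.vertex q)) := by
  have hmem : ∀ c, c ∈ Ω.crossing {q} ↔ φ.toOrderIso c ∈ Ω'.crossing {φ.vertex q} := by
    intro c
    refine mem_crossing_singleton_iff.trans (Iff.trans ?_ mem_crossing_singleton_iff.symm)
    refine and_congr (by rw [φ.dim_eq]) (and_congr ?_ ?_)
    · exact (φ.toOrderIso.le_iff_le).symm
    · rw [← φ.vertex.exists_congr_right]
      refine exists_congr fun u => and_congr ?_ ?_
      · exact (not_congr φ.vertex.apply_eq_iff_eq).symm
      · exact (φ.toOrderIso.le_iff_le).symm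
  refine CyclicData.vertexComplex_iso
    { toEquiv := φ.toOrderIso.toEquiv.subtypeEquiv hmem
      map_rel_iff' := φ.toOrderIso.le_iff_le } ?_ ?_ ?_ ?_
  · exact fun c => φ.dim_eq c.1
  · exact fun c d => φ.inc_eq c.1 d.1
  · exact fun c => φ.inc_eq c.1 q.1
  · exact fun c => φ.color_eq c.1 _ _

theorem inl_vertexComplex_iso (Ω₁ Ω₂ : CyclicData S) (q : Ω₁.Vertex) :
    (Ω₁.vertexComplex q).Iso ((Ω₁.disjointUnion Ω₂).vertexComplex ⟨Sum.inl q.1, q.2⟩) := by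
  have hmem : ∀ c, c ∈ Ω₁.crossing {q} ↔
      (Sum.inl c : Ω₁.Cell ⊕ Ω₂.Cell) ∈
        (Ω₁.disjointUnion Ω₂).crossing {⟨Sum.inl q.1, q.2⟩} := by
    intro c
    refine mem_crossing_singleton_iff.trans (Iff.trans ?_ mem_crossing_singleton_iff.symm)
    refine and_congr Iff.rfl (and_congr Sum.inl_le_inl_iff.symm ?_)
    constructor
    · rintro ⟨u, hu, huc⟩
      refine ⟨⟨Sum.inl u.1, u.2⟩, fun e => hu (Subtype.ext ?_), Sum.inl_le_inl_iff.2 huc⟩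
      exact Sum.inl_injective (congrArg Subtype.val e)
    · rintro ⟨⟨u | u, hu0⟩, hu, huc⟩
      · refine ⟨⟨u, hu0⟩, fun e => hu (Subtype.ext ?_), Sum.inl_le_inl_iff.1 huc⟩
        exact congrArg Sum.inl (congrArg Subtype.val e)
      · exact absurd huc Sum.not_inr_le_inl
  have hl : ∀ x, x ∈ (Ω₁.disjointUnion Ω₂).crossing {⟨Sum.inl q.1, q.2⟩} →
      ∃ c, (Sum.inl c : Ω₁.Cell ⊕ Ω₂.Cell) = x := by
    intro x hx
    have := le_of_mem_crossing_singleton hx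
    rcases x with c | c
    · exact ⟨c, rfl⟩
    · exact absurd this Sum.not_inl_le_inr
  refine CyclicData.vertexComplex_iso
    { toEquiv := Equiv.ofBijective (fun c => ⟨Sum.inl c.1, (hmem c.1).1 c.2⟩) ⟨?_, ?_⟩
      map_rel_iff' := Sum.inl_le_inl_iff } ?_ ?_ ?_ ?_
  · intro c d e
    exact Subtype.ext (Sum.inl_injective (congrArg Subtype.val e))
  · rintro ⟨x, hx⟩
    obtain ⟨c, rfl⟩ := hl x hx
    exact ⟨⟨c, (hmem c).2 hx⟩, rfl⟩
  · exact fun c => rfl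
  · exact fun c d => rfl
  · exact fun c => rfl
  · exact fun c => rfl

theorem inr_vertexComplex_iso (Ω₁ Ω₂ : CyclicData S) (q : Ω₂.Vertex) :
    (Ω₂.vertexComplex q).Iso ((Ω₁.disjointUnion Ω₂).vertexComplex ⟨Sum.inr q.1, q.2⟩) := by
  have hmem : ∀ c, c ∈ Ω₂.crossing {q} ↔
      (Sum.inr c : Ω₁.Cell ⊕ Ω₂.Cell) ∈
        (Ω₁.disjointUnion Ω₂).crossing {⟨Sum.inr q.1, q.2⟩} := by
    intro c
    refine mem_crossing_singleton_iff.trans (Iff.trans ?_ mem_crossing_singleton_iff.symm)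
    refine and_congr Iff.rfl (and_congr Sum.inr_le_inr_iff.symm ?_)
    constructor
    · rintro ⟨u, hu, huc⟩
      refine ⟨⟨Sum.inr u.1, u.2⟩, fun e => hu (Subtype.ext ?_), Sum.inr_le_inr_iff.2 huc⟩
      exact Sum.inr_injective (congrArg Subtype.val e)
    · rintro ⟨⟨u | u, hu0⟩, hu, huc⟩
      · exact absurd huc Sum.not_inl_le_inr
      · refine ⟨⟨u, hu0⟩, fun e => hu (Subtype.ext ?_), Sum.inr_le_inr_iff.1 huc⟩
        exact congrArg Sum.inr (congrArg Subtype.val e)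
  have hl : ∀ x, x ∈ (Ω₁.disjointUnion Ω₂).crossing {⟨Sum.inr q.1, q.2⟩} →
      ∃ c, (Sum.inr c : Ω₁.Cell ⊕ Ω₂.Cell) = x := by
    intro x hx
    have := le_of_mem_crossing_singleton hx
    rcases x with c | c
    · exact absurd this Sum.not_inr_le_inl
    · exact ⟨c, rfl⟩
  refine CyclicData.vertexComplex_iso
    { toEquiv := Equiv.ofBijective (fun c => ⟨Sum.inr c.1, (hmem c.1).1 c.2⟩) ⟨?_, ?_⟩
      map_rel_iff' := Sum.inr_le_inr_iff } ?_ ?_ ?_ ?_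
  · intro c d e
    exact Subtype.ext (Sum.inr_injective (congrArg Subtype.val e))
  · rintro ⟨x, hx⟩
    obtain ⟨c, rfl⟩ := hl x hx
    exact ⟨⟨c, (hmem c).2 hx⟩, rfl⟩
  · exact fun c => rfl
  · exact fun c d => rfl
  · exact fun c => rfl
  · exact fun c => rfl

theorem half_vertexComplex_iso (Ω : CyclicData S) (A : Set Ω.Vertex) (c : Ω.Cell)
    (hc : c ∈ Ω.side A) (h0 : Ω.dim c = 0) (hA : (⟨c, h0⟩ : Ω.Vertex) ∈ A) :
    (Ω.vertexComplex ⟨c, h0⟩).Iso ((Ω.half A).vertexComplex ⟨.cell c hc, h0⟩) := by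
  have hside : ∀ d, d ∈ Ω.crossing {⟨c, h0⟩} → d ∈ Ω.side A := fun d hd =>
    ⟨⟨c, h0⟩, hA, le_of_mem_crossing_singleton hd⟩
  have hmem : ∀ d (hd : d ∈ Ω.side A), d ∈ Ω.crossing {⟨c, h0⟩} ↔
      (HalfCell.cell d hd) ∈ (Ω.half A).crossing {⟨.cell c hc, h0⟩} := by
    intro d hd
    refine mem_crossing_singleton_iff.trans (Iff.trans ?_ mem_crossing_singleton_iff.symm)
    refine and_congr Iff.rfl (and_congr Iff.rfl ?_)
    constructor
    · rintro ⟨u, hu, hud⟩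
      by_cases huA : u ∈ A
      · refine ⟨⟨.cell u.1 ⟨u, huA, le_rfl⟩, u.2⟩, fun e => hu (Subtype.ext ?_), hud⟩
        have := congrArg Subtype.val e
        exact (HalfCell.cell.inj this)
      · refine ⟨⟨.apex, rfl⟩, fun e => ?_, ⟨u, huA, hud⟩⟩
        have := congrArg Subtype.val e
        exact absurd this (by simp)
    · rintro ⟨⟨u | ⟨u, hu'⟩, hu0⟩, hu, hud⟩
      · obtain ⟨b, hb, hbd⟩ := (show d ∈ Ω.side Aᶜ from hud)
        exact ⟨b, fun e => hb (e ▸ hA), hbd⟩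
      · refine ⟨⟨u, hu0⟩, fun e => hu (Subtype.ext ?_), hud⟩
        have := congrArg Subtype.val e
        simp only at this
        subst this
        rfl
  have hl : ∀ x, x ∈ (Ω.half A).crossing {⟨.cell c hc, h0⟩} →
      ∃ d hd, (HalfCell.cell d hd : HalfCell Ω A) = x := by
    intro x hx
    have := le_of_mem_crossing_singleton hx
    rcases x with _ | ⟨d, hd⟩
    · exact this.elim
    · exact ⟨d, hd, rfl⟩
  refine CyclicData.vertexComplex_iso
    { toEquiv := Equiv.ofBijective
        (fun d => ⟨.cell d.1 (hside d.1 d.2), (hmem d.1 (hside d.1 d.2)).1 d.2⟩) ⟨?_, ?_⟩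
      map_rel_iff' := Iff.rfl } ?_ ?_ ?_ ?_
  · intro d e h
    exact Subtype.ext (HalfCell.cell.inj (congrArg Subtype.val h))
  · rintro ⟨x, hx⟩
    obtain ⟨d, hd, rfl⟩ := hl x hx
    exact ⟨⟨d, (hmem d hd).2 hx⟩, rfl⟩
  · exact fun d => rfl
  · exact fun d e => rfl
  · exact fun d => rfl
  · exact fun d => rfl

/-- The vertex complex of the new vertex is the cut, oriented from the other side. -/
theorem apex_vertexComplex_iso (Ω : CyclicData S) (A : Set Ω.Vertex) :
    (Ω.cutComplex Aᶜ).Iso ((Ω.half A).vertexComplex ⟨HalfCell.apex, rfl⟩) := by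
  have hA : ∀ d, d ∈ Ω.crossing Aᶜ → d ∈ Ω.side A := by
    rintro d ⟨_, _, h⟩
    rwa [compl_compl] at h
  have hmem : ∀ d (hd : d ∈ Ω.crossing Aᶜ),
      (HalfCell.cell d (hA d hd) : (Ω.half A).Cell) ∈
        (Ω.half A).crossing {⟨HalfCell.apex, rfl⟩} := by
    intro d hd
    refine mem_crossing_singleton_iff.2 ⟨hd.1, hd.2.1, ?_⟩
    obtain ⟨a, ha, had⟩ := hA d hd
    exact ⟨⟨HalfCell.cell a.1 ⟨a, ha, le_rfl⟩, a.2⟩,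
      fun e => HalfCell.cell_ne_apex _ _ (congrArg Subtype.val e), had⟩
  let f : {d // d ∈ Ω.crossing Aᶜ} ≃o
      {x // x ∈ (Ω.half A).crossing {⟨HalfCell.apex, rfl⟩}} :=
    { toEquiv := Equiv.ofBijective (fun d => ⟨HalfCell.cell d.1 (hA d.1 d.2), hmem d.1 d.2⟩)
        ⟨fun d e h => Subtype.ext (HalfCell.cell.inj (congrArg Subtype.val h)), by
          rintro ⟨x, hx⟩
          have hx' := mem_crossing_singleton_iff.1 hx
          rcases x with _ | ⟨d, hd⟩
          · exact absurd rfl hx'.1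
          · exact ⟨⟨d, hx'.1, hx'.2.1, by rwa [compl_compl]⟩, rfl⟩⟩
      map_rel_iff' := Iff.rfl }
  have hs : ∀ d : {d // d ∈ Ω.crossing Aᶜ},
      (Ω.half A).endSign {⟨HalfCell.apex, rfl⟩} (f d).1 = Ω.endSign Aᶜ d.1 :=
    fun d => endSign_singleton _ _ _
  refine ⟨f, fun d => rfl, fun d e => ?_, fun d => rfl, fun d h h' => hs d⟩
  exact congrArg (fun z => -Ω.inc d.1 e.1 * if Ω.dim e.1 = 1 then z else 1) (hs e)

theorem endSign_compl {Ω : CyclicData S} (ho : Ω.IsOrientation) (A : Set Ω.Vertex) (d : Ω.Cell)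
    (hd : Ω.dim d = 1) : Ω.endSign Aᶜ d = -Ω.endSign A d := by
  classical
  have h1 := ho.edge d hd
  have h2 : ∑ v : Ω.Vertex, Ω.inc d v.1 = 0 := by
    rw [← h1, ← Finset.sum_subtype (Finset.univ.filter fun v => Ω.dim v = 0) (by simp)
      (fun v => Ω.inc d v)]
    apply Finset.sum_subset (Finset.subset_univ _)
    intro v _ hv
    apply ho.not_facet
    rintro ⟨_, hdv⟩
    apply hv
    simp only [Finset.mem_filter, Finset.mem_univ, true_and]
    omega
  rw [eq_neg_iff_add_eq_zero, ← h2]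
  unfold endSign
  rw [← Finset.sum_add_distrib]
  refine Finset.sum_congr rfl fun v _ => ?_
  by_cases hv : v ∈ A <;> simp [hv]

/-- Seen from the other side, a cut has the opposite orientation. -/
theorem cutComplex_compl_iso {Ω : CyclicData S} (ho : Ω.IsOrientation) (A : Set Ω.Vertex) :
    (Ω.cutComplex A).reverse.Iso (Ω.cutComplex Aᶜ) := by
  have hmem : ∀ d, d ∈ Ω.crossing A ↔ d ∈ Ω.crossing Aᶜ := by
    intro d
    have : Ω.side Aᶜᶜ = Ω.side A := by rw [compl_compl]
    exact and_congr Iff.rfl (by rw [this]; exact and_comm)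
  let f : {d // d ∈ Ω.crossing A} ≃o {d // d ∈ Ω.crossing Aᶜ} :=
    { toEquiv := Equiv.subtypeEquivRight hmem
      map_rel_iff' := Iff.rfl }
  refine ⟨f, fun d => rfl, fun d e => ?_, fun d => rfl, fun d h h' => ?_⟩
  · change (-Ω.inc d.1 e.1 * if Ω.dim e.1 = 1 then Ω.endSign Aᶜ e.1 else 1) =
      if Ω.dim d.1 - 1 = 1 then -(-Ω.inc d.1 e.1 * if Ω.dim e.1 = 1 then Ω.endSign A e.1 else 1)
      else -Ω.inc d.1 e.1 * if Ω.dim e.1 = 1 then Ω.endSign A e.1 else 1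
    by_cases hf : e.1 < d.1 ∧ Ω.dim e.1 + 1 = Ω.dim d.1
    · by_cases h3 : Ω.dim e.1 = 1
      · rw [if_pos h3, if_pos h3, if_pos (by omega), endSign_compl ho A _ h3]
        ring
      · have := e.2.1
        rw [if_neg h3, if_neg h3, if_neg (by omega)]
    · rw [ho.not_facet d.1 e.1 hf]
      simp
  · have h0 := d.2.1
    have h1 : Ω.dim d.1 - 1 = 0 := h
    exact endSign_compl ho A d.1 (by omega)

end CyclicData

/-! ### Brane complexes and the types of their vertices -/

/-- The `(D+1)`-dimensional brane complexes with colors in `S`. -/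
def BraneComplex (D : ℕ) (S : Type u) : Type (max 1 u) := {Ω : CyclicData S // Ω.IsBrane D}

namespace BraneComplex

variable {D : ℕ} {S : Type u}

abbrev Vertex (Ω : BraneComplex D S) : Type := Ω.1.Vertex

/-- The isomorphism class `σ_q` of the vertex complex of the vertex `q`. -/
noncomputable def vertexType (Ω : BraneComplex D S) (q : Ω.Vertex) : CutType D S :=
  Quotient.mk (SliceData.isoSetoid D S) ⟨Ω.1.vertexComplex q, Ω.2.isSlice_vertexComplex q⟩

theorem vertexType_eq {Ω Ω' : BraneComplex D S} {q : Ω.Vertex} {q' : Ω'.Vertex}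
    (h : (Ω.1.vertexComplex q).Iso (Ω'.1.vertexComplex q')) :
    Ω.vertexType q = Ω'.vertexType q' :=
  Quotient.sound (s := SliceData.isoSetoid D S) h

theorem vertexType_isom {Ω Ω' : BraneComplex D S} (φ : Ω.1.Isom Ω'.1) (q : Ω'.Vertex) :
    Ω.vertexType (φ.vertex.symm q) = Ω'.vertexType q := by
  have h := φ.vertexComplex_iso (φ.vertex.symm q)
  rw [Equiv.apply_symm_apply] at h
  exact vertexType_eq h

theorem vertexType_inl {Ω₁ Ω₂ : BraneComplex D S} (h : (Ω₁.1.disjointUnion Ω₂.1).IsBrane D)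
    (q : Ω₁.Vertex) :
    Ω₁.vertexType q = vertexType ⟨Ω₁.1.disjointUnion Ω₂.1, h⟩ ⟨Sum.inl q.1, q.2⟩ :=
  vertexType_eq (Ω' := ⟨Ω₁.1.disjointUnion Ω₂.1, h⟩) (CyclicData.inl_vertexComplex_iso _ _ q)

theorem vertexType_inr {Ω₁ Ω₂ : BraneComplex D S} (h : (Ω₁.1.disjointUnion Ω₂.1).IsBrane D)
    (q : Ω₂.Vertex) :
    Ω₂.vertexType q = vertexType ⟨Ω₁.1.disjointUnion Ω₂.1, h⟩ ⟨Sum.inr q.1, q.2⟩ :=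
  vertexType_eq (Ω' := ⟨Ω₁.1.disjointUnion Ω₂.1, h⟩) (CyclicData.inr_vertexComplex_iso _ _ q)

theorem mem_of_mem_side (Ω : BraneComplex D S) {A : Set Ω.Vertex} {c : Ω.1.Cell}
    (hc : c ∈ Ω.1.side A) (h0 : Ω.1.dim c = 0) : (⟨c, h0⟩ : Ω.Vertex) ∈ A := by
  obtain ⟨a, ha, hac⟩ := hc
  rcases hac.eq_or_lt with h | h
  · have : a = ⟨c, h0⟩ := Subtype.ext h
    exact this ▸ ha
  · have := Ω.2.simple.dim_lt _ _ h
    omega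

section Cut

variable (Ω : BraneComplex D S) (A : Set Ω.Vertex) (h : (Ω.1.cutAlong A).IsBrane D)

/-- `Ω[γ]` as a brane complex. -/
noncomputable def cutAlong : BraneComplex D S := ⟨Ω.1.cutAlong A, h⟩

/-- The vertex `q₊` of `Ω[γ]`. -/
def plus : (Ω.cutAlong A h).Vertex := ⟨Sum.inl CyclicData.HalfCell.apex, rfl⟩

/-- The vertex `q₋` of `Ω[γ]`. -/
def minus : (Ω.cutAlong A h).Vertex := ⟨Sum.inr CyclicData.HalfCell.apex, rfl⟩

theorem vertexType_cut_left (c : Ω.1.Cell) (hc : c ∈ Ω.1.side A) (h0 : Ω.1.dim c = 0) :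
    Ω.vertexType ⟨c, h0⟩ =
      (Ω.cutAlong A h).vertexType ⟨Sum.inl (CyclicData.HalfCell.cell c hc), h0⟩ :=
  vertexType_eq (Ω' := Ω.cutAlong A h)
    ((CyclicData.half_vertexComplex_iso Ω.1 A c hc h0 (Ω.mem_of_mem_side hc h0)).trans
      (CyclicData.inl_vertexComplex_iso (Ω.1.half A) (Ω.1.half Aᶜ)
        ⟨CyclicData.HalfCell.cell c hc, h0⟩))

theorem vertexType_cut_right (c : Ω.1.Cell) (hc : c ∈ Ω.1.side Aᶜ) (h0 : Ω.1.dim c = 0) :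
    Ω.vertexType ⟨c, h0⟩ =
      (Ω.cutAlong A h).vertexType ⟨Sum.inr (CyclicData.HalfCell.cell c hc), h0⟩ :=
  vertexType_eq (Ω' := Ω.cutAlong A h)
    ((CyclicData.half_vertexComplex_iso Ω.1 Aᶜ c hc h0 (Ω.mem_of_mem_side hc h0)).trans
      (CyclicData.inr_vertexComplex_iso (Ω.1.half A) (Ω.1.half Aᶜ)
        ⟨CyclicData.HalfCell.cell c hc, h0⟩))

theorem vertexType_minus :
    ((Ω.cutAlong A h).vertexType (Ω.plus A h)).star =
      (Ω.cutAlong A h).vertexType (Ω.minus A h) := by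
  have h1 := (CyclicData.apex_vertexComplex_iso Ω.1 A).trans
    (CyclicData.inl_vertexComplex_iso (Ω.1.half A) (Ω.1.half Aᶜ)
      ⟨CyclicData.HalfCell.apex, rfl⟩)
  have h2 := (CyclicData.apex_vertexComplex_iso Ω.1 Aᶜ).trans
    (CyclicData.inr_vertexComplex_iso (Ω.1.half A) (Ω.1.half Aᶜ)
      ⟨CyclicData.HalfCell.apex, rfl⟩)
  exact Quotient.sound (s := SliceData.isoSetoid D S)
    (h1.symm.reverse.trans ((CyclicData.cutComplex_compl_iso Ω.2.orientation Aᶜ).trans h2))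

end Cut

end BraneComplex

/-- A compatible complex for `σ`: a connected brane complex with an enumeration of its vertices
such that the vertex complex of the `i`-th vertex belongs to `σ i` and the enumeration generates
the cyclic order. Thus `Nonempty (CompatibleComplex ![σ₁, …, σₙ])` means `Ω(σ₁, …, σₙ) ≠ ∅`. -/
structure CompatibleComplex {D : ℕ} {S : Type u} {n : ℕ} (σ : Fin n → CutType D S) where
  complex : BraneComplex D S
  connected : complex.1.IsConnectedOn Set.univ
  label : Fin n ≃ complex.Vertex
  vertexType_label : ∀ i, complex.vertexType (label i) = σ i
  cyc_iff : ∀ i j k, complex.1.cyc (label i) (label j) (label k) ↔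
    (i < j ∧ j < k) ∨ (j < k ∧ k < i) ∨ (k < i ∧ i < j)

/-! ### Brane topological field theories -/

section Transport

variable {D : ℕ} {S : Type u} {B : CutType D S → Type v}

/-- The identification of the spaces attached to equal classes. -/
def transport {σ τ : CutType D S} (h : σ = τ) (x : B σ) : B τ := h ▸ x

theorem transport_add [∀ σ, AddCommGroup (B σ)] {σ τ : CutType D S} (h : σ = τ) (x y : B σ) :
    transport h (x + y) = transport h x + transport h y := by
  subst h; rfl

theorem transport_smul {𝕜 : Type w} [Field 𝕜] [∀ σ, AddCommGroup (B σ)] [∀ σ, Module 𝕜 (B σ)]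
    {σ τ : CutType D S} (h : σ = τ) (a : 𝕜) (x : B σ) :
    transport h (a • x) = a • transport h x := by
  subst h; rfl

/-- The family `φ_* x` on the vertices of `Ω'`, for an isomorphism `φ : Ω → Ω'`. -/
noncomputable def pushFamily {Ω Ω' : BraneComplex D S} (φ : Ω.1.Isom Ω'.1)
    (x : ∀ q, B (Ω.vertexType q)) (q : Ω'.Vertex) : B (Ω'.vertexType q) :=
  transport (BraneComplex.vertexType_isom φ q) (x (φ.vertex.symm q))

/-- The family on the vertices of a disjoint union given by families on the two parts. -/
noncomputable def sumFamily {Ω₁ Ω₂ : BraneComplex D S} (h : (Ω₁.1.disjointUnion Ω₂.1).IsBrane D)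
    (x : ∀ q, B (Ω₁.vertexType q)) (y : ∀ q, B (Ω₂.vertexType q)) :
    ∀ q, B (BraneComplex.vertexType ⟨Ω₁.1.disjointUnion Ω₂.1, h⟩ q)
  | ⟨.inl c, hc⟩ => transport (BraneComplex.vertexType_inl h ⟨c, hc⟩) (x ⟨c, hc⟩)
  | ⟨.inr c, hc⟩ => transport (BraneComplex.vertexType_inr h ⟨c, hc⟩) (y ⟨c, hc⟩)

/-- The family on the vertices of `Ω[γ]` that extends a family on the vertices of `Ω` by the value
zero at the new vertices. -/
noncomputable def cutFamily [∀ σ, AddCommGroup (B σ)] (Ω : BraneComplex D S) (A : Set Ω.Vertex)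
    (h : (Ω.1.cutAlong A).IsBrane D) (x : ∀ q, B (Ω.vertexType q)) :
    ∀ q, B ((Ω.cutAlong A h).vertexType q)
  | ⟨.inl .apex, _⟩ => 0
  | ⟨.inr .apex, _⟩ => 0
  | ⟨.inl (.cell c hc), h0⟩ => transport (Ω.vertexType_cut_left A h c hc h0) (x ⟨c, h0⟩)
  | ⟨.inr (.cell c hc), h0⟩ => transport (Ω.vertexType_cut_right A h c hc h0) (x ⟨c, h0⟩)

end Transport

section StateSpace

variable (𝕜 : Type w) [Field 𝕜] {D : ℕ} {S : Type u} (B : CutType D S → Type v)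
  [∀ σ, AddCommGroup (B σ)] [∀ σ, Module 𝕜 (B σ)]

/-- The space `V_Ω`: the (unordered) tensor product of the spaces `B_{σ_q}` over the vertices. -/
abbrev StateSpace (Ω : BraneComplex D S) : Type _ := ⨂[𝕜] q : Ω.Vertex, B (Ω.vertexType q)

variable {B}

open Classical in
/-- For a decomposable `x`, the map `t ↦ x ⊗ t` from `B_{q₊} ⊗ B_{q₋}` to `V_{Ω[γ]}`. -/
noncomputable def insertTensor (Ω : BraneComplex D S) (A : Set Ω.Vertex)
    (h : (Ω.1.cutAlong A).IsBrane D) (x : ∀ q, B (Ω.vertexType q)) :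
    B ((Ω.cutAlong A h).vertexType (Ω.plus A h)) ⊗[𝕜]
      B ((Ω.cutAlong A h).vertexType (Ω.plus A h)).star →ₗ[𝕜] StateSpace 𝕜 B (Ω.cutAlong A h) :=
  TensorProduct.lift <| LinearMap.mk₂ 𝕜
    (fun b b' => PiTensorProduct.tprod 𝕜 <|
      Function.update (Function.update (cutFamily Ω A h x) (Ω.plus A h) b) (Ω.minus A h)
        (transport (Ω.vertexType_minus A h) b'))
    (fun b₁ b₂ b' => by
      have hne : Ω.plus A h ≠ Ω.minus A h := fun e =>
        Sum.inl_ne_inr (congrArg Subtype.val e)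
      simp only [Function.update_comm hne, MultilinearMap.map_update_add])
    (fun a b b' => by
      have hne : Ω.plus A h ≠ Ω.minus A h := fun e =>
        Sum.inl_ne_inr (congrArg Subtype.val e)
      simp only [Function.update_comm hne, MultilinearMap.map_update_smul])
    (fun b b₁ b₂ => by simp only [transport_add, MultilinearMap.map_update_add])
    (fun a b b' => by simp only [transport_smul, MultilinearMap.map_update_smul])

variable {𝕜} in
/-- The value `Φ_{Ω(σ₁, …, σₙ)}(x¹_{q₁} ⊗ … ⊗ xⁿ_{qₙ})`. -/
noncomputable def evalOn (Φ : ∀ Ω : BraneComplex D S, StateSpace 𝕜 B Ω →ₗ[𝕜] 𝕜) {n : ℕ}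
    {σ : Fin n → CutType D S} (m : CompatibleComplex σ) (x : ∀ i, B (σ i)) : 𝕜 :=
  Φ m.complex <| PiTensorProduct.tprod 𝕜 fun q =>
    transport ((m.vertexType_label (m.label.symm q)).symm.trans
      (congrArg m.complex.vertexType (m.label.apply_symm_apply q))) (x (m.label.symm q))

/-- `x` at the first vertex, `y` at the second one. -/
def pairFamily {σ₁ σ₂ : CutType D S} (x : B σ₁) (y : B σ₂) : ∀ i, B (![σ₁, σ₂] i)
  | 0 => x
  | 1 => y

/-- `x`, `y`, `z` at the first, second and third vertex. -/
def tripleFamily {σ₁ σ₂ σ₃ : CutType D S} (x : B σ₁) (y : B σ₂) (z : B σ₃) :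
    ∀ i, B (![σ₁, σ₂, σ₃] i)
  | 0 => x
  | 1 => y
  | 2 => z

variable (B)

/-- A brane topological field theory on the spaces `B σ`: tensors `K_σ ∈ B_σ ⊗ B_{σ*}` and linear
forms `Φ_Ω : V_Ω → 𝕜` for all brane complexes `Ω`, subject to the four axioms. The axioms are
stated on decomposable tensors, which span `V_Ω`. -/
structure BraneTFT where
  K : ∀ σ, B σ ⊗[𝕜] B σ.star
  Φ : ∀ Ω : BraneComplex D S, StateSpace 𝕜 B Ω →ₗ[𝕜] 𝕜
  /-- Topological invariance. -/
  invariance : ∀ (Ω Ω' : BraneComplex D S) (φ : Ω.1.Isom Ω'.1) (x : ∀ q, B (Ω.vertexType q)),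
    Φ Ω' (PiTensorProduct.tprod 𝕜 (pushFamily φ x)) = Φ Ω (PiTensorProduct.tprod 𝕜 x)
  /-- Non-degeneracy of the bilinear form given by a complex with exactly two vertices. -/
  nondegenerate : ∀ (σ₁ σ₂ : CutType D S) (m : CompatibleComplex ![σ₁, σ₂]),
    (∀ x : B σ₁, (∀ y : B σ₂, evalOn Φ m (pairFamily x y) = 0) → x = 0) ∧
    (∀ y : B σ₂, (∀ x : B σ₁, evalOn Φ m (pairFamily x y) = 0) → y = 0)
  /-- Cut invariance, for every cut of a connected brane complex. -/
  cut_invariance : ∀ (Ω : BraneComplex D S), Ω.1.IsConnectedOn Set.univ →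
    ∀ (A : Set Ω.Vertex), Ω.1.IsCut D A → ∀ (h : (Ω.1.cutAlong A).IsBrane D)
      (x : ∀ q, B (Ω.vertexType q)),
    Φ (Ω.cutAlong A h)
        (insertTensor 𝕜 Ω A h x (K ((Ω.cutAlong A h).vertexType (Ω.plus A h)))) =
      Φ Ω (PiTensorProduct.tprod 𝕜 x)
  /-- Multiplicativity. -/
  multiplicativity : ∀ (Ω₁ Ω₂ : BraneComplex D S) (h : (Ω₁.1.disjointUnion Ω₂.1).IsBrane D)
    (x : ∀ q, B (Ω₁.vertexType q)) (y : ∀ q, B (Ω₂.vertexType q)),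
    Φ ⟨Ω₁.1.disjointUnion Ω₂.1, h⟩ (PiTensorProduct.tprod 𝕜 (sumFamily h x y)) =
      Φ Ω₁ (PiTensorProduct.tprod 𝕜 x) * Φ Ω₂ (PiTensorProduct.tprod 𝕜 y)

end StateSpace

/-! ### Colored Frobenius algebras -/

/-- `τ` is a class `σ_{(1,2|3,4)}` of cuts separating the pair `1, 2` from the pair `3, 4`. -/
def IsCutClass {D : ℕ} {S : Type u} (σ₁ σ₂ σ₃ σ₄ τ : CutType D S) : Prop :=
  Nonempty (CompatibleComplex ![σ₁, σ₂, τ]) ∧ Nonempty (CompatibleComplex ![τ.star, σ₃, σ₄])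

section Frobenius

variable {𝕜 : Type w} [Field 𝕜] {D : ℕ} {S : Type u} {B : CutType D S → Type v}
  [∀ σ, AddCommGroup (B σ)] [∀ σ, Module 𝕜 (B σ)]

open Classical in
/-- The inclusion of `B_σ` into `B_⋆ = ⨁ B_σ`. -/
noncomputable def incl (𝕜 : Type w) [Field 𝕜] (B : CutType D S → Type v)
    [∀ σ, AddCommGroup (B σ)] [∀ σ, Module 𝕜 (B σ)] (σ : CutType D S) :
    B σ →ₗ[𝕜] ⨁ σ, B σ :=
  DirectSum.lof 𝕜 (CutType D S) B σ

/-- The sum `∑ (x₁, x₂, bᵢ) Fⁱʲ (b'ⱼ, x₃, x₄)`, where `Fⁱʲ` is the inverse of the matrix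
`(bᵢ, b'ⱼ)`, that is, `∑ⱼ Fⁱʲ (bₖ, b'ⱼ) = δⁱₖ`. -/
noncomputable def contraction
    (β : (⨁ σ, B σ) →ₗ[𝕜] (⨁ σ, B σ) →ₗ[𝕜] 𝕜)
    (t : (⨁ σ, B σ) →ₗ[𝕜] (⨁ σ, B σ) →ₗ[𝕜] (⨁ σ, B σ) →ₗ[𝕜] 𝕜)
    (x₁ x₂ x₃ x₄ : ⨁ σ, B σ) {n : ℕ} (b b' : Fin n → ⨁ σ, B σ) : 𝕜 :=
  ∑ i, ∑ j, t x₁ x₂ (b i) * (Matrix.of fun i j => β (b i) (b' j))⁻¹ j i * t (b' j) x₃ x₄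

/-- The bilinear form `β` and the trilinear form `t` make `B_⋆` a colored Frobenius algebra. -/
structure IsColoredFrobeniusAlgebra
    (β : (⨁ σ, B σ) →ₗ[𝕜] (⨁ σ, B σ) →ₗ[𝕜] 𝕜)
    (t : (⨁ σ, B σ) →ₗ[𝕜] (⨁ σ, B σ) →ₗ[𝕜] (⨁ σ, B σ) →ₗ[𝕜] 𝕜) : Prop where
  nondegenerate : β.Nondegenerate
  pair_eq_zero : ∀ σ₁ σ₂ : CutType D S, σ₁ ≠ σ₂.star →
    ∀ (x : B σ₁) (y : B σ₂), β (incl 𝕜 B σ₁ x) (incl 𝕜 B σ₂ y) = 0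
  triple_eq_zero : ∀ σ₁ σ₂ σ₃ : CutType D S, IsEmpty (CompatibleComplex ![σ₁, σ₂, σ₃]) →
    ∀ (x : B σ₁) (y : B σ₂) (z : B σ₃),
      t (incl 𝕜 B σ₁ x) (incl 𝕜 B σ₂ y) (incl 𝕜 B σ₃ z) = 0
  associativity : ∀ σ₁ σ₂ σ₃ σ₄ : CutType D S, Nonempty (CompatibleComplex ![σ₁, σ₂, σ₃, σ₄]) →
    ∀ τ υ : CutType D S, IsCutClass σ₁ σ₂ σ₃ σ₄ τ → IsCutClass σ₄ σ₁ σ₂ σ₃ υ →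
    ∀ (m n : ℕ) (b : Module.Basis (Fin m) 𝕜 (B τ)) (b' : Module.Basis (Fin m) 𝕜 (B τ.star))
      (c : Module.Basis (Fin n) 𝕜 (B υ)) (c' : Module.Basis (Fin n) 𝕜 (B υ.star))
      (x₁ : B σ₁) (x₂ : B σ₂) (x₃ : B σ₃) (x₄ : B σ₄),
    contraction β t (incl 𝕜 B σ₁ x₁) (incl 𝕜 B σ₂ x₂) (incl 𝕜 B σ₃ x₃) (incl 𝕜 B σ₄ x₄)
        (fun i => incl 𝕜 B τ (b i)) (fun j => incl 𝕜 B τ.star (b' j)) =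
      contraction β t (incl 𝕜 B σ₄ x₄) (incl 𝕜 B σ₁ x₁) (incl 𝕜 B σ₂ x₂) (incl 𝕜 B σ₃ x₃)
        (fun i => incl 𝕜 B υ (c i)) (fun j => incl 𝕜 B υ.star (c' j))

end Frobenius

end BraneTheory

namespace BraneTheory

/-! ### Topology of realizations -/

section Topology

/-! Rigidity. A connected brane complex is determined by the cyclic order of its vertices and by all
but one of its vertex complexes. Every cell of positive dimension has at least two vertices, so it
is seen in some vertex complex other than the exceptional one. In a connected complex such a cell is
recognized by its dimension and color, so the local isomorphisms at the vertices fit together. What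
happens at the exceptional vertex is recovered from the edges that end there, since each of them has
its other end elsewhere (`VertexMatching.exists_isom`). Rigidity gives the uniqueness in (a);
together with topological invariance it makes the forms independent of the chosen complexes.

Cutting. The axioms can be exploited only if cutting and contracting leads to brane complexes again
(`IsBrane.half`, `IsBrane.cutAlong`). A cut divides the boundary sphere of every cell that it meets
into two balls with a common bounding sphere. Contracting the cut replaces the far ball by the cone
over that sphere, which is again a ball, so the boundary of the cell is still a sphere
(`exists_homeomorph_fill`, `exists_homeomorph_Iio_cell`). The cuts of a half come from cuts of the
whole complex by the same replacement. The contracted complex is the disjoint union of the two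
halves, so cut invariance and multiplicativity together express the value on a complex as the
contraction, by `K`, of the values on its halves (`BraneTFT.evalOn_eq_contraction`).

Duality. The suspension of a slice of class `σ` is a brane complex with two vertices, of classes `σ`
and `σ.star` (`nonempty_compatibleComplex_star`), and by rigidity no other class can accompany `σ`.
Hence the bilinear form pairs each summand with exactly one other, and its non-degeneracy reduces to
the second axiom. Cutting a complex with two vertices expresses the pairing as its own contraction
with `K τ`; since the Gram matrix `G` is invertible, this forces the matrix of `K τ` to be the
transposed inverse of `G` (`mul'_map_eq_contraction`).

Associativity. Cutting a complex with four vertices into the pairs `1, 2` and `3, 4` turns its value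
into the left side of the identity. Rotating the enumeration by one and cutting again turns the same
value into the right side. -/

theorem exists_homeomorph_of_bijOn {X Y : Type} [TopologicalSpace X] [TopologicalSpace Y]
    [T2Space Y] {s : Set X} {t : Set Y} (hs : IsCompact s) {f : X → Y} (hf : ContinuousOn f s)
    (hb : Set.BijOn f s t) : ∃ h : s ≃ₜ t, ∀ x : s, (h x : Y) = f x := by
  have := isCompact_iff_compactSpace.1 hs
  have hc : Continuous (hb.equiv f) :=
    Continuous.subtype_mk (continuousOn_iff_continuous_domRestrict.1 hf) _
  exact ⟨hc.homeoOfEquivCompactToT2, fun x => rfl⟩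

theorem IsBallPair.of_homeomorph {X Y : Type} [TopologicalSpace X] [TopologicalSpace Y] {n : ℕ}
    {s t : Set X} {s' t' : Set Y} (h : s ≃ₜ s') (ht : ∀ x : s, (x : X) ∈ t ↔ (h x : Y) ∈ t')
    (hb : IsBallPair n s' t') : IsBallPair n s t := by
  obtain ⟨g, hg⟩ := hb
  exact ⟨h.trans g, fun x => (ht x).trans (hg (h x))⟩

/-- Two homeomorphisms between compact sets that agree on the intersection can be glued. -/
theorem exists_homeomorph_union {X Y : Type} [TopologicalSpace X] [TopologicalSpace Y]
    [T2Space X] [T2Space Y] {s₁ s₂ : Set X} {t₁ t₂ : Set Y} (h₁ : IsCompact s₁)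
    (h₂ : IsCompact s₂) (f₁ : s₁ ≃ₜ t₁) (f₂ : s₂ ≃ₜ t₂)
    (hf : ∀ x (hx : x ∈ s₁) (hx' : x ∈ s₂), (f₁ ⟨x, hx⟩ : Y) = f₂ ⟨x, hx'⟩)
    (hm₂ : ∀ x : s₂, (f₂ x : Y) ∈ t₁ → (x : X) ∈ s₁) :
    ∃ h : ↥(s₁ ∪ s₂) ≃ₜ ↥(t₁ ∪ t₂),
      (∀ x (hx : x ∈ s₁), (h ⟨x, Or.inl hx⟩ : Y) = f₁ ⟨x, hx⟩) ∧
      ∀ x (hx : x ∈ s₂), (h ⟨x, Or.inr hx⟩ : Y) = f₂ ⟨x, hx⟩ := by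
  classical
  -- The glued map needs some value `y₀` off `s₁ ∪ s₂`, so an empty target is treated separately.
  rcases isEmpty_or_nonempty Y with hY | ⟨⟨y₀⟩⟩
  · have e₁ : IsEmpty s₁ := ⟨fun x => hY.elim (f₁ x).1⟩
    have e₂ : IsEmpty s₂ := ⟨fun x => hY.elim (f₂ x).1⟩
    have e : IsEmpty ↥(s₁ ∪ s₂) := ⟨fun x => x.2.elim (fun h => e₁.elim ⟨_, h⟩)
      fun h => e₂.elim ⟨_, h⟩⟩
    have e' : IsEmpty ↥(t₁ ∪ t₂) := ⟨fun x => hY.elim x.1⟩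
    exact ⟨Homeomorph.empty, fun x hx => (e₁.elim ⟨x, hx⟩), fun x hx => (e₂.elim ⟨x, hx⟩)⟩
  let f : X → Y := fun x => if hx : x ∈ s₁ then f₁ ⟨x, hx⟩ else
    if hx : x ∈ s₂ then f₂ ⟨x, hx⟩ else y₀
  have hf₁ : ∀ x (hx : x ∈ s₁), f x = f₁ ⟨x, hx⟩ := fun x hx => dif_pos hx
  have hf₂ : ∀ x (hx : x ∈ s₂), f x = f₂ ⟨x, hx⟩ := fun x hx => by
    by_cases hx' : x ∈ s₁
    · rw [hf₁ x hx', hf]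
    · simp only [f, dif_neg hx', dif_pos hx]
  have hc₁ : ContinuousOn f s₁ := by
    rw [continuousOn_iff_continuous_domRestrict]
    refine (continuous_subtype_val.comp f₁.continuous).congr fun x => (hf₁ x x.2).symm
  have hc₂ : ContinuousOn f s₂ := by
    rw [continuousOn_iff_continuous_domRestrict]
    refine (continuous_subtype_val.comp f₂.continuous).congr fun x => (hf₂ x x.2).symm
  have hb : Set.BijOn f (s₁ ∪ s₂) (t₁ ∪ t₂) := by
    refine ⟨?_, ?_, ?_⟩
    · rintro x (hx | hx)
      · rw [hf₁ x hx]; exact Or.inl (f₁ _).2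
      · rw [hf₂ x hx]; exact Or.inr (f₂ _).2
    · have i₁ : Set.InjOn f s₁ := fun x hx y hy e => by
        rw [hf₁ x hx, hf₁ y hy] at e
        exact congrArg Subtype.val (f₁.injective (Subtype.ext e))
      have i₂ : Set.InjOn f s₂ := fun x hx y hy e => by
        rw [hf₂ x hx, hf₂ y hy] at e
        exact congrArg Subtype.val (f₂.injective (Subtype.ext e))
      rintro x hx y hy e
      rcases hx with hx | hx <;> rcases hy with hy | hy
      · exact i₁ hx hy e
      -- Two points of different pieces have the same image: it lies in `t₁`, so `hm₂` puts the
      -- second point into `s₁` as well.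
      · have : y ∈ s₁ := hm₂ ⟨y, hy⟩ (by rw [← hf₂ y hy, ← e, hf₁ x hx]; exact (f₁ _).2)
        exact i₁ hx this e
      · have : x ∈ s₁ := hm₂ ⟨x, hx⟩ (by rw [← hf₂ x hx, e, hf₁ y hy]; exact (f₁ _).2)
        exact i₁ this hy e
      · exact i₂ hx hy e
    · rintro y (hy | hy)
      · refine ⟨(f₁.symm ⟨y, hy⟩).1, Or.inl (f₁.symm ⟨y, hy⟩).2, ?_⟩
        rw [hf₁ _ (f₁.symm ⟨y, hy⟩).2]; simp
      · refine ⟨(f₂.symm ⟨y, hy⟩).1, Or.inr (f₂.symm ⟨y, hy⟩).2, ?_⟩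
        rw [hf₂ _ (f₂.symm ⟨y, hy⟩).2]; simp
  obtain ⟨h, hh⟩ := exists_homeomorph_of_bijOn (h₁.union h₂)
    (hc₁.union_of_isClosed hc₂ h₁.isClosed h₂.isClosed) hb
  exact ⟨h, fun x hx => (hh _).trans (hf₁ x hx), fun x hx => (hh _).trans (hf₂ x hx)⟩

variable {C C' : Type} [Fintype C] [PartialOrder C] [Fintype C'] [PartialOrder C']

theorem realization_mono {T U : Set C} (h : T ⊆ U) : realization T ⊆ realization U :=
  fun _ hw => ⟨hw.1, hw.2.1, fun c hc => h (hw.2.2.1 c hc), hw.2.2.2⟩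

theorem mem_realization_of_subset {T U : Set C} {w : C → ℝ} (h : w ∈ realization T)
    (hU : ∀ c, w c ≠ 0 → c ∈ U) : w ∈ realization U :=
  ⟨h.1, h.2.1, hU, h.2.2.2⟩

theorem realization_inter (T U : Set C) :
    realization (T ∩ U) = realization T ∩ realization U :=
  Set.Subset.antisymm
    (fun _ h => ⟨realization_mono Set.inter_subset_left h,
      realization_mono Set.inter_subset_right h⟩)
    fun _ h => mem_realization_of_subset h.1 fun c hc => ⟨h.1.2.2.1 c hc, h.2.2.2.1 c hc⟩

theorem le_one_of_mem_realization {T : Set C} {w : C → ℝ} (h : w ∈ realization T) (c : C) :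
    w c ≤ 1 := by
  rw [← h.2.1]
  exact Finset.single_le_sum (fun i _ => h.1 i) (Finset.mem_univ c)

/-- A realization is a closed subset of a cube. The chain condition is closed because it says that
the products `w c * w d` vanish for incomparable `c` and `d`. -/
theorem isCompact_realization (T : Set C) : IsCompact (realization T) := by
  have hcl : IsClosed (realization T) := by
    have h1 : IsClosed {w : C → ℝ | ∀ c, 0 ≤ w c} := by
      simp only [Set.ofPred_forall]
      exact isClosed_iInter fun c => isClosed_le continuous_const (continuous_apply c)
    have h2 : IsClosed {w : C → ℝ | ∑ c, w c = 1} :=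
      isClosed_eq (continuous_finsetSum _ fun c _ => continuous_apply c) continuous_const
    have h3 : IsClosed {w : C → ℝ | ∀ c, w c ≠ 0 → c ∈ T} := by
      have : {w : C → ℝ | ∀ c, w c ≠ 0 → c ∈ T} = ⋂ c ∈ Tᶜ, {w : C → ℝ | w c = 0} := by
        ext w
        simp only [Set.mem_ofPred_eq, Set.mem_iInter, Set.mem_compl_iff]
        exact forall_congr' fun c => by tauto
      rw [this]
      exact isClosed_biInter fun c _ => isClosed_eq (continuous_apply c) continuous_const
    have h4 : IsClosed {w : C → ℝ | ∀ c d, w c ≠ 0 → w d ≠ 0 → c ≤ d ∨ d ≤ c} := by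
      have : {w : C → ℝ | ∀ c d, w c ≠ 0 → w d ≠ 0 → c ≤ d ∨ d ≤ c} =
          ⋂ c, ⋂ d, {w : C → ℝ | (c ≤ d ∨ d ≤ c) ∨ w c * w d = 0} := by
        ext w
        simp only [Set.mem_ofPred_eq, Set.mem_iInter, mul_eq_zero]
        exact forall_congr' fun c => forall_congr' fun d => by tauto
      rw [this]
      refine isClosed_iInter fun c => isClosed_iInter fun d => ?_
      by_cases hcd : c ≤ d ∨ d ≤ c
      · simp [hcd]
      · simp only [hcd, false_or]
        exact isClosed_eq ((continuous_apply c).mul (continuous_apply d)) continuous_const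
    exact h1.inter (h2.inter (h3.inter h4))
  refine (isCompact_univ_pi fun _ : C => isCompact_Icc (a := (0 : ℝ)) (b := 1)).of_isClosed_subset
    hcl fun w hw c _ => ⟨hw.1 c, le_one_of_mem_realization hw c⟩

/-- A map that is an order embedding on `T` induces a homeomorphism of realizations. -/
theorem exists_homeomorph_realization_image {T : Set C} {f : C → C'}
    (hf : ∀ c ∈ T, ∀ d ∈ T, f c ≤ f d ↔ c ≤ d) :
    ∃ h : realization (f '' T) ≃ₜ realization T, (∀ w, ∀ c ∈ T, (h w : C → ℝ) c = (w : C' → ℝ) (f c)) ∧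
      ∀ (w : realization (f '' T)), ∀ U ⊆ T,
        ((w : C' → ℝ) ∈ realization (f '' U) ↔ (h w : C → ℝ) ∈ realization U) := by
  classical
  have hinj : ∀ c ∈ T, ∀ d ∈ T, f c = f d → c = d := fun c hc d hd e =>
    le_antisymm ((hf c hc d hd).1 e.le) ((hf d hd c hc).1 e.ge)
  -- Weights are pulled back along `f`. The zero off `T` keeps the total weight equal to one.
  let p : (C' → ℝ) → C → ℝ := fun w c => if c ∈ T then w (f c) else 0
  have hpT : ∀ w c, c ∈ T → p w c = w (f c) := fun w c hc => if_pos hc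
  have hpN : ∀ w c, p w c ≠ 0 → c ∈ T := fun w c hc => by
    by_contra h
    exact hc (if_neg h)
  have hsum : ∀ w : C' → ℝ, (∀ y, w y ≠ 0 → y ∈ f '' T) → ∑ c, p w c = ∑ y, w y := by
    intro w hw
    have e1 : ∑ c, p w c = ∑ c ∈ Finset.univ.filter (· ∈ T), w (f c) := by
      rw [Finset.sum_filter]
    rw [e1, ← Finset.sum_image (f := w) (s := Finset.univ.filter (· ∈ T)) (g := f)]
    · apply Finset.sum_subset (Finset.subset_univ _)
      intro y _ hy
      by_contra hne
      obtain ⟨c, hc, rfl⟩ := hw y hne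
      exact hy (Finset.mem_image_of_mem _ (by simpa using hc))
    · intro c hc d hd e
      exact hinj c (by simpa using hc) d (by simpa using hd) e
  have hmaps : ∀ U ⊆ T, ∀ w ∈ realization (f '' U), p w ∈ realization U := by
    intro U hU w hw
    refine ⟨fun c => ?_, ?_, fun c hc => ?_, fun c d hc hd => ?_⟩
    · by_cases hc : c ∈ T
      · rw [hpT w c hc]; exact hw.1 _
      · simp [p, hc]
    · rw [hsum w fun y hy => Set.image_mono hU (hw.2.2.1 y hy), hw.2.1]
    · have hcT := hpN w c hc
      rw [hpT w c hcT] at hc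
      obtain ⟨d, hd, e⟩ := hw.2.2.1 _ hc
      exact hinj d (hU hd) c hcT e ▸ hd
    · have hcT := hpN w c hc
      have hdT := hpN w d hd
      rw [hpT w _ hcT] at hc
      rw [hpT w _ hdT] at hd
      exact (hw.2.2.2 _ _ hc hd).imp (hf c hcT d hdT).1 (hf d hdT c hcT).1
  have hback : ∀ U ⊆ T, ∀ w ∈ realization (f '' T), p w ∈ realization U →
      w ∈ realization (f '' U) := by
    intro U hU w hw h
    refine mem_realization_of_subset hw fun y hy => ?_
    obtain ⟨c, hc, rfl⟩ := hw.2.2.1 y hy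
    exact ⟨c, h.2.2.1 c (by rwa [hpT w c hc]), rfl⟩
  have hcont : Continuous p := by
    refine continuous_pi fun c => ?_
    by_cases hc : c ∈ T
    · simpa [p, hc] using continuous_apply (f c)
    · simpa [p, hc] using continuous_const
  have hbij : Set.BijOn p (realization (f '' T)) (realization T) := by
    refine ⟨hmaps T subset_rfl, fun w hw w' hw' e => ?_, fun x hx => ?_⟩
    · funext y
      by_cases hy : y ∈ f '' T
      · obtain ⟨c, hc, rfl⟩ := hy
        have := congrFun e c
        rwa [hpT _ c hc, hpT _ c hc] at this
      · rw [not_not.1 fun h => hy (hw.2.2.1 y h), not_not.1 fun h => hy (hw'.2.2.1 y h)]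
    -- The inverse pushes weights forward; the chosen preimage is the only one in `T`, as `f` is
    -- injective there.
    · let w : C' → ℝ := fun y => if h : y ∈ f '' T then x h.choose else 0
      have hw : ∀ c ∈ T, w (f c) = x c := fun c hc => by
        have h : f c ∈ f '' T := ⟨c, hc, rfl⟩
        simp only [w, dif_pos h]
        rw [hinj _ h.choose_spec.1 c hc h.choose_spec.2]
      have hwN : ∀ y, w y ≠ 0 → y ∈ f '' T := fun y hy => by
        by_contra h
        exact hy (dif_neg h)
      have hpw : p w = x := by
        funext c
        by_cases hc : c ∈ T
        · rw [hpT _ c hc, hw c hc]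
        · rw [not_not.1 fun h => hc (hpN w c h), not_not.1 fun h => hc (hx.2.2.1 c h)]
      refine ⟨w, ⟨fun y => ?_, ?_, hwN, fun y z hy hz => ?_⟩, hpw⟩
      · by_cases h : y ∈ f '' T
        · simp only [w, dif_pos h]; exact hx.1 _
        · exact (dif_neg h : w y = 0).ge
      · rw [← hsum w hwN, hpw, hx.2.1]
      · obtain ⟨c, hc, rfl⟩ := hwN y hy
        obtain ⟨d, hd, rfl⟩ := hwN z hz
        rw [hw _ hc] at hy
        rw [hw _ hd] at hz
        exact (hx.2.2.2 _ _ hy hz).imp (hf c hc d hd).2 (hf d hd c hc).2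
  obtain ⟨h, hh⟩ := exists_homeomorph_of_bijOn (isCompact_realization _) hcont.continuousOn hbij
  refine ⟨h, fun w c hc => by rw [hh, hpT _ c hc], fun w U hU => ?_⟩
  rw [hh]
  exact ⟨hmaps U hU w, hback U hU w w.2⟩

/-- Ball conditions depend only on the order induced on the set of cells. This carries them to
halves, suspensions and disjoint unions. -/
theorem isBallPair_image_iff {T U : Set C} (hU : U ⊆ T) {f : C → C'}
    (hf : ∀ c ∈ T, ∀ d ∈ T, f c ≤ f d ↔ c ≤ d) (n : ℕ) :
    IsBallPair n (realization (f '' T)) (realization (f '' U)) ↔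
      IsBallPair n (realization T) (realization U) := by
  obtain ⟨h, -, hh⟩ := exists_homeomorph_realization_image hf
  refine ⟨fun hb => hb.of_homeomorph h.symm fun w => ?_,
    fun hb => hb.of_homeomorph h fun w => hh w U hU⟩
  have := hh (h.symm w) U hU
  rw [h.apply_symm_apply] at this
  exact this.symm

/-- The boundary of a ball pair is a sphere. -/
theorem IsBallPair.exists_homeomorph_sphere {n : ℕ} {T U : Set C} (hU : U ⊆ T)
    (h : IsBallPair n (realization T) (realization U)) :
    ∃ (H : realization T ≃ₜ Metric.closedBall (0 : EuclideanSpace ℝ (Fin n)) 1)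
      (g : realization U ≃ₜ Metric.sphere (0 : EuclideanSpace ℝ (Fin n)) 1),
      (∀ x : realization T, (x : C → ℝ) ∈ realization U ↔
        ‖(H x : EuclideanSpace ℝ (Fin n))‖ = 1) ∧
      ∀ w (hw : w ∈ realization U), (g ⟨w, hw⟩ : EuclideanSpace ℝ (Fin n)) =
        H ⟨w, realization_mono hU hw⟩ := by
  classical
  obtain ⟨H, hH⟩ := h
  let f : (C → ℝ) → EuclideanSpace ℝ (Fin n) :=
    fun x => if hx : x ∈ realization T then H ⟨x, hx⟩ else 0
  have hf : ∀ x (hx : x ∈ realization T), f x = H ⟨x, hx⟩ := fun x hx => dif_pos hx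
  have hc : ContinuousOn f (realization T) := by
    rw [continuousOn_iff_continuous_domRestrict]
    exact (continuous_subtype_val.comp H.continuous).congr fun x => (hf x x.2).symm
  have hm := realization_mono hU
  have hb : Set.BijOn f (realization U) (Metric.sphere 0 1) := by
    refine ⟨fun x hx => ?_, fun x hx y hy e => ?_, fun y hy => ?_⟩
    · rw [hf x (hm hx), mem_sphere_zero_iff_norm]
      exact (hH ⟨x, hm hx⟩).1 hx
    · rw [hf x (hm hx), hf y (hm hy)] at e
      exact congrArg Subtype.val (H.injective (Subtype.ext e))
    · have hy' := Metric.sphere_subset_closedBall hy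
      have e : f (H.symm ⟨y, hy'⟩).1 = y := by
        rw [hf _ (H.symm ⟨y, hy'⟩).2]; simp
      refine ⟨_, (hH (H.symm ⟨y, hy'⟩)).2 ?_, e⟩
      simpa using hy
  obtain ⟨g, hg⟩ := exists_homeomorph_of_bijOn (isCompact_realization U) (hc.mono hm) hb
  exact ⟨H, g, hH, fun w hw => (hg _).trans (hf w (hm hw))⟩

end Topology

/-! ### Cones over spheres in barycentric coordinates -/

section Join

variable {C : Type} [Fintype C]

open Classical in
/-- The total weight of `w` on `U`. -/
noncomputable def weightOn (U : Set C) (w : C → ℝ) : ℝ := ∑ c, if c ∈ U then w c else 0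

open Classical in
/-- The normalized restriction of `w` to `U`. -/
noncomputable def normalizeOn (U : Set C) (w : C → ℝ) : C → ℝ :=
  fun c => if c ∈ U then (weightOn U w)⁻¹ * w c else 0

theorem continuous_weightOn (U : Set C) : Continuous (weightOn U) := by
  classical
  refine continuous_finsetSum _ fun c _ => ?_
  by_cases h : c ∈ U
  · simpa [h] using continuous_apply c
  · simpa [h] using continuous_const

theorem mul_normalizeOn {U : Set C} {w : C → ℝ} (h : weightOn U w ≠ 0) {c : C} (hc : c ∈ U) :
    weightOn U w * normalizeOn U w c = w c := by
  classical
  simp only [normalizeOn, if_pos hc]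
  rw [mul_inv_cancel_left₀ h]

variable [PartialOrder C]

theorem weightOn_nonneg {T : Set C} {w : C → ℝ} (U : Set C) (hw : w ∈ realization T) :
    0 ≤ weightOn U w :=
  Finset.sum_nonneg fun c _ => by split_ifs; exacts [hw.1 c, le_rfl]

theorem weightOn_eq_zero {T : Set C} {w : C → ℝ} {U : Set C} (hw : w ∈ realization T)
    (h : weightOn U w = 0) {c : C} (hc : c ∈ U) : w c = 0 := by
  classical
  have := (Finset.sum_eq_zero_iff_of_nonneg (fun c _ => by
    split_ifs; exacts [hw.1 c, le_rfl])).1 h c (Finset.mem_univ c)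
  rwa [if_pos hc] at this

theorem weightOn_self {U : Set C} {w : C → ℝ} (hw : w ∈ realization U) : weightOn U w = 1 := by
  classical
  rw [← hw.2.1]
  refine Finset.sum_congr rfl fun c _ => ?_
  split_ifs with h
  · rfl
  · exact (not_not.1 fun h' => h (hw.2.2.1 c h')).symm

theorem normalizeOn_self {U : Set C} {w : C → ℝ} (hw : w ∈ realization U) :
    normalizeOn U w = w := by
  classical
  funext c
  simp only [normalizeOn, weightOn_self hw, inv_one, one_mul]
  split_ifs with h
  · rfl
  · exact (not_not.1 fun h' => h (hw.2.2.1 c h')).symm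

theorem normalizeOn_mem {T U : Set C} {w : C → ℝ} (hw : w ∈ realization T)
    (h : weightOn U w ≠ 0) : normalizeOn U w ∈ realization U := by
  classical
  have hp : 0 < weightOn U w := lt_of_le_of_ne (weightOn_nonneg U hw) h.symm
  have hz : ∀ c, normalizeOn U w c ≠ 0 → c ∈ U ∧ w c ≠ 0 := fun c hc => by
    by_cases hU : c ∈ U
    · refine ⟨hU, fun h0 => hc ?_⟩
      simp [normalizeOn, h0]
    · exact absurd (if_neg hU) hc
  refine ⟨fun c => ?_, ?_, fun c hc => (hz c hc).1,
    fun c d hc hd => hw.2.2.2 c d (hz c hc).2 (hz d hd).2⟩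
  · unfold normalizeOn
    split_ifs
    · exact mul_nonneg (inv_nonneg.2 hp.le) (hw.1 c)
    · exact le_rfl
  · have : ∀ c, normalizeOn U w c = (weightOn U w)⁻¹ * if c ∈ U then w c else 0 := fun c => by
      unfold normalizeOn; split_ifs <;> simp
    simp only [this]
    rw [← Finset.mul_sum]
    exact inv_mul_cancel₀ h

open Classical in
/-- The radially constant extension of a map on the realization of `U`. -/
noncomputable def radialExtension {E : Type} [Zero E] {U : Set C} (g : realization U → E)
    (w : C → ℝ) : E :=
  if h : normalizeOn U w ∈ realization U then g ⟨normalizeOn U w, h⟩ else 0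

theorem radialExtension_of_mem {E : Type} [Zero E] {U : Set C} (g : realization U → E)
    {w : C → ℝ} (h : normalizeOn U w ∈ realization U) :
    radialExtension g w = g ⟨normalizeOn U w, h⟩ := dif_pos h

theorem radialExtension_self {E : Type} [Zero E] {U : Set C} (g : realization U → E)
    {w : C → ℝ} (h : w ∈ realization U) : radialExtension g w = g ⟨w, h⟩ := by
  have e := normalizeOn_self h
  rw [radialExtension_of_mem g (by rwa [e])]
  congr 1
  exact Subtype.ext e

/-- The radial extension has no limit where the weight on `U` vanishes, but it stays bounded; a
factor `φ` that vanishes there makes the product continuous. -/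
theorem continuousOn_smul_radialExtension {E : Type} [NormedAddCommGroup E] [NormedSpace ℝ E]
    {T U : Set C} {g : realization U → E} (hg : Continuous g) (hb : ∀ x, ‖g x‖ ≤ 1)
    {φ : (C → ℝ) → ℝ} (hφ : Continuous φ)
    (h0 : ∀ w ∈ realization T, weightOn U w = 0 → φ w = 0) :
    ContinuousOn (fun w => φ w • radialExtension g w) (realization T) := by
  classical
  have hbound : ∀ w, ‖radialExtension g w‖ ≤ 1 := fun w => by
    unfold radialExtension
    split_ifs
    · exact hb _
    · simp
  intro w hw
  by_cases hz : weightOn U w = 0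
  · have hφ0 := h0 w hw hz
    have : (fun w => φ w • radialExtension g w) w = 0 := by simp [hφ0]
    unfold ContinuousWithinAt
    rw [this]
    refine squeeze_zero_norm (a := fun w => |φ w|) (fun v => ?_) ?_
    · rw [norm_smul, Real.norm_eq_abs]
      exact mul_le_of_le_one_right (abs_nonneg _) (hbound v)
    · have : Filter.Tendsto (fun w => |φ w|) (nhds w) (nhds |φ w|) := (hφ.abs).tendsto w
      rw [hφ0, abs_zero] at this
      exact this.mono_left nhdsWithin_le_nhds
  -- Off the zero set of the weight the normalization itself is continuous, and this is an open
  -- condition.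
  · have hopen : IsOpen {w : C → ℝ | weightOn U w ≠ 0} :=
      isOpen_ne_fun (continuous_weightOn U) continuous_const
    have key : ContinuousOn (fun w => φ w • radialExtension g w)
        (realization T ∩ {w | weightOn U w ≠ 0}) := by
      refine hφ.continuousOn.smul ?_
      rw [continuousOn_iff_continuous_domRestrict]
      have hm : ∀ v : ↥(realization T ∩ {w | weightOn U w ≠ 0}),
          normalizeOn U v.1 ∈ realization U := fun v => normalizeOn_mem v.2.1 v.2.2
      have hn : Continuous fun v : ↥(realization T ∩ {w | weightOn U w ≠ 0}) =>
          normalizeOn U v.1 := by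
        refine continuous_pi fun c => ?_
        by_cases hc : c ∈ U
        · simp only [normalizeOn, if_pos hc]
          exact (((continuous_weightOn U).comp continuous_subtype_val).inv₀ fun v => v.2.2).mul
            ((continuous_apply c).comp continuous_subtype_val)
        · simp only [normalizeOn, if_neg hc]
          exact continuous_const
      refine (hg.comp (hn.subtype_mk hm)).congr fun v => ?_
      exact (radialExtension_of_mem g (hm v)).symm
    exact (key w ⟨hw, hz⟩).mono_of_mem_nhdsWithin
      (Filter.inter_mem self_mem_nhdsWithin (mem_nhdsWithin_of_mem_nhds (hopen.mem_nhds hz)))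

theorem weightOn_add_apply {U : Set C} {p : C} (hp : p ∉ U) {w : C → ℝ}
    (hw : w ∈ realization (insert p U)) : weightOn U w + w p = 1 := by
  classical
  rw [← hw.2.1]
  have : w p = ∑ c, if c = p then w c else 0 := by simp
  rw [this]
  unfold weightOn
  rw [← Finset.sum_add_distrib]
  refine Finset.sum_congr rfl fun c _ => ?_
  by_cases hc : c = p
  · subst hc; simp [hp]
  · by_cases hU : c ∈ U
    · simp [hc, hU]
    · have : w c = 0 := not_not.1 fun h => by
        rcases hw.2.2.1 c h with h | h
        exacts [hc h, hU h]
      simp [this]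

open Classical in
/-- The point of the cone over `u` with apex `p`, at distance `s` from the apex. -/
noncomputable def conePoint (p : C) (s : ℝ) (u : C → ℝ) : C → ℝ :=
  fun c => if c = p then 1 - s else s * u c

/-- A chain stays a chain when an element comparable with all of `U` is added. The apex carries the
remaining weight `1 - s`, which leaves `s` as the radial coordinate. -/
theorem conePoint_mem {U : Set C} {p : C} (hp : p ∉ U) (hle : ∀ u ∈ U, p ≤ u ∨ u ≤ p)
    {s : ℝ} (h0 : 0 ≤ s) (h1 : s ≤ 1) {u : C → ℝ} (hu : u ∈ realization U) :
    conePoint p s u ∈ realization (insert p U) ∧ weightOn U (conePoint p s u) = s := by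
  classical
  have hup : u p = 0 := not_not.1 fun h => hp (hu.2.2.1 p h)
  have hz : ∀ c, conePoint p s u c ≠ 0 → c = p ∨ (c ≠ p ∧ u c ≠ 0) := fun c hc => by
    by_cases h : c = p
    · exact Or.inl h
    · refine Or.inr ⟨h, fun h' => hc ?_⟩
      simp [conePoint, h, h']
  have hmem : conePoint p s u ∈ realization (insert p U) := by
    refine ⟨fun c => ?_, ?_, fun c hc => ?_, fun c d hc hd => ?_⟩
    · unfold conePoint
      split_ifs
      · linarith
      · exact mul_nonneg h0 (hu.1 c)
    · have : ∀ c, conePoint p s u c = (if c = p then 1 - s else 0) + s * u c := fun c => by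
        unfold conePoint
        split_ifs with h
        · rw [h, hup]; ring
        · ring
      simp only [this]
      rw [Finset.sum_add_distrib, ← Finset.mul_sum, hu.2.1]
      simp
    · exact (hz c hc).imp id fun h => hu.2.2.1 c h.2
    · rcases hz c hc with rfl | ⟨-, hc'⟩ <;> rcases hz d hd with rfl | ⟨-, hd'⟩
      · exact Or.inl le_rfl
      · exact hle d (hu.2.2.1 d hd')
      · exact (hle c (hu.2.2.1 c hc')).symm
      · exact hu.2.2.2 c d hc' hd'
  refine ⟨hmem, ?_⟩
  have := weightOn_add_apply hp hmem
  simp only [conePoint, if_true] at this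
  linarith

theorem normalizeOn_conePoint {U : Set C} {p : C} (hp : p ∉ U) (hle : ∀ u ∈ U, p ≤ u ∨ u ≤ p)
    {s : ℝ} (h0 : 0 < s) (h1 : s ≤ 1) {u : C → ℝ} (hu : u ∈ realization U) :
    normalizeOn U (conePoint p s u) = u := by
  classical
  funext c
  unfold normalizeOn
  rw [(conePoint_mem hp hle h0.le h1 hu).2]
  split_ifs with h
  · have : c ≠ p := fun e => hp (e ▸ h)
    simp only [conePoint, if_neg this]
    field_simp
  · exact (not_not.1 fun h' => h (hu.2.2.1 c h')).symm

theorem single_mem_realization [DecidableEq C] {T : Set C} {p : C} (hp : p ∈ T) :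
    Pi.single p (1 : ℝ) ∈ realization T := by
  have hz : ∀ c, (Pi.single p 1 : C → ℝ) c ≠ 0 → c = p := fun c hc => by
    by_contra h
    simp [h] at hc
  refine ⟨fun c => ?_, by simp, fun c hc => hz c hc ▸ hp, fun c d hc hd => ?_⟩
  · by_cases h : c = p
    · subst h; simp
    · simp [h]
  · rw [hz c hc, hz d hd]; exact Or.inl le_rfl

/-- Polar coordinates on the cone: the weight on `U` is the radius, the normalization on `U` is the
direction, and the direction is irrelevant at the apex. -/
theorem eq_of_weightOn_eq {U : Set C} {p : C} (hp : p ∉ U) {w w' : C → ℝ}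
    (hw : w ∈ realization (insert p U)) (hw' : w' ∈ realization (insert p U))
    (h : weightOn U w = weightOn U w')
    (hn : weightOn U w ≠ 0 → normalizeOn U w = normalizeOn U w') : w = w' := by
  funext c
  have h1 := weightOn_add_apply hp hw
  have h2 := weightOn_add_apply hp hw'
  by_cases hc : c = p
  · subst hc; linarith
  by_cases hU : c ∈ U
  · by_cases h0 : weightOn U w = 0
    · rw [weightOn_eq_zero hw h0 hU, weightOn_eq_zero hw' (h ▸ h0) hU]
    · rw [← mul_normalizeOn h0 hU, ← mul_normalizeOn (w := w') (h ▸ h0) hU, h, hn h0]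
  · have e : ∀ v ∈ realization (insert p U), v c = 0 := fun v hv => not_not.1 fun h => by
      rcases hv.2.2.1 c h with h | h
      exacts [hc h, hU h]
    rw [e w hw, e w' hw']

/-- The cone over a sphere is a ball. -/
theorem exists_homeomorph_cone {n : ℕ} {U : Set C} {p : C} (hp : p ∉ U)
    (hle : ∀ u ∈ U, p ≤ u ∨ u ≤ p)
    (g : realization U ≃ₜ Metric.sphere (0 : EuclideanSpace ℝ (Fin n)) 1) :
    ∃ H : realization (insert p U) ≃ₜ Metric.closedBall (0 : EuclideanSpace ℝ (Fin n)) 1,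
      (∀ w (hw : w ∈ realization U), (H ⟨w, realization_mono (Set.subset_insert p U) hw⟩ :
        EuclideanSpace ℝ (Fin n)) = g ⟨w, hw⟩) ∧
      ∀ w : realization (insert p U), (w : C → ℝ) ∈ realization U ↔
        ‖(H w : EuclideanSpace ℝ (Fin n))‖ = 1 := by
  classical
  let g' : realization U → EuclideanSpace ℝ (Fin n) := fun x => g x
  have hg' : ∀ x, ‖g' x‖ = 1 := fun x => mem_sphere_zero_iff_norm.1 (g x).2
  -- Polar coordinates are matched with polar coordinates of the ball: radius `weightOn U w`,
  -- direction given by `g`. The apex goes to the center.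
  let f : (C → ℝ) → EuclideanSpace ℝ (Fin n) := fun w => weightOn U w • radialExtension g' w
  have hcont : ContinuousOn f (realization (insert p U)) :=
    continuousOn_smul_radialExtension (continuous_subtype_val.comp g.continuous)
      (fun x => (hg' x).le) (continuous_weightOn U) fun w _ h => h
  have hnorm : ∀ w ∈ realization (insert p U), ‖f w‖ = weightOn U w := by
    intro w hw
    simp only [f, norm_smul, Real.norm_eq_abs, abs_of_nonneg (weightOn_nonneg U hw)]
    by_cases h0 : weightOn U w = 0
    · rw [h0, zero_mul]
    · rw [radialExtension_of_mem g' (normalizeOn_mem hw h0), hg', mul_one]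
  have hle1 : ∀ w ∈ realization (insert p U), weightOn U w ≤ 1 := fun w hw => by
    have := weightOn_add_apply hp hw
    have := hw.1 p
    linarith
  have hbij : Set.BijOn f (realization (insert p U)) (Metric.closedBall 0 1) := by
    refine ⟨fun w hw => ?_, fun w hw w' hw' e => ?_, fun y hy => ?_⟩
    · rw [mem_closedBall_zero_iff, hnorm w hw]; exact hle1 w hw
    · have h : weightOn U w = weightOn U w' := by
        rw [← hnorm w hw, ← hnorm w' hw', e]
      refine eq_of_weightOn_eq hp hw hw' h fun h0 => ?_
      simp only [f] at e
      rw [← h] at e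
      have e := smul_right_injective _ h0 e
      rw [radialExtension_of_mem g' (normalizeOn_mem hw h0),
        radialExtension_of_mem g' (normalizeOn_mem hw' (h ▸ h0))] at e
      exact congrArg Subtype.val (g.injective (Subtype.ext e))
    · rw [mem_closedBall_zero_iff] at hy
      -- The center is the image of the apex; any other point has a direction, whose preimage under
      -- `g` spans the required ray.
      by_cases h0 : y = 0
      · have hs := single_mem_realization (T := insert p U) (Set.mem_insert p U)
        refine ⟨Pi.single p 1, hs, ?_⟩
        rw [h0, ← norm_eq_zero, hnorm _ hs]
        have := weightOn_add_apply hp hs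
        simpa using this
      · have hpos : 0 < ‖y‖ := norm_pos_iff.2 h0
        have hy1 : ‖y‖⁻¹ • y ∈ Metric.sphere (0 : EuclideanSpace ℝ (Fin n)) 1 := by
          rw [mem_sphere_zero_iff_norm, norm_smul, norm_inv, norm_norm,
            inv_mul_cancel₀ hpos.ne']
        have hu := (g.symm ⟨_, hy1⟩).2
        refine ⟨_, (conePoint_mem hp hle hpos.le hy hu).1, ?_⟩
        simp only [f]
        have e := normalizeOn_conePoint hp hle hpos hy hu
        rw [(conePoint_mem hp hle hpos.le hy hu).2, radialExtension_of_mem g' (by rwa [e])]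
        have e2 : g' ⟨_, (e.symm ▸ hu : normalizeOn U (conePoint p ‖y‖ _) ∈ realization U)⟩ =
            ‖y‖⁻¹ • y := by
          have e3 : (⟨_, (e.symm ▸ hu : normalizeOn U (conePoint p ‖y‖ _) ∈ realization U)⟩ :
            realization U) = g.symm ⟨_, hy1⟩ := Subtype.ext e
          simp only [g']
          rw [e3, g.apply_symm_apply]
        rw [e2, smul_smul, mul_inv_cancel₀ hpos.ne', one_smul]
  obtain ⟨H, hH⟩ := exists_homeomorph_of_bijOn (isCompact_realization _) hcont hbij
  refine ⟨H, fun w hw => ?_, fun w => ?_⟩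
  · rw [hH]
    simp only [f]
    rw [weightOn_self hw, one_smul, radialExtension_self g' hw]
  · rw [hH, hnorm w w.2]
    constructor
    · exact fun h => weightOn_self h
    · intro h
      refine mem_realization_of_subset w.2 fun c hc => ?_
      rcases w.2.2.2.1 c hc with h' | h'
      · have := weightOn_add_apply hp w.2
        rw [h'] at hc
        exact absurd (by linarith) hc
      · exact h'

theorem isBallPair_cone {n : ℕ} {U : Set C} {p : C} (hp : p ∉ U)
    (hle : ∀ u ∈ U, p ≤ u ∨ u ≤ p)
    (g : realization U ≃ₜ Metric.sphere (0 : EuclideanSpace ℝ (Fin n)) 1) :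
    IsBallPair n (realization (insert p U)) (realization U) := by
  obtain ⟨H, -, hH⟩ := exists_homeomorph_cone hp hle g
  exact ⟨H, hH⟩

/-- A point is the cone over the empty set, and the unit sphere of the zero-dimensional space is
empty. -/
theorem isBallPair_point {p : C} :
    IsBallPair 0 (realization {p}) (realization (∅ : Set C)) := by
  have h1 : IsEmpty (realization (∅ : Set C)) := ⟨fun w => by
    have h : ∀ c, w.1 c = 0 := fun c => not_not.1 fun h => w.2.2.2.1 c h
    have := w.2.2.1
    simp [h] at this⟩
  have h2 : IsEmpty (Metric.sphere (0 : EuclideanSpace ℝ (Fin 0)) 1) := ⟨fun y => by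
    have := mem_sphere_zero_iff_norm.1 y.2
    rw [Subsingleton.elim y.1 0, norm_zero] at this
    exact zero_ne_one this⟩
  have := isBallPair_cone (Set.notMem_empty p) (by simp) (Homeomorph.empty (X := realization (∅ : Set C))
    (Y := Metric.sphere (0 : EuclideanSpace ℝ (Fin 0)) 1))
  rwa [insert_empty_eq] at this

end Join

/-! ### Suspensions of spheres, and replacing a ball by a cone -/

section Suspension

variable {C : Type} [Fintype C] [PartialOrder C]

/-- Incomparable elements cannot both carry weight, so the suspension is the union of the two cones.
-/
theorem mem_realization_insert_or {U : Set C} {p q : C} (hpq : ¬p ≤ q) (hqp : ¬q ≤ p)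
    {w : C → ℝ} (hw : w ∈ realization (insert p (insert q U))) :
    (w q = 0 ∧ w ∈ realization (insert p U)) ∨ (w p = 0 ∧ w ∈ realization (insert q U)) := by
  by_cases hq : w q = 0
  · refine Or.inl ⟨hq, mem_realization_of_subset hw fun c hc => ?_⟩
    rcases hw.2.2.1 c hc with h | h | h
    · exact Or.inl h
    · exact absurd (h ▸ hq) hc
    · exact Or.inr h
  · have hp : w p = 0 := not_not.1 fun hp => (hw.2.2.2 p q hp hq).elim hpq hqp
    refine Or.inr ⟨hp, mem_realization_of_subset hw fun c hc => ?_⟩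
    rcases hw.2.2.1 c hc with h | h
    · exact absurd (h ▸ hp) hc
    · exact h

/-- Surjectivity of the cone onto a closed hemisphere: the height `a` is the weight of the apex, and
`√(1 - a ^ 2)` is the radius of the sphere cut out at this height. -/
theorem exists_mem_cone {n : ℕ} {U : Set C} {p : C} (hp : p ∉ U) (hle : ∀ u ∈ U, p ≤ u ∨ u ≤ p)
    (g : realization U ≃ₜ Metric.sphere (0 : EuclideanSpace ℝ (Fin n)) 1) {a : ℝ} (ha : 0 ≤ a)
    {y : EuclideanSpace ℝ (Fin n)} (hy : a ^ 2 + ‖y‖ ^ 2 = 1) :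
    ∃ w ∈ realization (insert p U), w p = a ∧
      √(1 - a ^ 2) • radialExtension (fun x => (g x : EuclideanSpace ℝ (Fin n))) w = y := by
  classical
  have hyn : √(1 - a ^ 2) = ‖y‖ := by
    rw [← Real.sqrt_sq (norm_nonneg y)]
    congr 1
    linarith
  rw [hyn]
  -- At the pole there is no direction to lift; the apex itself is taken.
  by_cases h0 : y = 0
  · subst h0
    have : a = 1 := by
      rw [norm_zero] at hy
      nlinarith
    exact ⟨Pi.single p 1, single_mem_realization (Set.mem_insert p U), by simp [this], by simp⟩
  · have hpos : 0 < ‖y‖ := norm_pos_iff.2 h0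
    have ha1 : a < 1 := by nlinarith
    have hy1 : ‖y‖⁻¹ • y ∈ Metric.sphere (0 : EuclideanSpace ℝ (Fin n)) 1 := by
      rw [mem_sphere_zero_iff_norm, norm_smul, norm_inv, norm_norm, inv_mul_cancel₀ hpos.ne']
    have hu := (g.symm ⟨_, hy1⟩).2
    have hs0 : 0 < 1 - a := by linarith
    have hs1 : 1 - a ≤ 1 := by linarith
    have e := normalizeOn_conePoint hp hle hs0 hs1 hu
    refine ⟨_, (conePoint_mem hp hle hs0.le hs1 hu).1, by simp [conePoint], ?_⟩
    rw [radialExtension_of_mem _ (by rwa [e])]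
    have e3 : (⟨_, (e.symm ▸ hu : normalizeOn U (conePoint p (1 - a) _) ∈ realization U)⟩ :
      realization U) = g.symm ⟨_, hy1⟩ := Subtype.ext e
    rw [e3, g.apply_symm_apply, smul_smul, mul_inv_cancel₀ hpos.ne', one_smul]

/-- The suspension of a sphere is a sphere. -/
theorem exists_homeomorph_suspension {n : ℕ} {U : Set C} {p q : C} (hp : p ∉ U) (hq : q ∉ U)
    (hpq : ¬p ≤ q) (hqp : ¬q ≤ p) (hlep : ∀ u ∈ U, p ≤ u ∨ u ≤ p)
    (hleq : ∀ u ∈ U, q ≤ u ∨ u ≤ q)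
    (g : realization U ≃ₜ Metric.sphere (0 : EuclideanSpace ℝ (Fin n)) 1) :
    Nonempty (realization (insert p (insert q U)) ≃ₜ
      Metric.sphere (0 : EuclideanSpace ℝ (Fin (n + 1))) 1) := by
  classical
  -- With the `L²` norm on the product the unit sphere is round, and an orthonormal basis identifies
  -- it with the standard one.
  let F := WithLp 2 (ℝ × EuclideanSpace ℝ (Fin n))
  let g' : realization U → EuclideanSpace ℝ (Fin n) := fun x => g x
  have hg' : ∀ x, ‖g' x‖ = 1 := fun x => mem_sphere_zero_iff_norm.1 (g x).2
  -- The height of a point is `w p - w q`, and `φ` is the radius of the horizontal slice of the unit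
  -- sphere at this height.
  let φ : (C → ℝ) → ℝ := fun w => √(1 - (w p - w q) ^ 2)
  let f : (C → ℝ) → F := fun w => WithLp.toLp 2 (w p - w q, φ w • radialExtension g' w)
  have hcases : ∀ w ∈ realization (insert p (insert q U)),
      (w q = 0 ∧ 0 ≤ w p ∧ weightOn U w + w p = 1 ∧ w ∈ realization (insert p U)) ∨
      (w p = 0 ∧ 0 ≤ w q ∧ weightOn U w + w q = 1 ∧ w ∈ realization (insert q U)) := by
    intro w hw
    rcases mem_realization_insert_or hpq hqp hw with ⟨h, h'⟩ | ⟨h, h'⟩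
    · exact Or.inl ⟨h, hw.1 p, weightOn_add_apply hp h', h'⟩
    · exact Or.inr ⟨h, hw.1 q, weightOn_add_apply hq h', h'⟩
  have hφ : Continuous φ := by
    have h1 := continuous_apply (A := fun _ : C => ℝ) p
    have h2 := continuous_apply (A := fun _ : C => ℝ) q
    exact (continuous_const.sub ((h1.sub h2).pow 2)).sqrt
  have hcont : ContinuousOn f (realization (insert p (insert q U))) := by
    have h1 := continuous_apply (A := fun _ : C => ℝ) p
    have h2 := continuous_apply (A := fun _ : C => ℝ) q
    refine (WithLp.prod_continuous_toLp 2 ℝ (EuclideanSpace ℝ (Fin n))).comp_continuousOn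
      ((h1.sub h2).continuousOn.prodMk ?_)
    refine continuousOn_smul_radialExtension (continuous_subtype_val.comp g.continuous)
      (fun x => (hg' x).le) hφ fun w hw h => ?_
    simp only [φ]
    rcases hcases w hw with ⟨h1, -, h2, -⟩ | ⟨h1, -, h2, -⟩
    · rw [h1, show w p = 1 by linarith]; simp
    · rw [h1, show w q = 1 by linarith]; simp
  have hφ0 : ∀ w ∈ realization (insert p (insert q U)), weightOn U w ≠ 0 → 0 < φ w ∧
      φ w ^ 2 = 1 - (w p - w q) ^ 2 := by
    intro w hw h0
    have hpos := lt_of_le_of_ne (weightOn_nonneg U hw) h0.symm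
    have : 0 < 1 - (w p - w q) ^ 2 := by
      rcases hcases w hw with ⟨h1, h3, h2, -⟩ | ⟨h1, h3, h2, -⟩ <;> rw [h1] <;> nlinarith
    exact ⟨Real.sqrt_pos.2 this, Real.sq_sqrt this.le⟩
  have hbij : Set.BijOn f (realization (insert p (insert q U))) (Metric.sphere 0 1) := by
    refine ⟨fun w hw => ?_, fun w hw w' hw' e => ?_, fun y hy => ?_⟩
    · rw [mem_sphere_zero_iff_norm, ← sq_eq_sq₀ (norm_nonneg _) zero_le_one,
        WithLp.prod_norm_sq_eq_of_L2]
      change ‖w p - w q‖ ^ 2 + ‖φ w • radialExtension g' w‖ ^ 2 = 1 ^ 2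
      rw [norm_smul, mul_pow, Real.norm_eq_abs, Real.norm_eq_abs, sq_abs, sq_abs]
      by_cases h0 : weightOn U w = 0
      · have hz : φ w ^ 2 = 0 ∧ (w p - w q) ^ 2 = 1 := by
          simp only [φ]
          rcases hcases w hw with ⟨h1, -, h2, -⟩ | ⟨h1, -, h2, -⟩
          · rw [h1, show w p = 1 by linarith]; simp
          · rw [h1, show w q = 1 by linarith]; simp
        rw [hz.1, hz.2]; simp
      · rw [radialExtension_of_mem g' (normalizeOn_mem hw h0), hg', (hφ0 w hw h0).2]
        ring
    · have e0 := congrArg WithLp.ofLp e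
      have e1 : w p - w q = w' p - w' q := congrArg Prod.fst e0
      have e2 : φ w • radialExtension g' w = φ w' • radialExtension g' w' :=
        congrArg Prod.snd e0
      have e3 : φ w = φ w' := by simp only [φ]; rw [e1]
      have hn : weightOn U w = weightOn U w' → weightOn U w ≠ 0 →
          normalizeOn U w = normalizeOn U w' := by
        intro h h0
        rw [← e3] at e2
        have e4 := smul_right_injective _ (hφ0 w hw h0).1.ne' e2
        rw [radialExtension_of_mem g' (normalizeOn_mem hw h0),
          radialExtension_of_mem g' (normalizeOn_mem hw' (h ▸ h0))] at e4
        exact congrArg Subtype.val (g.injective (Subtype.ext e4))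
      have wq : ∀ v : C → ℝ, v ∈ realization (insert p U) → v q = 0 := fun v hv =>
        not_not.1 fun h => by
          rcases hv.2.2.1 q h with h | h
          exacts [hpq h.ge, hq h]
      rcases hcases w hw with ⟨a1, a2, a3, a4⟩ | ⟨a1, a2, a3, a4⟩ <;>
        rcases hcases w' hw' with ⟨b1, b2, b3, b4⟩ | ⟨b1, b2, b3, b4⟩
      · have h : weightOn U w = weightOn U w' := by linarith
        exact eq_of_weightOn_eq hp a4 b4 h (hn h)
      -- Points of opposite cones have heights of opposite signs; equal heights force both to
      -- vanish, so both points lie on the equator.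
      · have h : weightOn U w = weightOn U w' := by linarith
        refine eq_of_weightOn_eq hp a4 ?_ h (hn h)
        refine mem_realization_of_subset hw' fun c hc => ?_
        rcases hw'.2.2.1 c hc with h | h | h
        · exact Or.inl h
        · subst h; exact absurd (by linarith) hc
        · exact Or.inr h
      · have h : weightOn U w = weightOn U w' := by linarith
        refine eq_of_weightOn_eq hp ?_ b4 h (hn h)
        refine mem_realization_of_subset hw fun c hc => ?_
        rcases hw.2.2.1 c hc with h | h | h
        · exact Or.inl h
        · subst h; exact absurd (by linarith) hc
        · exact Or.inr h
      · have h : weightOn U w = weightOn U w' := by linarith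
        exact eq_of_weightOn_eq hq a4 b4 h (hn h)
    · rw [mem_sphere_zero_iff_norm, ← sq_eq_sq₀ (norm_nonneg _) zero_le_one,
        WithLp.prod_norm_sq_eq_of_L2, Real.norm_eq_abs, sq_abs, one_pow] at hy
      have hext : ∀ v : C → ℝ, v p - v q = y.fst → √(1 - y.fst ^ 2) • radialExtension g' v = y.snd →
          f v = y := by
        intro v h1 h2
        simp only [f, φ]
        rw [h1, h2]
        rfl
      rcases le_total 0 y.fst with h | h
      · obtain ⟨w, hw, h1, h2⟩ := exists_mem_cone hp hlep g h hy
        have hwq : w q = 0 := not_not.1 fun h => by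
          rcases hw.2.2.1 q h with h | h
          exacts [hpq h.ge, hq h]
        refine ⟨w, realization_mono (Set.insert_subset_insert (Set.subset_insert q U)) hw,
          hext w (by rw [hwq, h1, sub_zero]) h2⟩
      · obtain ⟨w, hw, h1, h2⟩ := exists_mem_cone hq hleq g (a := -y.fst) (by linarith)
          (by rw [neg_sq]; exact hy)
        have hwp : w p = 0 := not_not.1 fun h => by
          rcases hw.2.2.1 p h with h | h
          exacts [hpq h.le, hp h]
        refine ⟨w, realization_mono (Set.subset_insert p _) hw,
          hext w (by rw [hwp, h1]; ring) (by rwa [neg_sq] at h2)⟩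
  obtain ⟨H, -⟩ := exists_homeomorph_of_bijOn (isCompact_realization _) hcont hbij
  have hdim : Module.finrank ℝ F = n + 1 := by
    rw [(WithLp.linearEquiv 2 ℝ (ℝ × EuclideanSpace ℝ (Fin n))).finrank_eq, Module.finrank_prod,
      finrank_euclideanSpace_fin, Module.finrank_self, add_comm]
  let L : F ≃ₗᵢ[ℝ] EuclideanSpace ℝ (Fin (n + 1)) :=
    ((stdOrthonormalBasis ℝ F).reindex (finCongr hdim)).repr
  exact ⟨H.trans (L.toHomeomorph.subtype fun x => by
    rw [mem_sphere_zero_iff_norm, mem_sphere_zero_iff_norm]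
    exact (congrArg (· = 1) (L.norm_map x)).to_iff.symm)⟩

/-- The realization of `insert p R'` is homeomorphic to that of `R ∪ P` if `R'` is a copy of `R`,
the apex `p` is comparable exactly with the copy of `R ∩ P`, and `P` is a ball bounded by
`R ∩ P`. -/
theorem exists_homeomorph_fill {C' : Type} [Fintype C'] [PartialOrder C'] {n : ℕ} {P R : Set C}
    {f : C → C'} {p : C'} (hP : IsBallPair n (realization P) (realization (R ∩ P)))
    (hRP : ∀ r ∈ R, r ∉ P → ∀ d ∈ P, d ∉ R → ¬r ≤ d ∧ ¬d ≤ r)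
    (hf : ∀ c ∈ R, ∀ d ∈ R, f c ≤ f d ↔ c ≤ d) (hp : p ∉ f '' R)
    (hpf : ∀ r ∈ R, (p ≤ f r ∨ f r ≤ p) ↔ r ∈ P) :
    ∃ h : realization (insert p (f '' R)) ≃ₜ realization (R ∪ P),
      (∀ (w : realization (insert p (f '' R))), ∀ U ⊆ R,
        ((w : C' → ℝ) ∈ realization (f '' U) ↔ (h w : C → ℝ) ∈ realization U)) ∧
      ∀ (w : realization (insert p (f '' R))), ∀ U ⊆ R, R ∩ P ⊆ U →
        ((w : C' → ℝ) ∈ realization (insert p (f '' U)) ↔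
          (h w : C → ℝ) ∈ realization (U ∪ P)) := by
  classical
  obtain ⟨H, g, hH, hg⟩ := hP.exists_homeomorph_sphere Set.inter_subset_right
  obtain ⟨e, he, heU⟩ := exists_homeomorph_realization_image hf
  have hQ : R ∩ P ⊆ R := Set.inter_subset_left
  have hfQ : ∀ c ∈ R ∩ P, ∀ d ∈ R ∩ P, f c ≤ f d ↔ c ≤ d := fun c hc d hd => hf c hc.1 d hd.1
  obtain ⟨e', he', -⟩ := exists_homeomorph_realization_image hfQ
  have hee' : ∀ w (hw : w ∈ realization (f '' (R ∩ P))),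
      (e' ⟨w, hw⟩ : C → ℝ) = e ⟨w, realization_mono (Set.image_mono hQ) hw⟩ := by
    intro w hw
    funext c
    by_cases hc : c ∈ R ∩ P
    · rw [he' _ c hc, he _ c hc.1]
    · rw [not_not.1 fun h => hc ((e' ⟨w, hw⟩).2.2.2.1 c h)]
      have := (heU ⟨w, realization_mono (Set.image_mono hQ) hw⟩ (R ∩ P) hQ).1 hw
      rw [not_not.1 fun h => hc (this.2.2.1 c h)]
  have hpQ : p ∉ f '' (R ∩ P) := fun h => hp (Set.image_mono hQ h)
  -- The cone over the copy of `R ∩ P` and the ball `P` are both balls bounded by the same sphere.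
  -- The cone is parametrized through the boundary map of `P`, so that the identification extends
  -- the one on `R ∩ P`.
  obtain ⟨K, hK, hK1⟩ := exists_homeomorph_cone hpQ
    (by rintro _ ⟨r, hr, rfl⟩; exact (hpf r hr.1).2 hr.2) (e'.trans g)
  let k : realization (insert p (f '' (R ∩ P))) ≃ₜ realization P := K.trans H.symm
  have hk : ∀ w (hw : w ∈ realization (f '' (R ∩ P))),
      (k ⟨w, realization_mono (Set.subset_insert p _) hw⟩ : C → ℝ) = e' ⟨w, hw⟩ := by
    intro w hw
    have h1 := hK w hw
    have h2 : K ⟨w, realization_mono (Set.subset_insert p _) hw⟩ =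
        H ⟨e' ⟨w, hw⟩, realization_mono Set.inter_subset_right (e' ⟨w, hw⟩).2⟩ :=
      Subtype.ext (h1.trans (hg _ (e' ⟨w, hw⟩).2))
    simp only [k, Homeomorph.trans_apply]
    rw [h2, H.symm_apply_apply]
  have hkQ : ∀ w : realization (insert p (f '' (R ∩ P))),
      (w : C' → ℝ) ∈ realization (f '' (R ∩ P)) ↔ (k w : C → ℝ) ∈ realization (R ∩ P) := by
    intro w
    rw [hK1 w, hH]
    simp [k]
  -- A chain in which the apex carries weight contains only elements comparable with the apex, hence
  -- lies in the cone.
  have hunion : realization (insert p (f '' R)) =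
      realization (f '' R) ∪ realization (insert p (f '' (R ∩ P))) := by
    refine Set.Subset.antisymm (fun w hw => ?_) (Set.union_subset
      (realization_mono (Set.subset_insert _ _))
      (realization_mono (Set.insert_subset_insert (Set.image_mono hQ))))
    by_cases h0 : w p = 0
    · refine Or.inl (mem_realization_of_subset hw fun c hc => ?_)
      rcases hw.2.2.1 c hc with h | h
      · exact absurd (h ▸ h0) hc
      · exact h
    · refine Or.inr (mem_realization_of_subset hw fun c hc => ?_)
      rcases hw.2.2.1 c hc with h | ⟨r, hr, rfl⟩
      · exact Or.inl h
      · exact Or.inr ⟨r, ⟨hr, (hpf r hr).1 (hw.2.2.2 _ _ h0 hc)⟩, rfl⟩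
  -- By `hRP` no chain mixes an element of `R` outside `P` with one of `P` outside `R`.
  have hunion' : realization (R ∪ P) = realization R ∪ realization P := by
    refine Set.Subset.antisymm (fun w hw => ?_) (Set.union_subset
      (realization_mono Set.subset_union_left) (realization_mono Set.subset_union_right))
    by_cases h : ∀ c, w c ≠ 0 → c ∈ P
    · exact Or.inr (mem_realization_of_subset hw h)
    · push Not at h
      obtain ⟨c, hc, hcP⟩ := h
      have hcR : c ∈ R := (hw.2.2.1 c hc).resolve_right hcP
      refine Or.inl (mem_realization_of_subset hw fun d hd => ?_)
      by_contra hdR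
      have hdP : d ∈ P := (hw.2.2.1 d hd).resolve_left hdR
      have := hRP c hcR hcP d hdP hdR
      exact (hw.2.2.2 c d hc hd).elim this.1 this.2
  have hcone : ∀ w, w ∈ realization (f '' R) → w ∈ realization (insert p (f '' (R ∩ P))) →
      w ∈ realization (f '' (R ∩ P)) := by
    intro w hw hw'
    refine mem_realization_of_subset hw' fun c hc => ?_
    rcases hw'.2.2.1 c hc with h | h
    · exact absurd (h ▸ hw.2.2.1 c hc) hp
    · exact h
  have hagree : ∀ w (hw : w ∈ realization (f '' R))
      (hw' : w ∈ realization (insert p (f '' (R ∩ P)))),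
      (e ⟨w, hw⟩ : C → ℝ) = k ⟨w, hw'⟩ := fun w hw hw' =>
    ((hk w (hcone w hw hw')).trans (hee' w (hcone w hw hw'))).symm
  obtain ⟨h, h1, h2⟩ := exists_homeomorph_union (isCompact_realization _)
    (isCompact_realization _) e k hagree fun w hw => by
      refine realization_mono (Set.image_mono hQ) ((hkQ w).2 ?_)
      rw [realization_inter]
      exact ⟨hw, (k w).2⟩
  have hR : ∀ w (hw : w ∈ realization (f '' R)), ∀ U ⊆ R,
      (w ∈ realization (f '' U) ↔ (h ⟨w, Or.inl hw⟩ : C → ℝ) ∈ realization U) := by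
    intro w hw U hU
    rw [h1 w hw]
    exact heU ⟨w, hw⟩ U hU
  have key : (∀ w : ↥(realization (f '' R) ∪ realization (insert p (f '' (R ∩ P)))), ∀ U ⊆ R,
      ((w : C' → ℝ) ∈ realization (f '' U) ↔ (h w : C → ℝ) ∈ realization U)) ∧
      ∀ w : ↥(realization (f '' R) ∪ realization (insert p (f '' (R ∩ P)))), ∀ U ⊆ R, R ∩ P ⊆ U →
        ((w : C' → ℝ) ∈ realization (insert p (f '' U)) ↔
          (h w : C → ℝ) ∈ realization (U ∪ P)) := by
    constructor
    · rintro ⟨w, hw | hw⟩ U hU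
      · exact hR w hw U hU
      · constructor
        · intro hwU
          exact (hR w (realization_mono (Set.image_mono hU) hwU) U hU).1 hwU
        · intro hwU
          have hwP : (h ⟨w, Or.inr hw⟩ : C → ℝ) ∈ realization P := by
            rw [h2 w hw]; exact (k _).2
          have hwQ : w ∈ realization (f '' (R ∩ P)) := by
            refine (hkQ ⟨w, hw⟩).2 ?_
            rw [← h2 w hw, realization_inter]
            exact ⟨realization_mono hU hwU, hwP⟩
          exact (hR w (realization_mono (Set.image_mono hQ) hwQ) U hU).2 hwU
    · rintro ⟨w, hw | hw⟩ U hU hQU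
      · have e1 : w ∈ realization (insert p (f '' U)) ↔ w ∈ realization (f '' U) := by
          refine ⟨fun hwU => mem_realization_of_subset hwU fun c hc => ?_,
            fun hwU => realization_mono (Set.subset_insert _ _) hwU⟩
          rcases hwU.2.2.1 c hc with h | h
          · exact absurd (h ▸ hw.2.2.1 c hc) hp
          · exact h
        have hhR : (h ⟨w, Or.inl hw⟩ : C → ℝ) ∈ realization R := by
          rw [h1 w hw]; exact (e _).2
        refine e1.trans ((hR w hw U hU).trans ⟨fun hwU => realization_mono Set.subset_union_left hwU,
          fun hwU => mem_realization_of_subset hwU fun c hc => ?_⟩)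
        exact (hwU.2.2.1 c hc).elim id fun hcP => hQU ⟨hhR.2.2.1 c hc, hcP⟩
      · refine iff_of_true (realization_mono (Set.insert_subset_insert (Set.image_mono hQU)) hw) ?_
        rw [h2 w hw]
        exact realization_mono Set.subset_union_right (k _).2
  exact ⟨(Homeomorph.setCongr hunion).trans (h.trans (Homeomorph.setCongr hunion'.symm)),
    fun w U hU => key.1 ⟨w, hunion ▸ w.2⟩ U hU, fun w U hU => key.2 ⟨w, hunion ▸ w.2⟩ U hU⟩

end Suspension

/-! ### Transport of complexes and of connectedness along maps of face posets -/

theorem IsBallPair.congr_orderIso {C C' : Type} [Fintype C] [PartialOrder C] [Fintype C']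
    [PartialOrder C'] (e : C ≃o C') {n : ℕ} {T U : Set C} (hU : U ⊆ T)
    (h : IsBallPair n (realization T) (realization U)) :
    IsBallPair n (realization (e '' T)) (realization (e '' U)) :=
  (isBallPair_image_iff hU (fun _ _ _ _ => e.le_iff_le) n).2 h

theorem CellComplex.IsSimple.congr {X Y : CellComplex} {n : ℕ} (e : X.Cell ≃o Y.Cell)
    (hd : ∀ c, Y.dim (e c) = X.dim c) (h : X.IsSimple n) : Y.IsSimple n where
  dim_lt c d hcd := by
    have := h.dim_lt (e.symm c) (e.symm d) (e.symm.lt_iff_lt.2 hcd)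
    rwa [← hd, ← hd, e.apply_symm_apply, e.apply_symm_apply] at this
  ball c := by
    have := (h.ball (e.symm c)).congr_orderIso e Set.Iio_subset_Iic_self
    rwa [e.image_Iic, e.image_Iio, e.apply_symm_apply, ← hd, e.apply_symm_apply] at this
  dim_le c := by
    have := h.dim_le (e.symm c)
    rwa [← hd, e.apply_symm_apply] at this
  pure c := by
    obtain ⟨m, hm, hn⟩ := h.pure (e.symm c)
    exact ⟨e m, e.symm_apply_le.1 hm, (hd m).trans hn⟩

theorem CellComplex.Linked.map {X Y : CellComplex} {T : Set X.Cell} {T' : Set Y.Cell}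
    (f : X.Cell → Y.Cell) (hT : ∀ c ∈ T, f c ∈ T')
    (hf : ∀ c ∈ T, ∀ d ∈ T, c ≤ d → f c ≤ f d ∨ f d ≤ f c) {c d : X.Cell}
    (h : X.Linked T c d) : Y.Linked T' (f c) (f d) := by
  induction h with
  | refl => exact Relation.ReflTransGen.refl
  | @tail a b _ hab ih =>
    refine ih.tail ⟨hT a hab.1, hT b hab.2.1, ?_⟩
    rcases hab.2.2 with hle | hle
    · exact hf a hab.1 b hab.2.1 hle
    · exact (hf b hab.2.1 a hab.1 hle).symm

theorem CellComplex.IsConnectedOn.map {X Y : CellComplex} {T : Set X.Cell} {T' : Set Y.Cell}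
    (f : X.Cell → Y.Cell) (hT : ∀ c ∈ T, f c ∈ T') (hs : ∀ y ∈ T', ∃ c ∈ T, f c = y)
    (hf : ∀ c ∈ T, ∀ d ∈ T, c ≤ d → f c ≤ f d ∨ f d ≤ f c) (h : X.IsConnectedOn T) :
    Y.IsConnectedOn T' := by
  refine ⟨h.1.elim fun c hc => ⟨f c, hT c hc⟩, fun y hy z hz => ?_⟩
  obtain ⟨c, hc, rfl⟩ := hs y hy
  obtain ⟨d, hd, rfl⟩ := hs z hz
  exact (h.2 c hc d hd).map f hT hf

theorem CellComplex.Linked.symm {X : CellComplex} {T : Set X.Cell} {c d : X.Cell}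
    (h : X.Linked T c d) : X.Linked T d c := by
  induction h with
  | refl => exact Relation.ReflTransGen.refl
  | tail _ hab ih => exact Relation.ReflTransGen.head ⟨hab.2.1, hab.1, hab.2.2.symm⟩ ih

namespace CyclicData

variable {S : Type u}

/-! ### Vertices and edges of a brane complex -/

theorem vertex_eq_of_le {X : CellComplex} {n : ℕ} (hX : X.IsSimple n) {p q : X.Vertex}
    (h : p.1 ≤ q.1) : p = q := by
  rcases h.eq_or_lt with h | h
  · exact Subtype.ext h
  · have := hX.dim_lt _ _ h
    have := q.2
    omega

theorem vertex_lt_of_le {X : CellComplex} {q : X.Vertex} {c : X.Cell} (hc : X.dim c ≠ 0)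
    (h : q.1 ≤ c) : q.1 < c :=
  lt_of_le_of_ne h fun e => hc (e ▸ q.2)

/-- Let `e` be a minimal cell above `q` inside `c`. If `q` were the only vertex of `c`, the boundary
of `e` would be the single point `q`, which bounds no ball of positive dimension. -/
theorem exists_other_vertex_le {X : CellComplex} {n : ℕ} (hX : X.IsSimple n) {q : X.Vertex}
    {c : X.Cell} (hqc : q.1 < c) : ∃ u : X.Vertex, u ≠ q ∧ u.1 ≤ c := by
  obtain ⟨e, ⟨hqe, hec⟩, hmin⟩ :=
    (Set.toFinite {d : X.Cell | q.1 < d ∧ d ≤ c}).exists_minimal ⟨c, hqc, le_rfl⟩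
  by_contra hno
  push Not at hno
  have hall : ∀ u : X.Vertex, u.1 ≤ c → u = q := fun u hu => by
    by_contra hne
    exact hno u hne hu
  have hio : ∀ d, d < e → d = q.1 := by
    intro d hd
    obtain ⟨v, hv⟩ := exists_vertex_le hX d
    have hvq := hall v (hv.trans (hd.le.trans hec))
    subst hvq
    by_contra hne
    exact absurd (hmin ⟨lt_of_le_of_ne hv (Ne.symm hne), hd.le.trans hec⟩ hd.le)
      (not_le_of_gt hd)
  have h0 : X.dim e = 0 := dim_eq_zero_of_subsingleton hX e (by
    intro w hw w' hw'
    have hz : ∀ f ∈ realization (Set.Iio e), ∀ d, d ≠ q.1 → f d = 0 := fun f hf d hd =>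
      not_not.1 fun h => hd (hio d (hf.2.2.1 d h))
    have h1 : ∀ f ∈ realization (Set.Iio e), f q.1 = 1 := fun f hf => by
      rw [← hf.2.1]
      exact (Finset.sum_eq_single q.1 (fun d _ hd => hz f hf d hd) (by simp)).symm
    funext d
    by_cases hd : d = q.1
    · rw [hd, h1 w hw, h1 w' hw']
    · rw [hz w hw d hd, hz w' hw' d hd])
  have := hX.dim_lt _ _ hqe
  omega

theorem mem_crossing_singleton_of_lt {Ω : CyclicData S} {n : ℕ} (hX : Ω.IsSimple n)
    {q : Ω.Vertex} {c : Ω.Cell} (h : q.1 < c) : c ∈ Ω.crossing {q} := by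
  have := hX.dim_lt _ _ h
  exact mem_crossing_singleton_iff.2 ⟨by omega, h.le, exists_other_vertex_le hX h⟩

theorem mem_crossing_singleton_iff_le {Ω : CyclicData S} {n : ℕ} (hX : Ω.IsSimple n)
    {q : Ω.Vertex} {c : Ω.Cell} : c ∈ Ω.crossing {q} ↔ Ω.dim c ≠ 0 ∧ q.1 ≤ c :=
  ⟨fun h => ⟨h.1, le_of_mem_crossing_singleton h⟩,
    fun h => mem_crossing_singleton_of_lt hX (vertex_lt_of_le h.1 h.2)⟩

/-- A cell that contains a vertex properly has an edge at that vertex. -/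
theorem IsBrane.exists_edge {Ω : CyclicData S} {D : ℕ} (h : Ω.IsBrane D) {q : Ω.Vertex}
    {c : Ω.Cell} (hc : q.1 < c) : ∃ e, Ω.dim e = 1 ∧ q.1 < e ∧ e ≤ c := by
  have hs := (h.cut {q} (h.division_singleton q)).simple
  -- A zero-dimensional cell of the vertex complex below the piece of `c` is a piece of an edge at
  -- `q`.
  obtain ⟨e, he⟩ := exists_vertex_le hs ⟨c, mem_crossing_singleton_of_lt h.simple hc⟩
  have h0 : Ω.dim e.1.1 - 1 = 0 := e.2
  have h1 := e.1.2.1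
  exact ⟨e.1.1, by omega, vertex_lt_of_le h1 (le_of_mem_crossing_singleton e.1.2), he⟩

/-- The ends of an edge embed into the unit sphere of the line, which has two points. -/
theorem edge_vertices {X : CellComplex} {n : ℕ} (hX : X.IsSimple n) {e : X.Cell}
    (he : X.dim e = 1) {a b c : X.Vertex} (ha : a.1 ≤ e) (hb : b.1 ≤ e) (hc : c.1 ≤ e)
    (hab : a ≠ b) : c = a ∨ c = b := by
  classical
  obtain ⟨H, hH⟩ := he ▸ hX.ball e
  have hmem : ∀ v : X.Vertex, v.1 ≤ e → v.1 ∈ Set.Iio e := fun v hv =>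
    vertex_lt_of_le (by omega) hv
  let pt : ∀ v : X.Vertex, v.1 ≤ e → realization (Set.Iic e) := fun v hv =>
    ⟨Pi.single v.1 1, single_mem_realization hv⟩
  have hval : ∀ v hv, (H (pt v hv) : EuclideanSpace ℝ (Fin 1)) 0 = 1 ∨
      (H (pt v hv) : EuclideanSpace ℝ (Fin 1)) 0 = -1 := by
    intro v hv
    have h1 := (hH (pt v hv)).1 (single_mem_realization (hmem v hv))
    rw [EuclideanSpace.norm_eq, Fin.sum_univ_one, Real.sqrt_sq (norm_nonneg _),
      Real.norm_eq_abs] at h1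
    exact eq_or_eq_neg_of_abs_eq h1
  have hinj : ∀ v hv v' hv', (H (pt v hv) : EuclideanSpace ℝ (Fin 1)) 0 =
      (H (pt v' hv') : EuclideanSpace ℝ (Fin 1)) 0 → v = v' := by
    intro v hv v' hv' heq
    have h1 : H (pt v hv) = H (pt v' hv') := Subtype.ext (by
      ext i
      rw [Subsingleton.elim i 0, heq])
    have h2 := congrArg Subtype.val (H.injective h1)
    have h3 : (Pi.single v.1 1 : X.Cell → ℝ) v.1 = (Pi.single v'.1 1 : X.Cell → ℝ) v.1 :=
      congrFun h2 v.1
    rw [Pi.single_eq_same] at h3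
    by_contra hne
    rw [Pi.single_eq_of_ne (fun h => hne (Subtype.ext h))] at h3
    exact one_ne_zero h3
  rcases hval a ha with h1 | h1 <;> rcases hval b hb with h2 | h2 <;>
    rcases hval c hc with h3 | h3
  all_goals first
    | exact absurd (hinj a ha b hb (h1.trans h2.symm)) hab
    | exact Or.inl (hinj c hc a ha (h3.trans h1.symm))
    | exact Or.inr (hinj c hc b hb (h3.trans h2.symm))

theorem edge_inc {Ω : CyclicData S} {n : ℕ} (hX : Ω.IsSimple n) (ho : Ω.IsOrientation)
    {e : Ω.Cell} (he : Ω.dim e = 1) {a b : Ω.Vertex} (ha : a.1 ≤ e) (hb : b.1 ≤ e)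
    (hab : a ≠ b) : Ω.inc e a.1 = -Ω.inc e b.1 := by
  classical
  have h := ho.edge e he
  rw [eq_neg_iff_add_eq_zero, ← h,
    ← Finset.sum_pair (f := fun d => Ω.inc e d) (fun h => hab (Subtype.ext h))]
  refine Finset.sum_subset (Finset.subset_univ _) fun d _ hd => ho.not_facet e d ?_
  rintro ⟨hlt, hdim⟩
  have h0 : Ω.dim d = 0 := by omega
  refine hd ?_
  rw [Finset.mem_insert, Finset.mem_singleton]
  exact (edge_vertices hX he ha hb (c := ⟨d, h0⟩) hlt.le hab).imp
    (congrArg Subtype.val) (congrArg Subtype.val)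

/-! ### A connected brane complex is determined by all but one of its vertex complexes -/

/-- A bijection of the vertices of two connected brane complexes such that corresponding vertices,
with at most one exception, have isomorphic vertex complexes. -/
structure VertexMatching (D : ℕ) (Ω Ω' : CyclicData S) where
  brane : Ω.IsBrane D
  brane' : Ω'.IsBrane D
  connected : Ω.IsConnectedOn Set.univ
  connected' : Ω'.IsConnectedOn Set.univ
  equiv : Ω.Vertex ≃ Ω'.Vertex
  last : Ω.Vertex
  iso : ∀ q, q ≠ last → (Ω.vertexComplex q).Iso (Ω'.vertexComplex (equiv q))

namespace VertexMatching

variable {D : ℕ} {Ω Ω' : CyclicData S}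

def symm (M : VertexMatching D Ω Ω') : VertexMatching D Ω' Ω where
  brane := M.brane'
  brane' := M.brane
  connected := M.connected'
  connected' := M.connected
  equiv := M.equiv.symm
  last := M.equiv M.last
  iso q hq := by
    have := (M.iso (M.equiv.symm q) fun h => hq (by rw [← h, M.equiv.apply_symm_apply])).symm
    rwa [M.equiv.apply_symm_apply] at this

/-- Corresponding cells: corresponding vertices, or cells of the same dimension and color. -/
def Rel (M : VertexMatching D Ω Ω') (c : Ω.Cell) (c' : Ω'.Cell) : Prop :=
  (∃ q : Ω.Vertex, c = q.1 ∧ c' = (M.equiv q).1) ∨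
    ∃ (h : Ω.dim c ≠ 0) (h' : Ω'.dim c' ≠ 0), Ω.dim c = Ω'.dim c' ∧ Ω.color c h = Ω'.color c' h'

variable {M : VertexMatching D Ω Ω'}

theorem Rel.symm {c : Ω.Cell} {c' : Ω'.Cell} (h : M.Rel c c') : M.symm.Rel c' c := by
  rcases h with ⟨q, rfl, rfl⟩ | ⟨h, h', h1, h2⟩
  · exact Or.inl ⟨M.equiv q, rfl, by simp [VertexMatching.symm]⟩
  · exact Or.inr ⟨h', h, h1.symm, h2.symm⟩

theorem Rel.dim_eq {c : Ω.Cell} {c' : Ω'.Cell} (h : M.Rel c c') : Ω'.dim c' = Ω.dim c := by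
  rcases h with ⟨q, rfl, rfl⟩ | ⟨h, h', h1, h2⟩
  · rw [q.2, (M.equiv q).2]
  · exact h1.symm

/-- Connectedness makes the colors global: a cell of positive dimension is the only one of its
dimension with its color, so matches found at different vertices agree. -/
theorem Rel.unique {c : Ω.Cell} {c' c'' : Ω'.Cell} (h₁ : M.Rel c c') (h₂ : M.Rel c c'') :
    c' = c'' := by
  rcases h₁ with ⟨q, rfl, rfl⟩ | ⟨h, h', h1, h2⟩ <;>
    rcases h₂ with ⟨r, h3, rfl⟩ | ⟨k, k', k1, k2⟩
  · rw [Subtype.ext h3]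
  · exact absurd q.2 k
  · exact absurd (h3 ▸ r.2) h
  · exact M.brane'.color_inj c' c'' h' k' (M.connected'.2 _ trivial _ trivial)
      (h1.symm.trans k1) (h2.symm.trans k2)

/-- This is why one unknown vertex complex does no harm: a cell of positive dimension has two
vertices, and at most one of them is exceptional. -/
theorem exists_vertex_ne_last (M : VertexMatching D Ω Ω') {c : Ω.Cell} (hc : Ω.dim c ≠ 0) :
    ∃ q, q ≠ M.last ∧ q.1 ≤ c := by
  obtain ⟨q, hq⟩ := exists_vertex_le M.brane.simple c
  by_cases h : q = M.last
  · obtain ⟨u, hu, huc⟩ := exists_other_vertex_le M.brane.simple (vertex_lt_of_le hc hq)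
    exact ⟨u, h ▸ hu, huc⟩
  · exact ⟨q, h, hq⟩

/-- The local isomorphism at a vertex, in terms of corresponding cells. -/
theorem local_iso (M : VertexMatching D Ω Ω') {q : Ω.Vertex} (hq : q ≠ M.last) :
    ∃ f : {c // c ∈ Ω.crossing {q}} ≃o {c // c ∈ Ω'.crossing {M.equiv q}},
      (∀ c, M.Rel c.1 (f c).1) ∧
      (∀ c, Ω.dim c.1 = 1 → Ω'.inc (f c).1 (M.equiv q).1 = Ω.inc c.1 q.1) ∧
      ∀ c d, Ω'.inc (f c).1 (f d).1 = Ω.inc c.1 d.1 := by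
  obtain ⟨f, h1, h2, h3, h4⟩ := M.iso q hq
  have hdim : ∀ c : {c // c ∈ Ω.crossing {q}}, Ω'.dim (f c).1 = Ω.dim c.1 := fun c => by
    have e : Ω'.dim (f c).1 - 1 = Ω.dim c.1 - 1 := h1 c
    have e1 := c.2.1
    have e2 := (f c).2.1
    omega
  have hs : ∀ c : {c // c ∈ Ω.crossing {q}}, Ω.dim c.1 = 1 →
      Ω'.inc (f c).1 (M.equiv q).1 = Ω.inc c.1 q.1 := fun c hc => by
    rw [← endSign_singleton, ← endSign_singleton]
    refine h4 c ?_ ?_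
    · change Ω.dim c.1 - 1 = 0; omega
    · change Ω'.dim (f c).1 - 1 = 0; rw [hdim]; omega
  refine ⟨f, fun c => Or.inr ⟨c.2.1, (f c).2.1, (hdim c).symm, (h3 c).symm⟩, hs,
    fun c d => ?_⟩
  have e : (-Ω'.inc (f c).1 (f d).1 *
      if Ω'.dim (f d).1 = 1 then Ω'.endSign {M.equiv q} (f d).1 else 1) =
      -Ω.inc c.1 d.1 * if Ω.dim d.1 = 1 then Ω.endSign {q} d.1 else 1 := h2 c d
  rw [hdim, endSign_singleton, endSign_singleton] at e
  -- The incidence number of a cut with a point `d` contains the sign of that point. The two signs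
  -- agree by `hs` and are `±1`, so they cancel.
  split_ifs at e with hd
  · rw [hs d hd] at e
    have hne : Ω.inc d.1 q.1 ≠ 0 := by
      have hlt := vertex_lt_of_le d.2.1 (le_of_mem_crossing_singleton d.2)
      rcases M.brane.orientation.facet d.1 q.1 hlt (by rw [q.2, hd]) with h | h <;> rw [h] <;> simp
    exact neg_injective (mul_right_cancel₀ hne e)
  · exact neg_injective (mul_right_cancel₀ one_ne_zero e)

theorem exists_rel (M : VertexMatching D Ω Ω') (c : Ω.Cell) : ∃ c', M.Rel c c' := by
  by_cases hc : Ω.dim c = 0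
  · exact ⟨_, Or.inl ⟨⟨c, hc⟩, rfl, rfl⟩⟩
  · obtain ⟨q, hq, hqc⟩ := M.exists_vertex_ne_last hc
    obtain ⟨f, hf, -⟩ := M.local_iso hq
    exact ⟨_, hf ⟨c, (mem_crossing_singleton_iff_le M.brane.simple).2 ⟨hc, hqc⟩⟩⟩

theorem Rel.vertex_le {c : Ω.Cell} {c' : Ω'.Cell} (h : M.Rel c c') (hc : Ω.dim c ≠ 0)
    {q : Ω.Vertex} (hq : q ≠ M.last) (hqc : q.1 ≤ c) : (M.equiv q).1 ≤ c' := by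
  obtain ⟨f, hf, -⟩ := M.local_iso hq
  have hm := (mem_crossing_singleton_iff_le M.brane.simple).2 ⟨hc, hqc⟩
  rw [h.unique (hf ⟨c, hm⟩)]
  exact le_of_mem_crossing_singleton (f ⟨c, hm⟩).2

/-- A non-exceptional vertex of the smaller cell is a vertex of both cells, so both are seen in the
same local isomorphism. -/
theorem Rel.le_of_dim_ne_zero {c d : Ω.Cell} {c' d' : Ω'.Cell} (h : M.Rel c c')
    (h' : M.Rel d d') (hc : Ω.dim c ≠ 0) (hcd : c ≤ d) :
    c' ≤ d' ∧ Ω'.inc d' c' = Ω.inc d c := by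
  obtain ⟨q, hq, hqc⟩ := M.exists_vertex_ne_last hc
  obtain ⟨f, hf, -, hi⟩ := M.local_iso hq
  have hm := (mem_crossing_singleton_iff_le M.brane.simple).2 ⟨hc, hqc⟩
  have hm' := mem_crossing_mono M.brane.simple hm hcd
  rw [h.unique (hf ⟨c, hm⟩), h'.unique (hf ⟨d, hm'⟩)]
  exact ⟨f.le_iff_le.2 hcd, hi _ _⟩

/-- The other end `u` of `e` is not exceptional, so its image is an end of `e'`. If the second end
of `e'` were not the image of the exceptional vertex, it would pull back to a third end of `e`. -/
theorem Rel.edge_last_le {e : Ω.Cell} {e' : Ω'.Cell} (h : M.Rel e e') (he : Ω.dim e = 1)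
    (hl : M.last.1 ≤ e) : (M.equiv M.last).1 ≤ e' := by
  have he0 : Ω.dim e ≠ 0 := by omega
  have he' : Ω'.dim e' ≠ 0 := by rw [h.dim_eq]; omega
  obtain ⟨u, hu, hue⟩ := exists_other_vertex_le M.brane.simple (vertex_lt_of_le he0 hl)
  have hu' := h.vertex_le he0 hu hue
  obtain ⟨w, hw, hwe⟩ := exists_other_vertex_le M.brane'.simple (vertex_lt_of_le he' hu')
  by_cases hwl : w = M.equiv M.last
  · exact hwl ▸ hwe
  · have h1 : (M.equiv.symm w).1 ≤ e := h.symm.vertex_le he' hwl hwe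
    rcases edge_vertices M.brane.simple he hl hue h1 hu.symm with h2 | h2
    · exact absurd ((Equiv.symm_apply_eq _).1 h2) hwl
    · exact absurd ((Equiv.symm_apply_eq _).1 h2) hw

theorem Rel.le {c d : Ω.Cell} {c' d' : Ω'.Cell} (h : M.Rel c c') (h' : M.Rel d d')
    (hcd : c ≤ d) : c' ≤ d' := by
  by_cases hc : Ω.dim c = 0
  · obtain ⟨q, rfl⟩ : ∃ q : Ω.Vertex, c = q.1 := ⟨⟨c, hc⟩, rfl⟩
    have hc' := h.unique (Or.inl ⟨q, rfl, rfl⟩)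
    subst hc'
    by_cases hd : Ω.dim d = 0
    · have : q = ⟨d, hd⟩ := vertex_eq_of_le M.brane.simple hcd
      subst this
      rw [h'.unique h]
    · by_cases hq : q = M.last
      · subst hq
        -- Nothing is known directly at the exceptional vertex; an edge of `d` that starts there
        -- provides the link.
        obtain ⟨e, he, hqe, hed⟩ := M.brane.exists_edge (vertex_lt_of_le hd hcd)
        obtain ⟨e', hee'⟩ := M.exists_rel e
        exact (hee'.edge_last_le he hqe.le).trans
          (hee'.le_of_dim_ne_zero h' (by omega) hed).1
      · exact h'.vertex_le hd hq hcd
  · exact (h.le_of_dim_ne_zero h' hc hcd).1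

theorem Rel.le_iff {c d : Ω.Cell} {c' d' : Ω'.Cell} (h : M.Rel c c') (h' : M.Rel d d') :
    c' ≤ d' ↔ c ≤ d :=
  ⟨fun hle => h.symm.le h'.symm hle, fun hle => h.le h' hle⟩

theorem Rel.inc_eq {c d : Ω.Cell} {c' d' : Ω'.Cell} (h : M.Rel c c') (h' : M.Rel d d') :
    Ω'.inc c' d' = Ω.inc c d := by
  have hlt : d' < c' ↔ d < c := by
    rw [lt_iff_le_not_ge, lt_iff_le_not_ge, h'.le_iff h, h.le_iff h']
  by_cases hf : d < c ∧ Ω.dim d + 1 = Ω.dim c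
  · by_cases hd : Ω.dim d = 0
    · have hc : Ω.dim c = 1 := by omega
      have hsign : ∀ q, q ≠ M.last → q.1 ≤ c → Ω'.inc c' (M.equiv q).1 = Ω.inc c q.1 := by
        intro q hq hqc
        obtain ⟨f, hf, hs, -⟩ := M.local_iso hq
        have hm : c ∈ Ω.crossing {q} :=
          (mem_crossing_singleton_iff_le M.brane.simple).2 ⟨by omega, hqc⟩
        rw [h.unique (hf ⟨c, hm⟩)]
        exact hs ⟨c, hm⟩ hc
      obtain ⟨q, rfl⟩ : ∃ q : Ω.Vertex, d = q.1 := ⟨⟨d, hd⟩, rfl⟩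
      have hd' := h'.unique (Or.inl ⟨q, rfl, rfl⟩)
      subst hd'
      by_cases hq : q = M.last
      · subst hq
        -- The incidence number at the exceptional end is minus that at the other end, where it is
        -- known.
        obtain ⟨u, hu, huc⟩ := exists_other_vertex_le M.brane.simple hf.1
        rw [edge_inc M.brane.simple M.brane.orientation hc hf.1.le huc hu.symm,
          edge_inc M.brane'.simple M.brane'.orientation (h.dim_eq.trans hc) (hlt.2 hf.1).le
            (h.vertex_le (by omega) hu huc) (M.equiv.injective.ne hu.symm), hsign u hu huc]
      · exact hsign q hq hf.1.le
    · exact (h'.le_of_dim_ne_zero h hd hf.1.le).2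
  · rw [M.brane.orientation.not_facet c d hf, M.brane'.orientation.not_facet c' d']
    rwa [hlt, h.dim_eq, h'.dim_eq]

/-- The isomorphism of complexes given by a matching of vertices. -/
theorem exists_isom (M : VertexMatching D Ω Ω')
    (hcyc : ∀ a b c, Ω'.cyc (M.equiv a) (M.equiv b) (M.equiv c) ↔ Ω.cyc a b c) :
    ∃ φ : Ω.Isom Ω', φ.vertex = M.equiv := by
  -- The correspondence is total and functional in both directions, so the two choices are mutually
  -- inverse.
  choose F hF using M.exists_rel
  choose G hG using M.symm.exists_rel
  have hGF : ∀ c, G (F c) = c := fun c => (hG (F c)).unique (hF c).symm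
  have hFG : ∀ c, F (G c) = c := fun c => (hF (G c)).unique (hG c).symm
  have hv : ∀ q : Ω.Vertex, F q.1 = (M.equiv q).1 := fun q =>
    (hF q.1).unique (Or.inl ⟨q, rfl, rfl⟩)
  have hvv : ∀ (q : Ω.Vertex) (h : Ω'.dim (F q.1) = 0), (⟨F q.1, h⟩ : Ω'.Vertex) = M.equiv q :=
    fun q _ => Subtype.ext (hv q)
  refine ⟨{ toOrderIso := ⟨⟨F, G, hGF, hFG⟩, fun {a b} => (hF a).le_iff (hF b)⟩
            dim_eq := fun c => (hF c).dim_eq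
            inc_eq := fun c d => (hF c).inc_eq (hF d)
            color_eq := fun c h h' => ?_
            cyc_iff := fun a b c => ?_ }, ?_⟩
  · rcases hF c with ⟨q, h1, -⟩ | ⟨_, _, _, h2⟩
    · exact absurd (h1 ▸ q.2) h
    · exact h2.symm
  · rw [← hcyc, ← hvv a, ← hvv b, ← hvv c]
    exact Iff.rfl
  · ext q : 1
    exact hvv q _

end VertexMatching

end CyclicData

namespace CyclicData

variable {S : Type u}

/-! ### The two sides of a cut -/

theorem crossing_compl (Ω : CyclicData S) (A : Set Ω.Vertex) : Ω.crossing Aᶜ = Ω.crossing A := by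
  ext c
  unfold crossing
  rw [compl_compl]
  exact and_congr Iff.rfl and_comm

theorem mem_side_or (Ω : CyclicData S) {n : ℕ} (h : Ω.IsSimple n) (A : Set Ω.Vertex)
    (c : Ω.Cell) : c ∈ Ω.side A ∨ c ∈ Ω.side Aᶜ := by
  obtain ⟨v, hv⟩ := exists_vertex_le h c
  by_cases hA : v ∈ A
  · exact Or.inl ⟨v, hA, hv⟩
  · exact Or.inr ⟨v, hA, hv⟩

theorem vertex_mem_side_iff {Ω : CyclicData S} {n : ℕ} (h : Ω.IsSimple n) {A : Set Ω.Vertex}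
    {v : Ω.Vertex} : v.1 ∈ Ω.side A ↔ v ∈ A := by
  constructor
  · rintro ⟨a, ha, hav⟩
    exact vertex_eq_of_le h hav ▸ ha
  · exact fun hv => ⟨v, hv, le_rfl⟩

theorem side_mono {Ω : CyclicData S} {A B : Set Ω.Vertex} (h : A ⊆ B) : Ω.side A ⊆ Ω.side B :=
  fun _ ⟨a, ha, hac⟩ => ⟨a, h ha, hac⟩

theorem side_upward {Ω : CyclicData S} {A : Set Ω.Vertex} {c d : Ω.Cell} (hc : c ∈ Ω.side A)
    (h : c ≤ d) : d ∈ Ω.side A :=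
  hc.imp fun _ ha => ⟨ha.1, ha.2.trans h⟩

theorem dim_ne_zero_of_mem_sides {Ω : CyclicData S} {n : ℕ} (h : Ω.IsSimple n)
    {A : Set Ω.Vertex} {c : Ω.Cell} (h1 : c ∈ Ω.side A) (h2 : c ∈ Ω.side Aᶜ) : Ω.dim c ≠ 0 :=
  fun h0 => (vertex_mem_side_iff h (v := ⟨c, h0⟩)).1 h2 ((vertex_mem_side_iff h).1 h1)

theorem mem_crossing_iff {Ω : CyclicData S} {n : ℕ} (h : Ω.IsSimple n) {A : Set Ω.Vertex}
    {c : Ω.Cell} : c ∈ Ω.crossing A ↔ c ∈ Ω.side A ∧ c ∈ Ω.side Aᶜ :=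
  ⟨fun hc => hc.2, fun hc => ⟨dim_ne_zero_of_mem_sides h hc.1 hc.2, hc⟩⟩

theorem IsCompatibleDivision.compl {Ω : CyclicData S} {n : ℕ} (h : Ω.IsCyclicComplex n)
    (hc : Ω.IsConnectedOn Set.univ) {A : Set Ω.Vertex} (hA : Ω.IsCompatibleDivision A) :
    Ω.IsCompatibleDivision Aᶜ where
  nonempty := by
    obtain ⟨a, -, b, hb, -⟩ := hA.rest
    exact ⟨b, hb⟩
  component a _ a' _ := hc.2 _ trivial _ trivial
  rest := by
    obtain ⟨a, ha, b, hb, -⟩ := hA.rest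
    exact ⟨b, hb, a, fun h => h ha, hc.2 _ trivial _ trivial⟩
  compatible := by
    rintro ⟨a, ha, a', ha', b, hb, b', hb', h1, h2⟩
    -- Alternation is symmetric in the two pairs: the triples `(a, b, a')` and `(a', b', a)` yield
    -- `(b, a', b')` and `(b', a, b)`.
    refine hA.compatible ⟨b, not_not.1 hb, b', not_not.1 hb', a', ha', a, ha, ?_, ?_⟩
    · exact h.cyc_rotate _ _ _ (h.cyc_rotate _ _ _ (h.cyc_trans _ _ _ _ h2
        (h.cyc_rotate _ _ _ (h.cyc_rotate _ _ _ h1))))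
    · exact h.cyc_rotate _ _ _ (h.cyc_rotate _ _ _ (h.cyc_trans _ _ _ _ h1
        (h.cyc_rotate _ _ _ (h.cyc_rotate _ _ _ h2))))

/-- In a connected complex the clause about components in the definition of a cut is vacuous and the
two sides play the same role; the cut complex only gets reversed. This allows the choice of the side
on which a given vertex lies. -/
theorem IsCut.compl {Ω : CyclicData S} {n D : ℕ} (h : Ω.IsCyclicComplex n)
    (hc : Ω.IsConnectedOn Set.univ) {A : Set Ω.Vertex} (hA : Ω.IsCut D A) :
    Ω.IsCut D Aᶜ where
  division := hA.division.compl h hc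
  simple := by
    obtain ⟨f, h1, -⟩ := cutComplex_compl_iso h.orientation A
    exact CellComplex.IsSimple.congr (X := (Ω.cutComplex A).toCellComplex) f h1 hA.simple
  connected := by
    obtain ⟨f, -⟩ := cutComplex_compl_iso h.orientation A
    exact CellComplex.IsConnectedOn.map (X := (Ω.cutComplex A).toCellComplex) f
      (T := Set.univ) (fun _ _ => trivial)
      (fun y _ => ⟨f.symm y, trivial, f.apply_symm_apply y⟩)
      (fun _ _ _ _ h => Or.inl (f.le_iff_le.2 h)) hA.connected
  ball_side c hcr := by
    rw [crossing_compl] at hcr ⊢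
    exact hA.ball_other_side c hcr
  ball_other_side c hcr := by
    rw [crossing_compl] at hcr ⊢
    rw [compl_compl]
    exact hA.ball_side c hcr
  connected_side := by
    have e : {c | c ∉ Ω.side Aᶜᶜ} = {c | (∃ a ∈ A, Ω.SameComponent a.1 c) ∧ c ∉ Ω.side A} := by
      ext c
      rw [compl_compl]
      exact ⟨fun h => ⟨hA.division.nonempty.imp fun a ha => ⟨ha, hc.2 _ trivial _ trivial⟩, h⟩,
        fun h => h.2⟩
    rw [e]
    exact hA.connected_other_side
  connected_other_side := by
    have e : {c | (∃ a ∈ Aᶜ, Ω.SameComponent a.1 c) ∧ c ∉ Ω.side Aᶜ} = {c | c ∉ Ω.side Aᶜ} := by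
      ext c
      exact ⟨fun h' => h'.2, fun h' => ⟨(hA.division.compl h hc).nonempty.imp
        fun a ha => ⟨ha, hc.2 _ trivial _ trivial⟩, h'⟩⟩
    rw [e]
    exact hA.connected_side

theorem endSign_eq_zero {Ω : CyclicData S} (ho : Ω.IsOrientation) {A : Set Ω.Vertex}
    {c : Ω.Cell} (h : ∀ v ∈ A, ¬(v.1 < c ∧ Ω.dim c = 1)) : Ω.endSign A c = 0 := by
  classical
  refine Finset.sum_eq_zero fun v _ => ?_
  split_ifs with hv
  · refine ho.not_facet _ _ fun hh => h v hv ⟨hh.1, ?_⟩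
    rw [← hh.2, v.2]
  · rfl

theorem endSign_edge {Ω : CyclicData S} {n : ℕ} (hX : Ω.IsSimple n) (ho : Ω.IsOrientation)
    {A : Set Ω.Vertex} {e : Ω.Cell} (he : Ω.dim e = 1) {a b : Ω.Vertex} (ha : a ∉ A) (hb : b ∈ A)
    (hae : a.1 ≤ e) (hbe : b.1 ≤ e) : Ω.endSign A e = Ω.inc e b.1 := by
  classical
  unfold endSign
  rw [Finset.sum_eq_single b]
  · rw [if_pos hb]
  · intro v _ hvb
    split_ifs with hv
    · refine ho.not_facet _ _ fun hh => ?_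
      rcases edge_vertices hX he hae hbe hh.1.le (fun h => ha (h ▸ hb)) with h | h
      · exact ha (h ▸ hv)
      · exact hvb h
    · rfl
  · simp

/-! ### Contracting one side of a cut -/

open Classical in
/-- The map of cells that contracts the cells without a vertex in `A` to the new vertex. -/
noncomputable def collapse (Ω : CyclicData S) (A : Set Ω.Vertex) (c : Ω.Cell) : HalfCell Ω A :=
  if h : c ∈ Ω.side A then .cell c h else .apex

noncomputable instance (Ω : CyclicData S) (A : Set Ω.Vertex) : Fintype (HalfCell Ω A) :=
  Fintype.ofFinite _

section Half

variable {Ω : CyclicData S} {A : Set Ω.Vertex}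

theorem collapse_of_mem {c : Ω.Cell} (h : c ∈ Ω.side A) : Ω.collapse A c = .cell c h := dif_pos h

theorem collapse_of_notMem {c : Ω.Cell} (h : c ∉ Ω.side A) : Ω.collapse A c = .apex := dif_neg h

theorem collapse_le_iff {c d : Ω.Cell} (hc : c ∈ Ω.side A) (hd : d ∈ Ω.side A) :
    Ω.collapse A c ≤ Ω.collapse A d ↔ c ≤ d := by
  rw [collapse_of_mem hc, collapse_of_mem hd]
  exact Iff.rfl

theorem collapse_mono {n : ℕ} (h : Ω.IsSimple n) {c d : Ω.Cell} (hcd : c ≤ d) :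
    Ω.collapse A c ≤ Ω.collapse A d := by
  by_cases hc : c ∈ Ω.side A
  · exact (collapse_le_iff hc (side_upward hc hcd)).2 hcd
  · rw [collapse_of_notMem hc]
    by_cases hd : d ∈ Ω.side A
    · rw [collapse_of_mem hd]
      exact side_upward ((Ω.mem_side_or h A c).resolve_left hc) hcd
    · rw [collapse_of_notMem hd]

theorem apex_le_cell {c : Ω.Cell} {hc : c ∈ Ω.side A} :
    (HalfCell.apex : HalfCell Ω A) ≤ .cell c hc ↔ c ∈ Ω.side Aᶜ := Iff.rfl

theorem cell_le_cell {c d : Ω.Cell} {hc : c ∈ Ω.side A} {hd : d ∈ Ω.side A} :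
    (HalfCell.cell c hc : HalfCell Ω A) ≤ .cell d hd ↔ c ≤ d := Iff.rfl

theorem cell_lt_cell {c d : Ω.Cell} {hc : c ∈ Ω.side A} {hd : d ∈ Ω.side A} :
    (HalfCell.cell c hc : HalfCell Ω A) < .cell d hd ↔ c < d := by
  rw [lt_iff_le_not_ge, lt_iff_le_not_ge, cell_le_cell, cell_le_cell]

theorem not_cell_le_apex {c : Ω.Cell} {hc : c ∈ Ω.side A} :
    ¬(HalfCell.cell c hc : HalfCell Ω A) ≤ .apex := fun h => h

theorem apex_lt_cell {c : Ω.Cell} {hc : c ∈ Ω.side A} :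
    (HalfCell.apex : HalfCell Ω A) < .cell c hc ↔ c ∈ Ω.side Aᶜ := by
  rw [lt_iff_le_not_ge, apex_le_cell]
  exact and_iff_left not_cell_le_apex

theorem not_lt_apex {x : HalfCell Ω A} : ¬x < .apex := fun h => by
  cases x with
  | apex => exact lt_irrefl _ h
  | cell c hc => exact not_cell_le_apex h.le

theorem image_collapse {T : Set Ω.Cell} (hT : T ⊆ Ω.side A) {T' : Set (HalfCell Ω A)}
    (ha : .apex ∉ T') (h : ∀ c hc, .cell c hc ∈ T' ↔ c ∈ T) : Ω.collapse A '' T = T' := by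
  ext x
  constructor
  · rintro ⟨c, hc, rfl⟩
    rw [collapse_of_mem (hT hc)]
    exact (h c _).2 hc
  · intro hx
    cases x with
    | apex => exact absurd hx ha
    | cell c hc => exact ⟨c, (h c hc).1 hx, collapse_of_mem hc⟩

theorem insert_apex_image_collapse {T : Set Ω.Cell} (hT : T ⊆ Ω.side A) {T' : Set (HalfCell Ω A)}
    (ha : .apex ∈ T') (h : ∀ c hc, .cell c hc ∈ T' ↔ c ∈ T) :
    insert .apex (Ω.collapse A '' T) = T' := by
  rw [image_collapse hT (T' := T' \ {.apex}) (by simp) (by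
    intro c hc
    rw [← h c hc]
    simp)]
  simp [ha]

/-- The boundary of `c` consists of a near part and a far ball that meet in the sphere of crossing
cells. In the half the far ball is replaced by the cone from the new vertex over this sphere, which
does not change the homeomorphism type. The two clauses record what becomes of a set `U` of near
cells: without the far ball, and with it when `U` contains the crossing cells. -/
theorem exists_homeomorph_Iio_cell {n D : ℕ} (h : Ω.IsSimple n) (hA : Ω.IsCut D A) {c : Ω.Cell}
    (hc : c ∈ Ω.side A) (hc' : c ∈ Ω.side Aᶜ) :
    ∃ H : realization (Set.Iio (HalfCell.cell c hc : HalfCell Ω A)) ≃ₜ realization (Set.Iio c),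
      (∀ w : realization (Set.Iio (HalfCell.cell c hc : HalfCell Ω A)),
        ∀ U ⊆ Ω.side A ∩ Set.Iio c, ((w : HalfCell Ω A → ℝ) ∈ realization (Ω.collapse A '' U) ↔
          (H w : Ω.Cell → ℝ) ∈ realization U)) ∧
      ∀ w : realization (Set.Iio (HalfCell.cell c hc : HalfCell Ω A)),
        ∀ U ⊆ Ω.side A ∩ Set.Iio c, Ω.crossing A ∩ Set.Iio c ⊆ U →
          ((w : HalfCell Ω A → ℝ) ∈ realization (insert .apex (Ω.collapse A '' U)) ↔
            (H w : Ω.Cell → ℝ) ∈ realization (U ∪ (Ω.side Aᶜ ∩ Set.Iio c))) := by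
  have hQ : (Ω.side A ∩ Set.Iio c) ∩ (Ω.side Aᶜ ∩ Set.Iio c) = Ω.crossing A ∩ Set.Iio c := by
    ext d
    simp only [Set.mem_inter_iff, mem_crossing_iff h]
    tauto
  have hU : (Ω.side A ∩ Set.Iio c) ∪ (Ω.side Aᶜ ∩ Set.Iio c) = Set.Iio c := by
    rw [← Set.union_inter_distrib_right]
    exact Set.inter_eq_right.2 fun d _ => Ω.mem_side_or h A d
  have hI : insert .apex (Ω.collapse A '' (Ω.side A ∩ Set.Iio c)) =
      Set.Iio (HalfCell.cell c hc : HalfCell Ω A) := by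
    refine insert_apex_image_collapse Set.inter_subset_left (apex_lt_cell.2 hc') fun d hd => ?_
    rw [Set.mem_Iio, cell_lt_cell]
    exact ⟨fun h => ⟨hd, h⟩, fun h => h.2⟩
  -- The far part is a ball bounded by the crossing cells; this is the condition on a cut that the
  -- contraction uses.
  have hb := hA.ball_other_side c ((mem_crossing_iff h).2 ⟨hc, hc'⟩)
  rw [← hQ] at hb
  obtain ⟨H, h1, h2⟩ := exists_homeomorph_fill (C' := HalfCell Ω A) (f := Ω.collapse A)
    (p := .apex) hb
    (by
      rintro r ⟨hr, hrc⟩ hrP d ⟨hd, hdc⟩ hdR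
      refine ⟨fun hle => hdR ⟨side_upward hr hle, hdc⟩, fun hle => hrP ⟨side_upward hd hle, hrc⟩⟩)
    (fun x hx y hy => collapse_le_iff hx.1 hy.1)
    (by
      rintro ⟨r, hr, e⟩
      rw [collapse_of_mem hr.1] at e
      exact HalfCell.cell_ne_apex _ _ e)
    (by
      intro r hr
      rw [collapse_of_mem hr.1, apex_le_cell, or_iff_left not_cell_le_apex]
      exact ⟨fun h => ⟨h, hr.2⟩, fun h => h.1⟩)
  rw [hQ] at h2
  refine ⟨(Homeomorph.setCongr (congrArg realization hI.symm)).trans (H.trans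
    (Homeomorph.setCongr (congrArg realization hU))), fun w U hUR => ?_, fun w U hUR => ?_⟩
  · exact h1 ⟨w, hI.symm ▸ w.2⟩ U hUR
  · exact h2 ⟨w, hI.symm ▸ w.2⟩ U hUR

/-- Only the cells met by the cut change. Such a cell is the cone over its boundary, and the
boundary is still a sphere because it is homeomorphic to the old one. -/
theorem IsCut.half_isSimple {n D : ℕ} (h : Ω.IsSimple (n + 1)) (hA : Ω.IsCut D A) :
    (Ω.half A).IsSimple (n + 1) where
  dim_lt x y hxy := by
    match x, y, hxy with
    | .apex, .apex, hxy => exact absurd hxy (lt_irrefl _)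
    | .cell c hc, .apex, hxy => exact absurd hxy not_lt_apex
    | .apex, .cell c hc, hxy =>
      exact Nat.pos_of_ne_zero (dim_ne_zero_of_mem_sides h hc (apex_lt_cell.1 hxy))
    | .cell c hc, .cell d hd, hxy => exact h.dim_lt c d (cell_lt_cell.1 hxy)
  ball x := by
    match x with
    | .apex =>
      have h1 : Set.Iic (HalfCell.apex : HalfCell Ω A) = {.apex} := by
        ext y
        cases y with
        | apex => simp
        | cell c hc => simp [not_cell_le_apex]
      have h2 : Set.Iio (HalfCell.apex : HalfCell Ω A) = ∅ := by
        ext y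
        simp [not_lt_apex]
      change IsBallPair 0 (realization (Set.Iic (HalfCell.apex : HalfCell Ω A)))
        (realization (Set.Iio (HalfCell.apex : HalfCell Ω A)))
      rw [h1, h2]
      exact isBallPair_point
    | .cell c hc =>
      have hb := h.ball c
      change IsBallPair (Ω.dim c) (realization (Set.Iic (HalfCell.cell c hc : HalfCell Ω A)))
        (realization (Set.Iio (HalfCell.cell c hc : HalfCell Ω A)))
      by_cases hc' : c ∈ Ω.side Aᶜ
      · obtain ⟨H, -⟩ := exists_homeomorph_Iio_cell h hA hc hc'
        obtain ⟨-, g, -⟩ := hb.exists_homeomorph_sphere Set.Iio_subset_Iic_self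
        have := isBallPair_cone (p := (HalfCell.cell c hc : HalfCell Ω A)) (U := Set.Iio _)
          (by simp) (fun u hu => Or.inr hu.le) (H.trans g)
        rwa [Set.Iio_insert] at this
      -- If `c` has no vertex outside `A`, the same is true of its faces, and the contraction is an
      -- embedding on the closed cell.
      · have hs : Set.Iic c ⊆ Ω.side A := fun d hd =>
          (Ω.mem_side_or h A d).resolve_right fun h' => hc' (side_upward h' hd)
        have e1 : Ω.collapse A '' Set.Iic c = Set.Iic (HalfCell.cell c hc) :=
          image_collapse hs (fun h' => hc' ((apex_le_cell (hc := hc)).1 h')) fun d hd => Iff.rfl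
        have e2 : Ω.collapse A '' Set.Iio c = Set.Iio (HalfCell.cell c hc) :=
          image_collapse (Set.Iio_subset_Iic_self.trans hs) (fun h' => hc' ((apex_lt_cell (hc := hc)).1 h'))
            fun d hd => cell_lt_cell
        rw [← e1, ← e2]
        exact (isBallPair_image_iff Set.Iio_subset_Iic_self
          (fun x hx y hy => collapse_le_iff (hs hx) (hs hy)) _).2 hb
  dim_le x := by
    match x with
    | .apex => exact Nat.zero_le _
    | .cell c hc => exact h.dim_le c
  pure x := by
    match x with
    | .apex =>
      -- The cut is nonempty, and a top cell above a cell that meets it has vertices on both sides,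
      -- hence contains the new vertex.
      obtain ⟨⟨c, hc⟩, -⟩ := hA.connected.1
      obtain ⟨m, hm, hd⟩ := h.pure c
      exact ⟨.cell m (side_upward hc.2.1 hm), side_upward hc.2.2 hm, hd⟩
    | .cell c hc =>
      obtain ⟨m, hm, hd⟩ := h.pure c
      exact ⟨.cell m (side_upward hc hm), hm, hd⟩

theorem IsCompatibleDivision.half_isConnectedOn {n : ℕ} (h : Ω.IsSimple n)
    (hc : Ω.IsConnectedOn Set.univ) (hA : Ω.IsCompatibleDivision A) :
    (Ω.half A).IsConnectedOn Set.univ := by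
  refine CellComplex.IsConnectedOn.map (Y := (Ω.half A).toCellComplex) (Ω.collapse A)
    (fun _ _ => trivial) (fun y _ => ?_)
    (fun _ _ _ _ hcd => Or.inl (collapse_mono h hcd)) hc
  match y with
  | .apex =>
    obtain ⟨-, -, b, hb, -⟩ := hA.rest
    exact ⟨b.1, trivial, collapse_of_notMem fun h' => hb ((vertex_mem_side_iff h).1 h')⟩
  | .cell c hc => exact ⟨c, trivial, collapse_of_mem hc⟩

theorem sum_halfCell (F : HalfCell Ω A → ℤ) (G : Ω.Cell → ℤ)
    (h1 : ∀ c hc, F (.cell c hc) = G c) (h2 : ∀ c, c ∉ Ω.side A → G c = 0) :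
    ∑ x, F x = F .apex + ∑ c, G c := by
  classical
  let e : Option {c // c ∈ Ω.side A} ≃ HalfCell Ω A :=
    { toFun := fun o => o.elim .apex fun c => .cell c.1 c.2
      invFun := fun x => match x with
        | .apex => none
        | .cell c hc => some ⟨c, hc⟩
      left_inv := fun o => by cases o <;> rfl
      right_inv := fun x => by cases x <;> rfl }
  rw [← e.sum_comp, Fintype.sum_option]
  congr 1
  have : ∑ c : {c // c ∈ Ω.side A}, F (e (some c)) =
      ∑ c ∈ Finset.univ.filter (· ∈ Ω.side A), G c := by
    rw [Finset.sum_subtype (p := (· ∈ Ω.side A)) _ (by simp)]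
    exact Finset.sum_congr rfl fun c _ => h1 c.1 c.2
  rw [this]
  exact Finset.sum_subset (Finset.subset_univ _) fun c _ hc => h2 c (by simpa using hc)

/-- The new vertex inherits the sum of the incidence numbers of all contracted vertices. A crossing
edge has just one end among them, so the sum is a single sign; the relations at the new vertex are
sums of old ones. -/
theorem half_isOrientation {n : ℕ} (h : Ω.IsSimple n) (ho : Ω.IsOrientation) :
    (Ω.half A).IsOrientation where
  facet x y hyx hdim := by
    match x, y, hyx, hdim with
    | .apex, y, hyx, _ => exact absurd hyx not_lt_apex
    | .cell c hc, .cell d hd, hyx, hdim => exact ho.facet c d (cell_lt_cell.1 hyx) hdim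
    | .cell c hc, .apex, hyx, hdim =>
      have hd : Ω.dim c = 1 := hdim.symm
      obtain ⟨a, ha, hac⟩ := hc
      obtain ⟨b, hb, hbc⟩ := apex_lt_cell.1 hyx
      change Ω.endSign Aᶜ c = 1 ∨ Ω.endSign Aᶜ c = -1
      rw [endSign_edge h ho hd (Set.notMem_compl_iff.2 ha) hb hac hbc]
      exact ho.facet c b.1 (vertex_lt_of_le (by omega) hbc) (by rw [b.2, hd])
  not_facet x y hn := by
    match x, y, hn with
    | .apex, y, _ => rfl
    | .cell c hc, .cell d hd, hn =>
      exact ho.not_facet c d fun hh => hn ⟨cell_lt_cell.2 hh.1, hh.2⟩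
    | .cell c hc, .apex, hn =>
      exact endSign_eq_zero ho fun v hv hh => hn ⟨apex_lt_cell.2 ⟨v, hv, hh.1.le⟩, hh.2.symm⟩
  edge x hx := by
    classical
    match x, hx with
    | .cell c hc, hx =>
      have hd : Ω.dim c = 1 := hx
      refine (sum_halfCell (fun y => (Ω.half A).inc (.cell c hc) y)
        (fun d => if d ∈ Ω.side A then Ω.inc c d else 0) (fun d hd => (if_pos hd).symm)
        fun d hd => if_neg hd).trans ?_
      change Ω.endSign Aᶜ c + _ = 0
      rw [endSign_compl ho A c hd, neg_add_eq_zero]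
      have e : ∀ v : Ω.Vertex, (if v ∈ A then Ω.inc c v.1 else 0) =
          if v.1 ∈ Ω.side A then Ω.inc c v.1 else 0 := fun v => by
        simp only [vertex_mem_side_iff h]
      unfold endSign
      rw [Finset.sum_congr rfl fun v _ => e v]
      rw [← Finset.sum_subtype (Finset.univ.filter fun v => Ω.dim v = 0) (by simp)
        (fun v => if v ∈ Ω.side A then Ω.inc c v else 0)]
      refine Finset.sum_subset (Finset.subset_univ _) fun d _ hd' => ?_
      split_ifs
      · refine ho.not_facet c d fun hh => hd' ?_
        simp only [Finset.mem_filter, Finset.mem_univ, true_and]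
        omega
      · rfl
  boundary_boundary x y hxy := by
    classical
    match x, y, hxy with
    | .cell c hc, .cell b hb, hxy =>
      refine (sum_halfCell (fun z => (Ω.half A).inc (.cell c hc) z * (Ω.half A).inc z (.cell b hb))
        (fun d => Ω.inc c d * Ω.inc d b) (fun d hd => rfl) fun d hd => ?_).trans ?_
      · rw [ho.not_facet d b fun hh => hd (side_upward hb hh.1.le), mul_zero]
      · rw [ho.boundary_boundary c b hxy, add_zero]
        exact mul_zero _
    | .cell c hc, .apex, hxy =>
      have hd2 : 0 + 2 = Ω.dim c := hxy
      refine (sum_halfCell (fun z => (Ω.half A).inc (.cell c hc) z * (Ω.half A).inc z .apex)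
        (fun d => Ω.inc c d * Ω.endSign Aᶜ d) (fun d hd => rfl) fun d hd => ?_).trans ?_
      -- An edge without a vertex in `A` is contracted; its two ends have cancelling signs, so it
      -- contributes nothing.
      · by_cases hd1 : Ω.dim d = 1
        · rw [endSign_compl ho A d hd1,
            endSign_eq_zero ho fun v hv hh => hd ⟨v, hv, hh.1.le⟩, neg_zero, mul_zero]
        · rw [ho.not_facet c d fun hh => hd1 (by omega), zero_mul]
      · have e1 : (Ω.half A).inc (.cell c hc) HalfCell.apex * (Ω.half A).inc HalfCell.apex
            HalfCell.apex = 0 := mul_zero _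
        rw [e1, zero_add]
        unfold endSign
        simp only [Finset.mul_sum, mul_ite, mul_zero]
        -- After exchanging the sums, each vertex outside `A` contributes its own relation `∂ ∂ =
        -- 0`.
        rw [Finset.sum_comm]
        refine Finset.sum_eq_zero fun v _ => ?_
        split_ifs
        · exact ho.boundary_boundary c v.1 (by rw [v.2, hd2])
        · exact Finset.sum_const_zero

end Half

end CyclicData

/-- Restriction of a homeomorphism to corresponding subsets. -/
theorem exists_homeomorph_restrict {X Y : Type} [TopologicalSpace X] [TopologicalSpace Y]
    {s s' : Set X} {t t' : Set Y} (h : s ≃ₜ t) (hs : s' ⊆ s) (ht : t' ⊆ t)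
    (hh : ∀ x : s, (x : X) ∈ s' ↔ (h x : Y) ∈ t') :
    ∃ k : s' ≃ₜ t', ∀ x (hx : x ∈ s'), (k ⟨x, hx⟩ : Y) = h ⟨x, hs hx⟩ := by
  refine ⟨{ toFun := fun x => ⟨h ⟨x.1, hs x.2⟩, (hh _).1 x.2⟩
            invFun := fun y => ⟨h.symm ⟨y.1, ht y.2⟩, (hh _).2 (by simp)⟩
            left_inv := fun x => by simp
            right_inv := fun y => by simp
            continuous_toFun := ?_
            continuous_invFun := ?_ }, fun x hx => rfl⟩
  · exact (continuous_subtype_val.comp (h.continuous.comp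
      (continuous_subtype_val.subtype_mk fun x => hs x.2))).subtype_mk _
  · exact (continuous_subtype_val.comp (h.symm.continuous.comp
      (continuous_subtype_val.subtype_mk fun x => ht x.2))).subtype_mk _

/-! ### The cyclic order on the vertices of a half -/

namespace CyclicData

variable {S : Type u} {Ω : CyclicData S} {A : Set Ω.Vertex}

/-- The vertex of the half that represents a vertex of `Ω`. -/
noncomputable def collapseVertex (A : Set Ω.Vertex) (v : Ω.Vertex) : (Ω.half A).Vertex :=
  ⟨Ω.collapse A v.1, by
    by_cases h : v.1 ∈ Ω.side A
    · rw [collapse_of_mem h]; exact v.2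
    · rw [collapse_of_notMem h]; rfl⟩

/-- The sets of representatives are the fibers of the contraction on vertices, so the cyclic order
of the half is the image of that of `Ω`. -/
theorem mem_reps_iff {n : ℕ} (h : Ω.IsSimple n) {x : (Ω.half A).Vertex} {v : Ω.Vertex} :
    v ∈ HalfCell.reps (A := A) x.1 ↔ collapseVertex A v = x := by
  match x with
  | ⟨.apex, hx⟩ =>
    change v ∈ Aᶜ ↔ _
    constructor
    · intro hv
      exact Subtype.ext (collapse_of_notMem fun h' => hv ((vertex_mem_side_iff h).1 h'))
    · intro e hv
      have e := congrArg Subtype.val e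
      rw [show (collapseVertex A v).1 = _ from
        collapse_of_mem ((vertex_mem_side_iff h).2 hv)] at e
      exact HalfCell.cell_ne_apex _ _ e
  | ⟨.cell c hc, hx⟩ =>
    change v.1 = c ↔ _
    constructor
    · rintro rfl
      exact Subtype.ext (collapse_of_mem hc)
    · intro e
      have e : Ω.collapse A v.1 = .cell c hc := congrArg Subtype.val e
      by_cases hv : v.1 ∈ Ω.side A
      · rw [collapse_of_mem hv] at e
        exact HalfCell.cell.inj e
      · rw [collapse_of_notMem hv] at e
        exact absurd e.symm (HalfCell.cell_ne_apex _ _)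

theorem collapseVertex_surjective {n : ℕ} (h : Ω.IsSimple n) (hA : Ω.IsCompatibleDivision A)
    (x : (Ω.half A).Vertex) : ∃ v, collapseVertex A v = x := by
  match x with
  | ⟨.apex, hx⟩ =>
    obtain ⟨-, -, b, hb, -⟩ := hA.rest
    exact ⟨b, (mem_reps_iff h).1 hb⟩
  | ⟨.cell c hc, hx⟩ => exact ⟨⟨c, hx⟩, (mem_reps_iff h).1 rfl⟩

theorem collapseVertex_eq_iff {n : ℕ} (h : Ω.IsSimple n) {v v' : Ω.Vertex} :
    collapseVertex A v = collapseVertex A v' ↔ v = v' ∨ (v ∉ A ∧ v' ∉ A) := by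
  by_cases hv : v ∈ A
  · have e : collapseVertex A v = ⟨.cell v.1 ((vertex_mem_side_iff h).2 hv), v.2⟩ :=
      Subtype.ext (collapse_of_mem _)
    rw [eq_comm, e, ← mem_reps_iff h]
    refine ⟨fun e' => Or.inl (Subtype.ext (e' : v'.1 = v.1)).symm, ?_⟩
    rintro (rfl | h')
    · exact rfl
    · exact absurd hv h'.1
  · have e : collapseVertex A v = ⟨.apex, rfl⟩ :=
      Subtype.ext (collapse_of_notMem fun h' => hv ((vertex_mem_side_iff h).1 h'))
    rw [eq_comm, e, ← mem_reps_iff h]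
    refine ⟨fun h' => Or.inr ⟨hv, h'⟩, ?_⟩
    rintro (rfl | h')
    · exact hv
    · exact h'.2

theorem half_cyc_iff {n : ℕ} (h : Ω.IsSimple n) {x y z : (Ω.half A).Vertex} :
    (Ω.half A).cyc x y z ↔ x ≠ y ∧ y ≠ z ∧ x ≠ z ∧ ∃ a b c, collapseVertex A a = x ∧
      collapseVertex A b = y ∧ collapseVertex A c = z ∧ Ω.cyc a b c := by
  refine and_congr Iff.rfl (and_congr Iff.rfl (and_congr Iff.rfl ?_))
  constructor
  · rintro ⟨a, ha, b, hb, c, hc, h'⟩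
    exact ⟨a, b, c, (mem_reps_iff h).1 ha, (mem_reps_iff h).1 hb, (mem_reps_iff h).1 hc, h'⟩
  · rintro ⟨a, b, c, ha, hb, hc, h'⟩
    exact ⟨a, (mem_reps_iff h).2 ha, b, (mem_reps_iff h).2 hb, c, (mem_reps_iff h).2 hc, h'⟩

section Cyc

variable {n : ℕ} (h : Ω.IsCyclicComplex n) (hconn : Ω.IsConnectedOn Set.univ)
  (hA : Ω.IsCompatibleDivision A)

include h hconn hA

/-- If `a` and `a'` are different and both contracted, then `b` and `c` lie in `A`. Were `a'` on the
other arc between `b` and `c` than `a`, the pairs `b, c` and `a, a'` would alternate, contrary to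
compatibility. -/
theorem cyc_of_collapse_eq_left {a a' b c : Ω.Vertex}
    (ha : collapseVertex A a = collapseVertex A a')
    (hab : collapseVertex A a ≠ collapseVertex A b) (hac : collapseVertex A a ≠ collapseVertex A c)
    (hbc : collapseVertex A b ≠ collapseVertex A c) (hcyc : Ω.cyc a b c) : Ω.cyc a' b c := by
  rcases (collapseVertex_eq_iff h.simple).1 ha with rfl | ⟨h1, h2⟩
  · exact hcyc
  have hb : b ∈ A := by
    by_contra hb
    exact hab ((collapseVertex_eq_iff h.simple).2 (Or.inr ⟨h1, hb⟩))
  have hc : c ∈ A := by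
    by_contra hc
    exact hac ((collapseVertex_eq_iff h.simple).2 (Or.inr ⟨h1, hc⟩))
  rcases h.cyc_total a' b c (fun e => h2 (e ▸ hb)) (fun e => hbc (e ▸ rfl))
    (fun e => h2 (e ▸ hc)) (hconn.2 _ trivial _ trivial) (hconn.2 _ trivial _ trivial) with h3 | h3
  · exact h3
  · exact absurd ⟨b, hb, c, hc, a', h2, a, h1, h.cyc_rotate _ _ _ h3,
      h.cyc_rotate _ _ _ (h.cyc_rotate _ _ _ hcyc)⟩ hA.compatible

theorem cyc_of_collapse_eq {a a' b b' c c' : Ω.Vertex}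
    (ha : collapseVertex A a = collapseVertex A a') (hb : collapseVertex A b = collapseVertex A b')
    (hc : collapseVertex A c = collapseVertex A c')
    (hab : collapseVertex A a ≠ collapseVertex A b) (hac : collapseVertex A a ≠ collapseVertex A c)
    (hbc : collapseVertex A b ≠ collapseVertex A c) (hcyc : Ω.cyc a b c) : Ω.cyc a' b' c' := by
  have h1 := cyc_of_collapse_eq_left h hconn hA ha hab hac hbc hcyc
  have h2 := cyc_of_collapse_eq_left h hconn hA hb hbc (ha ▸ hab.symm) (ha ▸ hac.symm)
    (h.cyc_rotate _ _ _ h1)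
  have h3 := cyc_of_collapse_eq_left h hconn hA hc (ha ▸ hac.symm) (hb ▸ hbc.symm)
    (ha ▸ hb ▸ hab) (h.cyc_rotate _ _ _ h2)
  exact h.cyc_rotate _ _ _ h3

theorem half_cyc_collapse {a b c : Ω.Vertex}
    (hab : collapseVertex A a ≠ collapseVertex A b) (hac : collapseVertex A a ≠ collapseVertex A c)
    (hbc : collapseVertex A b ≠ collapseVertex A c) :
    (Ω.half A).cyc (collapseVertex A a) (collapseVertex A b) (collapseVertex A c) ↔
      Ω.cyc a b c := by
  rw [half_cyc_iff h.simple]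
  constructor
  · rintro ⟨-, -, -, a', b', c', ha, hb, hc, h'⟩
    exact cyc_of_collapse_eq h hconn hA ha hb hc (ha ▸ hb ▸ hab) (ha ▸ hc ▸ hac)
      (hb ▸ hc ▸ hbc) h'
  · exact fun h' => ⟨hab, hbc, hac, a, b, c, rfl, rfl, rfl, h'⟩

theorem half_isCyclicComplex {D : ℕ} (hcut : Ω.IsCut D A) (hn : n = D + 1) :
    (Ω.half A).IsCyclicComplex n := by
  have hconn' := hA.half_isConnectedOn h.simple hconn
  have hsurj := collapseVertex_surjective h.simple hA
  have hne : ∀ {x y z}, (Ω.half A).cyc x y z → x ≠ y ∧ y ≠ z ∧ x ≠ z :=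
    fun h' => ⟨h'.1, h'.2.1, h'.2.2.1⟩
  have hiff : ∀ {a b c}, collapseVertex A a ≠ collapseVertex A b →
      collapseVertex A a ≠ collapseVertex A c → collapseVertex A b ≠ collapseVertex A c →
      ((Ω.half A).cyc (collapseVertex A a) (collapseVertex A b) (collapseVertex A c) ↔
        Ω.cyc a b c) := half_cyc_collapse h hconn hA
  subst hn
  refine { simple := hcut.half_isSimple h.simple
           orientation := half_isOrientation h.simple h.orientation
           color_inj := ?_
           cyc_component := fun a b c _ =>
            ⟨hconn'.2 _ trivial _ trivial, hconn'.2 _ trivial _ trivial⟩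
           cyc_rotate := ?_
           cyc_asymm := ?_
           cyc_trans := ?_
           cyc_total := ?_ }
  · intro x y hx hy _ hdim hcol
    match x, y, hx, hy, hdim, hcol with
    | .apex, _, hx, _, _, _ => exact absurd rfl hx
    | .cell c hc, .apex, _, hy, _, _ => exact absurd rfl hy
    | .cell c hc, .cell d hd, hx, hy, hdim, hcol =>
      have := h.color_inj c d hx hy (hconn.2 _ trivial _ trivial) hdim hcol
      subst this
      rfl
  · intro x y z hxyz
    obtain ⟨h1, h2, h3⟩ := hne hxyz
    obtain ⟨a, rfl⟩ := hsurj x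
    obtain ⟨b, rfl⟩ := hsurj y
    obtain ⟨c, rfl⟩ := hsurj z
    rw [hiff h1 h3 h2] at hxyz
    rw [hiff h2 h1.symm h3.symm]
    exact h.cyc_rotate _ _ _ hxyz
  · intro x y z hxyz hzyx
    obtain ⟨h1, h2, h3⟩ := hne hxyz
    obtain ⟨a, rfl⟩ := hsurj x
    obtain ⟨b, rfl⟩ := hsurj y
    obtain ⟨c, rfl⟩ := hsurj z
    rw [hiff h1 h3 h2] at hxyz
    rw [hiff h2.symm h3.symm h1.symm] at hzyx
    exact h.cyc_asymm _ _ _ hxyz hzyx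
  · intro x y z w hxyz hxzw
    obtain ⟨h1, h2, h3⟩ := hne hxyz
    obtain ⟨k1, k2, k3⟩ := hne hxzw
    obtain ⟨a, rfl⟩ := hsurj x
    obtain ⟨b, rfl⟩ := hsurj y
    obtain ⟨c, rfl⟩ := hsurj z
    obtain ⟨d, rfl⟩ := hsurj w
    rw [hiff h1 h3 h2] at hxyz
    -- If `y = w`, the two hypotheses would be the orders `(x, y, z)` and `(x, z, y)`, contrary to
    -- asymmetry. Otherwise all triples are of different vertices and can be lifted.
    by_cases hbd : collapseVertex A b = collapseVertex A d
    · rw [← hbd, hiff h3 h1 h2.symm] at hxzw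
      exact absurd (h.cyc_rotate _ _ _ hxzw) (h.cyc_asymm _ _ _ hxyz)
    · rw [hiff k1 k3 k2] at hxzw
      rw [hiff h1 k3 hbd]
      exact h.cyc_trans _ _ _ _ hxyz hxzw
  · intro x y z h1 h2 h3 _ _
    obtain ⟨a, rfl⟩ := hsurj x
    obtain ⟨b, rfl⟩ := hsurj y
    obtain ⟨c, rfl⟩ := hsurj z
    rw [hiff h1 h3 h2, hiff h2.symm h3.symm h1.symm]
    exact h.cyc_total a b c (fun e => h1 (e ▸ rfl)) (fun e => h2 (e ▸ rfl))
      (fun e => h3 (e ▸ rfl)) (hconn.2 _ trivial _ trivial) (hconn.2 _ trivial _ trivial)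

end Cyc

end CyclicData

/-! ### Cuts of a half -/

namespace CyclicData

variable {S : Type u} {Ω : CyclicData S} {A : Set Ω.Vertex}

/-- The vertices of `Ω` that survive in the half and belong to the set `A'` of its vertices. -/
def pullVertices (A' : Set (Ω.half A).Vertex) : Set Ω.Vertex := {v | collapseVertex A v ∈ A'}

section Sides

variable {n : ℕ} {A' : Set (Ω.half A).Vertex}

/-- A surviving cell contains the new vertex exactly when it has a vertex outside `A`, and all those
vertices lie in the preimage of `A'` or none does. So passing to the preimage is compatible with
sides whether or not `A'` contains the new vertex. -/
theorem mem_half_side_iff (h : Ω.IsSimple n) {c : Ω.Cell} (hc : c ∈ Ω.side A) :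
    HalfCell.cell c hc ∈ (Ω.half A).side A' ↔ c ∈ Ω.side (pullVertices A') := by
  constructor
  · rintro ⟨x, hx, hxc⟩
    match x, hx, hxc with
    | ⟨.apex, h0⟩, hx, hxc =>
      obtain ⟨b, hb, hbc⟩ := apex_le_cell.1 hxc
      refine ⟨b, ?_, hbc⟩
      rwa [pullVertices, Set.mem_ofPred_eq, (mem_reps_iff h (x := ⟨.apex, h0⟩)).1 hb]
    | ⟨.cell d hd, h0⟩, hx, hxc =>
      refine ⟨⟨d, h0⟩, ?_, hxc⟩
      rwa [pullVertices, Set.mem_ofPred_eq, (mem_reps_iff h (x := ⟨.cell d hd, h0⟩)).1 rfl]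
  · rintro ⟨v, hv, hvc⟩
    refine ⟨collapseVertex A v, hv, ?_⟩
    rw [← collapse_of_mem hc]
    exact collapse_mono h hvc

theorem pullVertices_subset (h : Ω.IsSimple n) (ha : (⟨.apex, rfl⟩ : (Ω.half A).Vertex) ∉ A') :
    pullVertices A' ⊆ A := fun v hv => by
  by_contra hvA
  have : collapseVertex A v = ⟨.apex, rfl⟩ := (mem_reps_iff h).1 hvA
  exact ha (this ▸ hv)

theorem apex_notMem_side (ha : (⟨.apex, rfl⟩ : (Ω.half A).Vertex) ∉ A') :
    HalfCell.apex ∉ (Ω.half A).side A' := by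
  rintro ⟨⟨x, h0⟩, hx, hxa⟩
  cases x with
  | apex => exact ha hx
  | cell c hc => exact not_cell_le_apex hxa

theorem mem_half_crossing_iff (h : Ω.IsSimple n) {c : Ω.Cell} (hc : c ∈ Ω.side A) :
    HalfCell.cell c hc ∈ (Ω.half A).crossing A' ↔ c ∈ Ω.crossing (pullVertices A') :=
  and_congr Iff.rfl (and_congr (mem_half_side_iff h hc) (mem_half_side_iff h hc))

end Sides

/-- The division `A'` comes from a division `B ⊆ A` of the vertices of `Ω`. Every cell that has a
vertex in `B` survives in the half, so the cut complex and the balls on the side of `B` are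
unchanged. The balls on the other side contain the contracted region, and there the far ball of the
cut along `A` is again exchanged for a cone. -/
theorem half_isCut_of_apex_notMem {D : ℕ} (h : Ω.IsBrane D) (hconn : Ω.IsConnectedOn Set.univ)
    (hA : Ω.IsCompatibleDivision A) {A' : Set (Ω.half A).Vertex}
    (ha : (⟨.apex, rfl⟩ : (Ω.half A).Vertex) ∉ A') (hA' : (Ω.half A).IsCompatibleDivision A') :
    (Ω.half A).IsCut D A' := by
  have hX := h.simple
  have hcut := h.cut A hA
  have hconn' := hA.half_isConnectedOn hX hconn
  have hsurj := collapseVertex_surjective hX hA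
  set B := pullVertices A' with hB
  have hBA : B ⊆ A := pullVertices_subset hX ha
  have hdiv : Ω.IsCompatibleDivision B := by
    refine ⟨?_, fun _ _ _ _ => hconn.2 _ trivial _ trivial, ?_, ?_⟩
    · obtain ⟨x, hx⟩ := hA'.nonempty
      obtain ⟨v, rfl⟩ := hsurj x
      exact ⟨v, hx⟩
    · obtain ⟨x, hx, y, hy, -⟩ := hA'.rest
      obtain ⟨v, rfl⟩ := hsurj x
      obtain ⟨u, rfl⟩ := hsurj y
      exact ⟨v, hx, u, hy, hconn.2 _ trivial _ trivial⟩
    · rintro ⟨a, ha, a', ha', b, hb, b', hb', h1, h2⟩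
      have hne : ∀ {p q : Ω.Vertex}, p ∈ B → q ∉ B → collapseVertex A p ≠ collapseVertex A q :=
        fun hp hq e => hq (show collapseVertex A _ ∈ A' from e ▸ hp)
      -- Different vertices of `A` stay different under the contraction, and `B ⊆ A`.
      have haa' : collapseVertex A a ≠ collapseVertex A a' := fun e => by
        rcases (collapseVertex_eq_iff hX).1 e with rfl | h'
        · exact h.cyc_asymm _ _ _ h1 h1
        · exact h'.1 (hBA ha)
      refine hA'.compatible ⟨_, ha, _, ha', _, hb, _, hb', ?_, ?_⟩
      · exact (half_cyc_collapse h.toIsCyclicComplex hconn hA (hne ha hb) haa'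
          (hne ha' hb).symm).2 h1
      · exact (half_cyc_collapse h.toIsCyclicComplex hconn hA (hne ha' hb') haa'.symm
          (hne ha hb').symm).2 h2
  have hcutB := h.cut B hdiv
  have hsub : Ω.side B ⊆ Ω.side A := side_mono hBA
  have hcr : Ω.crossing B ⊆ Ω.side A := fun c hc => hsub hc.2.1
  have hax : HalfCell.apex ∉ (Ω.half A).side A' := apex_notMem_side ha
  have hcross : ∀ c (hc : c ∈ Ω.crossing B),
      HalfCell.cell c (hcr hc) ∈ (Ω.half A).crossing A' := fun c hc =>
    (mem_half_crossing_iff hX _).2 hc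
  have hI : ∀ {c : Ω.Cell} (hc : c ∈ Ω.side A) {T : Set Ω.Cell} {T' : Set (HalfCell Ω A)},
      T ⊆ Ω.side A → .apex ∉ T' → (∀ d hd, .cell d hd ∈ T' ↔ d ∈ T) →
      Ω.collapse A '' (T ∩ Set.Iio c) = T' ∩ Set.Iio (.cell c hc) := fun hc T T' hT h1 h2 =>
    image_collapse (Set.inter_subset_left.trans hT) (fun h' => h1 h'.1) fun d hd =>
      and_congr (h2 d hd) cell_lt_cell
  have hIc : ∀ {c : Ω.Cell} (hc : c ∈ Ω.side A),
      Ω.collapse A '' (Ω.crossing B ∩ Set.Iio c) =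
        (Ω.half A).crossing A' ∩ Set.Iio (.cell c hc) := fun hc =>
    hI hc hcr (fun h' => hax h'.2.1) fun d hd => mem_half_crossing_iff hX hd
  let e : {c // c ∈ Ω.crossing B} ≃o {x // x ∈ (Ω.half A).crossing A'} :=
    { toEquiv := Equiv.ofBijective (fun c => ⟨.cell c.1 (hcr c.2), hcross c.1 c.2⟩)
        ⟨fun c d h => Subtype.ext (HalfCell.cell.inj (congrArg Subtype.val h)), by
          rintro ⟨x, hx⟩
          cases x with
          | apex => exact absurd hx.2.1 hax
          | cell c hc => exact ⟨⟨c, (mem_half_crossing_iff hX hc).1 hx⟩, rfl⟩⟩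
      map_rel_iff' := Iff.rfl }
  refine ⟨hA', ?_, ?_, ?_, ?_, ?_, ?_⟩
  · exact CellComplex.IsSimple.congr (X := (Ω.cutComplex B).toCellComplex)
      (Y := ((Ω.half A).cutComplex A').toCellComplex) e (fun _ => rfl) hcutB.simple
  · exact CellComplex.IsConnectedOn.map (X := (Ω.cutComplex B).toCellComplex)
      (Y := ((Ω.half A).cutComplex A').toCellComplex) e (T := Set.univ) (fun _ _ => trivial)
      (fun y _ => ⟨e.symm y, trivial, e.apply_symm_apply y⟩)
      (fun _ _ _ _ h => Or.inl (e.le_iff_le.2 h)) hcutB.connected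
  · intro x hx
    match x, hx with
    | .apex, hx => exact absurd hx.2.1 hax
    | .cell c hc, hx =>
      have hb := hcutB.ball_side c ((mem_half_crossing_iff hX hc).1 hx)
      rw [← isBallPair_image_iff (f := Ω.collapse A)
        (Set.inter_subset_inter_left _ fun d hd => hd.2.1)
        (fun x hx y hy => collapse_le_iff (hsub hx.1) (hsub hy.1)), hIc hc,
        hI hc hsub hax fun d hd => mem_half_side_iff hX hd] at hb
      exact hb
  · intro x hx
    match x, hx with
    | .apex, hx => exact absurd hx.2.1 hax
    | .cell c hc, hx =>
      have hb := hcutB.ball_other_side c ((mem_half_crossing_iff hX hc).1 hx)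
      by_cases hc' : c ∈ Ω.side Aᶜ
      · obtain ⟨H, h1, h2⟩ := exists_homeomorph_Iio_cell hX hcut hc hc'
        have hUA : Ω.side A ∩ Ω.side Bᶜ ∩ Set.Iio c ⊆ Ω.side A ∩ Set.Iio c :=
          Set.inter_subset_inter_left _ Set.inter_subset_left
        have hcompl : Ω.side Aᶜ ⊆ Ω.side Bᶜ := side_mono (Set.compl_subset_compl.2 hBA)
        -- The part of the boundary of `c` away from `B` splits into the cells that survive in the
        -- half and the ball that is exchanged for the cone.
        have hU : (Ω.side A ∩ Ω.side Bᶜ ∩ Set.Iio c) ∪ (Ω.side Aᶜ ∩ Set.Iio c) =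
            Ω.side Bᶜ ∩ Set.Iio c := by
          ext d
          have := Ω.mem_side_or hX A d
          have := @hcompl d
          simp only [Set.mem_union, Set.mem_inter_iff]
          tauto
        have hU' : insert .apex (Ω.collapse A '' (Ω.side A ∩ Ω.side Bᶜ ∩ Set.Iio c)) =
            (Ω.half A).side A'ᶜ ∩ Set.Iio (.cell c hc) := by
          refine insert_apex_image_collapse (fun d hd => hd.1.1)
            ⟨⟨⟨.apex, rfl⟩, ha, le_rfl⟩, apex_lt_cell.2 hc'⟩ fun d hd => ?_
          refine and_congr ((mem_half_side_iff hX hd).trans ?_) cell_lt_cell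
          exact ⟨fun h' => ⟨hd, h'⟩, fun h' => h'.2⟩
        have h2' := fun w => h2 w _ hUA fun d hd => ⟨⟨hd.1.2.1, hcompl hd.1.2.2⟩, hd.2⟩
        rw [hU, hU'] at h2'
        obtain ⟨k, hk⟩ := exists_homeomorph_restrict H (realization_mono Set.inter_subset_right)
          (realization_mono Set.inter_subset_right) h2'
        refine hb.of_homeomorph k fun w => ?_
        have hw := h1 ⟨w.1, realization_mono Set.inter_subset_right w.2⟩ _
          (Set.inter_subset_inter_left (Set.Iio c) hcr)
        rw [← hk w.1 w.2, hIc hc] at hw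
        exact hw
      · have hIio : Set.Iio c ⊆ Ω.side A := fun d hd =>
          (Ω.mem_side_or hX A d).resolve_right fun h' => hc' (side_upward h' (le_of_lt hd))
        have e1 : Ω.collapse A '' (Ω.side Bᶜ ∩ Set.Iio c) =
            (Ω.half A).side A'ᶜ ∩ Set.Iio (.cell c hc) :=
          image_collapse (fun d hd => hIio hd.2)
            (fun h' => hc' ((apex_lt_cell (hc := hc)).1 h'.2)) fun d hd =>
            and_congr (mem_half_side_iff hX hd) cell_lt_cell
        rw [← isBallPair_image_iff (f := Ω.collapse A)
          (Set.inter_subset_inter_left _ fun d hd => hd.2.2)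
          (fun x hx y hy => collapse_le_iff (hIio hx.2) (hIio hy.2)), hIc hc, e1] at hb
        exact hb
  · refine CellComplex.IsConnectedOn.map (Y := (Ω.half A).toCellComplex) (Ω.collapse A)
      (fun c hc => ?_) (fun x hx => ?_) (fun _ _ _ _ hcd => Or.inl (collapse_mono hX hcd))
      hcutB.connected_side
    · have hcA : c ∈ Ω.side A := hsub ((Ω.mem_side_or hX B c).resolve_right hc)
      rw [collapse_of_mem hcA]
      exact fun h' => hc ((mem_half_side_iff hX hcA).1 h')
    · match x, hx with
      | .apex, hx => exact absurd ⟨⟨.apex, rfl⟩, ha, le_rfl⟩ hx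
      | .cell d hd, hx =>
        exact ⟨d, fun h' => hx ((mem_half_side_iff hX hd).2 h'), collapse_of_mem hd⟩
  · have hex : ∀ x, ∃ a ∈ A', (Ω.half A).SameComponent a.1 x := fun x =>
      hA'.nonempty.imp fun a ha => ⟨ha, hconn'.2 _ trivial _ trivial⟩
    have hex' : ∀ x, ∃ a ∈ B, Ω.SameComponent a.1 x := fun x =>
      hdiv.nonempty.imp fun a ha => ⟨ha, hconn.2 _ trivial _ trivial⟩
    refine CellComplex.IsConnectedOn.map (Y := (Ω.half A).toCellComplex) (Ω.collapse A)
      (fun c hc => ⟨hex _, ?_⟩) (fun x hx => ?_)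
      (fun _ _ _ _ hcd => Or.inl (collapse_mono hX hcd)) hcutB.connected_other_side
    · by_cases hcA : c ∈ Ω.side A
      · rw [collapse_of_mem hcA]
        exact fun h' => hc.2 ((mem_half_side_iff hX hcA).1 h')
      · rw [collapse_of_notMem hcA]
        exact hax
    · match x, hx with
      | .apex, hx =>
        -- Every vertex outside `A` is contracted to the new vertex.
        obtain ⟨-, -, b, hb, -⟩ := hA.rest
        have hbA : b.1 ∉ Ω.side A := fun h' => hb ((vertex_mem_side_iff hX).1 h')
        exact ⟨b.1, ⟨hex' _, fun h' => hbA (hsub h')⟩, collapse_of_notMem hbA⟩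
      | .cell d hd, hx =>
        exact ⟨d, ⟨hex' _, fun h' => hx.2 ((mem_half_side_iff hX hd).2 h')⟩,
          collapse_of_mem hd⟩

/-- The half of a connected brane complex after contraction of a cut is a brane complex. -/
theorem IsBrane.half {D : ℕ} (h : Ω.IsBrane D) (hconn : Ω.IsConnectedOn Set.univ)
    (hA : Ω.IsCompatibleDivision A) : (Ω.half A).IsBrane D where
  toIsCyclicComplex := half_isCyclicComplex h.toIsCyclicComplex hconn hA (h.cut A hA) rfl
  cut A' hA' := by
    have hcyc := half_isCyclicComplex h.toIsCyclicComplex hconn hA (h.cut A hA) rfl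
    have hconn' := hA.half_isConnectedOn h.simple hconn
    -- A cut realizes a division together with its complement, so the new vertex may be assumed to
    -- lie outside the given set.
    by_cases ha : (⟨.apex, rfl⟩ : (Ω.half A).Vertex) ∈ A'
    · have := half_isCut_of_apex_notMem h hconn hA (A' := A'ᶜ) (fun h' => h' ha)
        (hA'.compl hcyc hconn')
      rw [← compl_compl A']
      exact this.compl hcyc hconn'
    · exact half_isCut_of_apex_notMem h hconn hA ha hA'

end CyclicData

namespace CyclicData

variable {S : Type u}

/-! ### Disjoint unions -/

/-- The inclusion of a union of connected components. -/
structure ClopenEmbedding (Ω₁ Ω : CyclicData S) where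
  toFun : Ω₁.Cell ↪o Ω.Cell
  dim_eq : ∀ c, Ω.dim (toFun c) = Ω₁.dim c
  inc_eq : ∀ c d, Ω.inc (toFun c) (toFun d) = Ω₁.inc c d
  inc_of_notMem : ∀ c x, x ∉ Set.range toFun → Ω.inc (toFun c) x = 0
  color_eq : ∀ c h h', Ω.color (toFun c) h = Ω₁.color c h'
  closed : ∀ c x, toFun c ≤ x ∨ x ≤ toFun c → x ∈ Set.range toFun
  cyc_iff : ∀ a b c : Ω₁.Vertex,
    Ω.cyc ⟨toFun a.1, (dim_eq a.1).trans a.2⟩ ⟨toFun b.1, (dim_eq b.1).trans b.2⟩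
      ⟨toFun c.1, (dim_eq c.1).trans c.2⟩ ↔ Ω₁.cyc a b c
  cyc_closed : ∀ (a : Ω₁.Vertex) (b c : Ω.Vertex),
    Ω.cyc ⟨toFun a.1, (dim_eq a.1).trans a.2⟩ b c →
      b.1 ∈ Set.range toFun ∧ c.1 ∈ Set.range toFun

namespace ClopenEmbedding

variable {Ω₁ Ω : CyclicData S} (f : ClopenEmbedding Ω₁ Ω)

def vertex (v : Ω₁.Vertex) : Ω.Vertex := ⟨f.toFun v.1, (f.dim_eq v.1).trans v.2⟩

theorem exists_vertex {v : Ω.Vertex} (h : v.1 ∈ Set.range f.toFun) : ∃ u, f.vertex u = v := by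
  obtain ⟨c, hc⟩ := h
  exact ⟨⟨c, by rw [← f.dim_eq, hc]; exact v.2⟩, Subtype.ext hc⟩

theorem lt_iff {c d : Ω₁.Cell} : f.toFun c < f.toFun d ↔ c < d := f.toFun.lt_iff_lt

theorem image_inter_Iio {T : Set Ω₁.Cell} {T' : Set Ω.Cell} (h : ∀ c, f.toFun c ∈ T' ↔ c ∈ T)
    (c : Ω₁.Cell) : f.toFun '' (T ∩ Set.Iio c) = T' ∩ Set.Iio (f.toFun c) := by
  ext x
  constructor
  · rintro ⟨d, hd, rfl⟩
    exact ⟨(h d).2 hd.1, f.lt_iff.2 hd.2⟩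
  · rintro ⟨hx, hxc⟩
    obtain ⟨d, rfl⟩ := f.closed c x (Or.inr (le_of_lt hxc))
    exact ⟨d, ⟨(h d).1 hx, f.lt_iff.1 hxc⟩, rfl⟩

theorem image_Iio (c : Ω₁.Cell) : f.toFun '' Set.Iio c = Set.Iio (f.toFun c) := by
  have := f.image_inter_Iio (T := Set.univ) (T' := Set.univ) (fun _ => Iff.rfl) c
  rwa [Set.univ_inter, Set.univ_inter] at this

theorem image_Iic (c : Ω₁.Cell) : f.toFun '' Set.Iic c = Set.Iic (f.toFun c) := by
  rw [← Set.Iio_insert, Set.image_insert_eq, f.image_Iio, Set.Iio_insert]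

theorem ball_iff {T U : Set Ω₁.Cell} (hU : U ⊆ T) (n : ℕ) :
    IsBallPair n (realization (f.toFun '' T)) (realization (f.toFun '' U)) ↔
      IsBallPair n (realization T) (realization U) :=
  isBallPair_image_iff hU (fun _ _ _ _ => f.toFun.le_iff_le) n

theorem sum_eq (F : Ω.Cell → ℤ) (hF : ∀ x, x ∉ Set.range f.toFun → F x = 0) :
    ∑ x, F x = ∑ c, F (f.toFun c) :=
  (Fintype.sum_of_injective f.toFun f.toFun.injective (fun c => F (f.toFun c)) F hF
    fun _ => rfl).symm

/-- The image is closed under incidence, so a chain of incident cells that starts in it never leaves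
it. -/
theorem sameComponent_range {c : Ω₁.Cell} {x : Ω.Cell} (h : Ω.SameComponent (f.toFun c) x) :
    ∃ d, f.toFun d = x ∧ Ω₁.SameComponent c d := by
  induction h with
  | refl => exact ⟨c, rfl, Relation.ReflTransGen.refl⟩
  | @tail x y _ hxy ih =>
    obtain ⟨d, rfl, hd⟩ := ih
    obtain ⟨e, rfl⟩ := f.closed d y hxy.2.2
    exact ⟨e, rfl, hd.tail ⟨trivial, trivial,
      hxy.2.2.imp f.toFun.le_iff_le.1 f.toFun.le_iff_le.1⟩⟩

theorem sameComponent_iff {c d : Ω₁.Cell} :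
    Ω.SameComponent (f.toFun c) (f.toFun d) ↔ Ω₁.SameComponent c d := by
  constructor
  · intro h
    obtain ⟨e, he, h'⟩ := f.sameComponent_range h
    rwa [← f.toFun.injective he]
  · exact fun h => CellComplex.Linked.map (Y := Ω.toCellComplex) f.toFun
      (T' := Set.univ) (fun _ _ => trivial) (fun _ _ _ _ hle => Or.inl (f.toFun.le_iff_le.2 hle)) h

theorem mem_side_iff {A : Set Ω.Vertex} {c : Ω₁.Cell} :
    f.toFun c ∈ Ω.side A ↔ c ∈ Ω₁.side (f.vertex ⁻¹' A) := by
  constructor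
  · rintro ⟨a, ha, hac⟩
    obtain ⟨u, rfl⟩ := f.exists_vertex (f.closed c a.1 (Or.inr hac))
    exact ⟨u, ha, f.toFun.le_iff_le.1 hac⟩
  · rintro ⟨a, ha, hac⟩
    exact ⟨f.vertex a, ha, f.toFun.le_iff_le.2 hac⟩

theorem mem_crossing_iff {A : Set Ω.Vertex} {c : Ω₁.Cell} :
    f.toFun c ∈ Ω.crossing A ↔ c ∈ Ω₁.crossing (f.vertex ⁻¹' A) :=
  and_congr (not_congr (by rw [f.dim_eq])) (and_congr f.mem_side_iff f.mem_side_iff)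

theorem mem_range_of_crossing {A : Set Ω.Vertex} (hA : ∀ v ∈ A, v.1 ∈ Set.range f.toFun)
    {x : Ω.Cell} (hx : x ∈ Ω.side A) : x ∈ Set.range f.toFun := by
  obtain ⟨a, ha, hax⟩ := hx
  obtain ⟨u, rfl⟩ := f.exists_vertex (hA a ha)
  exact f.closed u.1 x (Or.inl hax)

/-- All conditions on a cut concern cells in the component of `A`. When `A` lies in the image, this
component does too, and the conditions can be read off from the preimage. -/
theorem isCut {n D : ℕ} (hX : Ω.IsSimple n) (h : Ω₁.IsBrane D) {A : Set Ω.Vertex}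
    (hA : Ω.IsCompatibleDivision A) (hAf : ∀ v ∈ A, v.1 ∈ Set.range f.toFun) : Ω.IsCut D A := by
  have hdiv : Ω₁.IsCompatibleDivision (f.vertex ⁻¹' A) := by
    refine ⟨?_, fun a ha a' ha' => f.sameComponent_iff.1 (hA.component _ ha _ ha'), ?_, ?_⟩
    · obtain ⟨a, ha⟩ := hA.nonempty
      obtain ⟨u, rfl⟩ := f.exists_vertex (hAf a ha)
      exact ⟨u, ha⟩
    · obtain ⟨a, ha, b, hb, hab⟩ := hA.rest
      obtain ⟨u, rfl⟩ := f.exists_vertex (hAf a ha)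
      obtain ⟨d, hd, hud⟩ := f.sameComponent_range hab
      obtain ⟨w, rfl⟩ := f.exists_vertex ⟨d, hd⟩
      exact ⟨u, ha, w, hb, f.sameComponent_iff.1 hab⟩
    · rintro ⟨a, ha, a', ha', b, hb, b', hb', h1, h2⟩
      exact hA.compatible ⟨_, ha, _, ha', _, hb, _, hb', (f.cyc_iff _ _ _).2 h1,
        (f.cyc_iff _ _ _).2 h2⟩
  have hcut := h.cut _ hdiv
  have hcr : ∀ x ∈ Ω.crossing A, x ∈ Set.range f.toFun := fun x hx =>
    f.mem_range_of_crossing hAf hx.2.1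
  let e : {c // c ∈ Ω₁.crossing (f.vertex ⁻¹' A)} ≃o {x // x ∈ Ω.crossing A} :=
    { toEquiv := Equiv.ofBijective (fun c => ⟨f.toFun c.1, f.mem_crossing_iff.2 c.2⟩)
        ⟨fun c d h => Subtype.ext (f.toFun.injective (congrArg Subtype.val h)), by
          rintro ⟨x, hx⟩
          obtain ⟨c, rfl⟩ := hcr x hx
          exact ⟨⟨c, f.mem_crossing_iff.1 hx⟩, rfl⟩⟩
      map_rel_iff' := f.toFun.le_iff_le }
  have hmono : ∀ (T : Set Ω₁.Cell), ∀ c ∈ T, ∀ d ∈ T, c ≤ d →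
      f.toFun c ≤ f.toFun d ∨ f.toFun d ≤ f.toFun c := fun _ _ _ _ _ hle =>
    Or.inl (f.toFun.le_iff_le.2 hle)
  refine ⟨hA, ?_, ?_, ?_, ?_, ?_, ?_⟩
  · exact CellComplex.IsSimple.congr (X := (Ω₁.cutComplex (f.vertex ⁻¹' A)).toCellComplex)
      (Y := (Ω.cutComplex A).toCellComplex) e
      (fun c => congrArg (· - 1) (f.dim_eq c.1)) hcut.simple
  · exact CellComplex.IsConnectedOn.map
      (X := (Ω₁.cutComplex (f.vertex ⁻¹' A)).toCellComplex)
      (Y := (Ω.cutComplex A).toCellComplex) e (T := Set.univ) (fun _ _ => trivial)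
      (fun y _ => ⟨e.symm y, trivial, e.apply_symm_apply y⟩)
      (fun _ _ _ _ h => Or.inl (e.le_iff_le.2 h)) hcut.connected
  · intro x hx
    obtain ⟨c, rfl⟩ := hcr x hx
    have hb := hcut.ball_side c (f.mem_crossing_iff.1 hx)
    rwa [← f.ball_iff (Set.inter_subset_inter_left _ fun d hd => hd.2.1),
      f.image_inter_Iio (fun d => f.mem_side_iff), f.image_inter_Iio (fun d => f.mem_crossing_iff),
      ← f.dim_eq] at hb
  · intro x hx
    obtain ⟨c, rfl⟩ := hcr x hx
    have hb := hcut.ball_other_side c (f.mem_crossing_iff.1 hx)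
    rwa [← Set.preimage_compl, ← f.ball_iff (Set.inter_subset_inter_left _ fun d hd => hd.2.2),
      f.image_inter_Iio (T' := Ω.side Aᶜ) (fun d => f.mem_side_iff),
      f.image_inter_Iio (fun d => f.mem_crossing_iff), ← f.dim_eq] at hb
  · refine CellComplex.IsConnectedOn.map (Y := Ω.toCellComplex) f.toFun
      (fun c hc => mt f.mem_side_iff.1 hc) (fun x hx => ?_) (hmono _) hcut.connected_side
    obtain ⟨c, rfl⟩ := f.mem_range_of_crossing hAf ((Ω.mem_side_or hX A x).resolve_right hx)
    exact ⟨c, fun h' => hx (f.mem_side_iff.2 h'), rfl⟩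
  · refine CellComplex.IsConnectedOn.map (Y := Ω.toCellComplex) f.toFun
      (fun c hc => ⟨?_, fun h' => hc.2 (f.mem_side_iff.1 h')⟩) (fun x hx => ?_) (hmono _)
      hcut.connected_other_side
    · obtain ⟨a, ha, hac⟩ := hc.1
      exact ⟨f.vertex a, ha, f.sameComponent_iff.2 hac⟩
    · obtain ⟨⟨a, ha, hax⟩, hxA⟩ := hx
      obtain ⟨u, rfl⟩ := f.exists_vertex (hAf a ha)
      obtain ⟨c, rfl, hc⟩ := f.sameComponent_range hax
      exact ⟨c, ⟨⟨u, ha, hc⟩, fun h' => hxA (f.mem_side_iff.2 h')⟩, rfl⟩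

end ClopenEmbedding

/-- A complex that is covered by inclusions of unions of components that are brane complexes is
a brane complex. -/
theorem isBrane_of_cover {Ω : CyclicData S} {D : ℕ}
    (hΩ : ∀ x : Ω.Cell, ∃ Ω₁ : CyclicData S, Ω₁.IsBrane D ∧ ∃ (f : ClopenEmbedding Ω₁ Ω)
      (c : Ω₁.Cell), f.toFun c = x) : Ω.IsBrane D := by
  have hv : ∀ v : Ω.Vertex, ∃ Ω₁ : CyclicData S, Ω₁.IsBrane D ∧ ∃ (f : ClopenEmbedding Ω₁ Ω)
      (u : Ω₁.Vertex), f.vertex u = v := fun v => by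
    obtain ⟨Ω₁, h, f, c, hc⟩ := hΩ v.1
    exact ⟨Ω₁, h, f, f.exists_vertex ⟨c, hc⟩⟩
  have hsimple : Ω.IsSimple (D + 1) := by
    refine ⟨fun x y hxy => ?_, fun x => ?_, fun x => ?_, fun x => ?_⟩ <;>
      obtain ⟨Ω₁, h, f, c, rfl⟩ := hΩ x
    · obtain ⟨d, rfl⟩ := f.closed c y (Or.inl hxy.le)
      rw [f.dim_eq, f.dim_eq]
      exact h.simple.dim_lt c d (f.lt_iff.1 hxy)
    · have := h.simple.ball c
      rwa [← f.ball_iff Set.Iio_subset_Iic_self, f.image_Iic, f.image_Iio, ← f.dim_eq] at this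
    · rw [f.dim_eq]
      exact h.simple.dim_le c
    · obtain ⟨m, hm, hd⟩ := h.simple.pure c
      exact ⟨f.toFun m, f.toFun.le_iff_le.2 hm, (f.dim_eq m).trans hd⟩
  have hori : Ω.IsOrientation := by
    refine ⟨fun x y hyx hd => ?_, fun x y hn => ?_, fun x hx => ?_, fun x y hxy => ?_⟩ <;>
      obtain ⟨Ω₁, h, f, c, rfl⟩ := hΩ x
    · obtain ⟨d, rfl⟩ := f.closed c y (Or.inr hyx.le)
      rw [f.inc_eq]
      rw [f.dim_eq, f.dim_eq] at hd
      exact h.orientation.facet c d (f.lt_iff.1 hyx) hd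
    · by_cases hy : y ∈ Set.range f.toFun
      · obtain ⟨d, rfl⟩ := hy
        rw [f.inc_eq]
        rw [f.dim_eq, f.dim_eq, f.lt_iff] at hn
        exact h.orientation.not_facet c d hn
      · exact f.inc_of_notMem c y hy
    · rw [f.sum_eq _ (f.inc_of_notMem c)]
      simp only [f.inc_eq]
      rw [f.dim_eq] at hx
      exact h.orientation.edge c hx
    · rw [f.sum_eq _ fun z hz => by rw [f.inc_of_notMem c z hz, zero_mul]]
      by_cases hy : y ∈ Set.range f.toFun
      · obtain ⟨b, rfl⟩ := hy
        simp only [f.inc_eq]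
        rw [f.dim_eq, f.dim_eq] at hxy
        exact h.orientation.boundary_boundary c b hxy
      · refine Finset.sum_eq_zero fun d _ => ?_
        rw [f.inc_of_notMem d y hy, mul_zero]
  refine { simple := hsimple, orientation := hori, color_inj := ?_, cyc_component := ?_,
           cyc_rotate := ?_, cyc_asymm := ?_, cyc_trans := ?_, cyc_total := ?_, cut := ?_ }
  · intro x y hx hy hxy hdim hcol
    obtain ⟨Ω₁, h, f, c, rfl⟩ := hΩ x
    obtain ⟨d, rfl, hcd⟩ := f.sameComponent_range hxy
    have hc : Ω₁.dim c ≠ 0 := by rwa [← f.dim_eq]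
    have hd : Ω₁.dim d ≠ 0 := by rwa [← f.dim_eq]
    rw [f.color_eq c hx hc, f.color_eq d hy hd] at hcol
    rw [f.dim_eq, f.dim_eq] at hdim
    rw [h.color_inj c d hc hd hcd hdim hcol]
  · intro x y z hxyz
    obtain ⟨Ω₁, h, f, a, rfl⟩ := hv x
    obtain ⟨hb, hc⟩ := f.cyc_closed a y z hxyz
    obtain ⟨b, rfl⟩ := f.exists_vertex hb
    obtain ⟨c, rfl⟩ := f.exists_vertex hc
    have := h.cyc_component a b c ((f.cyc_iff a b c).1 hxyz)
    exact ⟨f.sameComponent_iff.2 this.1, f.sameComponent_iff.2 this.2⟩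
  · intro x y z hxyz
    obtain ⟨Ω₁, h, f, a, rfl⟩ := hv x
    obtain ⟨hb, hc⟩ := f.cyc_closed a y z hxyz
    obtain ⟨b, rfl⟩ := f.exists_vertex hb
    obtain ⟨c, rfl⟩ := f.exists_vertex hc
    exact (f.cyc_iff b c a).2 (h.cyc_rotate _ _ _ ((f.cyc_iff a b c).1 hxyz))
  · intro x y z hxyz hzyx
    obtain ⟨Ω₁, h, f, a, rfl⟩ := hv x
    obtain ⟨hb, hc⟩ := f.cyc_closed a y z hxyz
    obtain ⟨b, rfl⟩ := f.exists_vertex hb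
    obtain ⟨c, rfl⟩ := f.exists_vertex hc
    exact h.cyc_asymm _ _ _ ((f.cyc_iff a b c).1 hxyz) ((f.cyc_iff c b a).1 hzyx)
  · intro x y z w hxyz hxzw
    obtain ⟨Ω₁, h, f, a, rfl⟩ := hv x
    obtain ⟨hb, hc⟩ := f.cyc_closed a y z hxyz
    obtain ⟨-, hd⟩ := f.cyc_closed a z w hxzw
    obtain ⟨b, rfl⟩ := f.exists_vertex hb
    obtain ⟨c, rfl⟩ := f.exists_vertex hc
    obtain ⟨d, rfl⟩ := f.exists_vertex hd
    exact (f.cyc_iff a b d).2 (h.cyc_trans _ _ _ _ ((f.cyc_iff a b c).1 hxyz)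
      ((f.cyc_iff a c d).1 hxzw))
  · intro x y z hxy hyz hxz h1 h2
    obtain ⟨Ω₁, h, f, a, rfl⟩ := hv x
    obtain ⟨d, hd, had⟩ := f.sameComponent_range h1
    obtain ⟨b, rfl⟩ := f.exists_vertex ⟨d, hd⟩
    obtain ⟨e, he, hbe⟩ := f.sameComponent_range h2
    obtain ⟨c, rfl⟩ := f.exists_vertex ⟨e, he⟩
    exact (h.cyc_total a b c (fun e => hxy (e ▸ rfl)) (fun e => hyz (e ▸ rfl))
      (fun e => hxz (e ▸ rfl)) (f.sameComponent_iff.1 h1) (f.sameComponent_iff.1 h2)).imp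
      (f.cyc_iff a b c).2 (f.cyc_iff c b a).2
  · intro A hA
    -- The set `A` lies in a single component, so the piece of the cover that contains one of its
    -- vertices contains them all.
    obtain ⟨a, ha⟩ := hA.nonempty
    obtain ⟨Ω₁, h, f, u, rfl⟩ := hv a
    refine f.isCut hsimple h hA fun v hvA => ?_
    obtain ⟨d, hd, -⟩ := f.sameComponent_range (hA.component _ ha v hvA)
    exact ⟨d, hd⟩

def ClopenEmbedding.inl (Ω₁ Ω₂ : CyclicData S) : ClopenEmbedding Ω₁ (Ω₁.disjointUnion Ω₂) where
  toFun := ⟨⟨Sum.inl, Sum.inl_injective⟩, Sum.inl_le_inl_iff⟩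
  dim_eq _ := rfl
  inc_eq _ _ := rfl
  inc_of_notMem c x hx := by
    rcases x with x | x
    · exact absurd ⟨x, rfl⟩ hx
    · rfl
  color_eq _ _ _ := rfl
  closed c x hx := by
    rcases x with x | x
    · exact ⟨x, rfl⟩
    · exact absurd hx (not_or.2 ⟨Sum.not_inl_le_inr, Sum.not_inr_le_inl⟩)
  cyc_iff _ _ _ := Iff.rfl
  cyc_closed := by
    rintro a ⟨b | b, hb⟩ ⟨c | c, hc⟩ h
    · exact ⟨⟨b, rfl⟩, ⟨c, rfl⟩⟩
    all_goals exact h.elim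

def ClopenEmbedding.inr (Ω₁ Ω₂ : CyclicData S) : ClopenEmbedding Ω₂ (Ω₁.disjointUnion Ω₂) where
  toFun := ⟨⟨Sum.inr, Sum.inr_injective⟩, Sum.inr_le_inr_iff⟩
  dim_eq _ := rfl
  inc_eq _ _ := rfl
  inc_of_notMem c x hx := by
    rcases x with x | x
    · rfl
    · exact absurd ⟨x, rfl⟩ hx
  color_eq _ _ _ := rfl
  closed c x hx := by
    rcases x with x | x
    · exact absurd hx (not_or.2 ⟨Sum.not_inr_le_inl, Sum.not_inl_le_inr⟩)
    · exact ⟨x, rfl⟩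
  cyc_iff _ _ _ := Iff.rfl
  cyc_closed := by
    rintro a ⟨b | b, hb⟩ ⟨c | c, hc⟩ h
    on_goal 4 => exact ⟨⟨b, rfl⟩, ⟨c, rfl⟩⟩
    all_goals exact h.elim

theorem IsBrane.disjointUnion {Ω₁ Ω₂ : CyclicData S} {D : ℕ} (h₁ : Ω₁.IsBrane D)
    (h₂ : Ω₂.IsBrane D) : (Ω₁.disjointUnion Ω₂).IsBrane D :=
  isBrane_of_cover fun x => match x with
    | .inl c => ⟨Ω₁, h₁, ClopenEmbedding.inl Ω₁ Ω₂, c, rfl⟩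
    | .inr c => ⟨Ω₂, h₂, ClopenEmbedding.inr Ω₁ Ω₂, c, rfl⟩

/-- It supplies the brane hypothesis in the axioms of cut invariance and multiplicativity, so both
can be used at every compatible division of a connected brane complex. -/
theorem IsBrane.cutAlong {Ω : CyclicData S} {D : ℕ} (h : Ω.IsBrane D)
    (hconn : Ω.IsConnectedOn Set.univ) {A : Set Ω.Vertex} (hA : Ω.IsCompatibleDivision A) :
    (Ω.cutAlong A).IsBrane D :=
  (h.half hconn hA).disjointUnion (h.half hconn (hA.compl h.toIsCyclicComplex hconn))

end CyclicData

namespace SliceData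

variable {S : Type u}

/-! ### Suspensions -/

/-- The cells of the suspension: the two new vertices and the suspensions of the cells. -/
inductive SuspensionCell (X : SliceData S) : Type
  | north : SuspensionCell X
  | south : SuspensionCell X
  | cell (c : X.Cell) : SuspensionCell X

namespace SuspensionCell

variable {X : SliceData S}

def le : SuspensionCell X → SuspensionCell X → Prop
  | .north, .north => True
  | .south, .south => True
  | .north, .cell _ => True
  | .south, .cell _ => True
  | .cell c, .cell d => c ≤ d
  | _, _ => False

instance : PartialOrder (SuspensionCell X) where
  le := le
  le_refl x := by cases x <;> simp [le]
  le_trans x y z hxy hyz := by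
    cases x <;> cases y <;> cases z <;> simp only [le] at *
    exact hxy.trans hyz
  le_antisymm x y hxy hyx := by
    cases x <;> cases y <;> simp only [le, SuspensionCell.cell.injEq] at *
    exact le_antisymm hxy hyx

instance : Finite (SuspensionCell X) :=
  Finite.of_injective (β := Bool ⊕ X.Cell)
    (fun x => match x with
      | .north => .inl true
      | .south => .inl false
      | .cell c => .inr c) (by
    intro x y h
    cases x <;> cases y <;> simp_all)

noncomputable instance : Fintype (SuspensionCell X) := Fintype.ofFinite _

def dim : SuspensionCell X → ℕ
  | .north => 0
  | .south => 0
  | .cell c => X.dim c + 1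

theorem cell_le_cell {c d : X.Cell} : (cell c : SuspensionCell X) ≤ cell d ↔ c ≤ d := Iff.rfl

theorem cell_lt_cell {c d : X.Cell} : (cell c : SuspensionCell X) < cell d ↔ c < d := by
  rw [lt_iff_le_not_ge, lt_iff_le_not_ge, cell_le_cell, cell_le_cell]

theorem north_le_cell (c : X.Cell) : (north : SuspensionCell X) ≤ cell c := trivial

theorem south_le_cell (c : X.Cell) : (south : SuspensionCell X) ≤ cell c := trivial

theorem not_cell_le_north {c : X.Cell} : ¬(cell c : SuspensionCell X) ≤ north := fun h => h

theorem not_cell_le_south {c : X.Cell} : ¬(cell c : SuspensionCell X) ≤ south := fun h => h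

theorem not_north_le_south : ¬(north : SuspensionCell X) ≤ south := fun h => h

theorem not_south_le_north : ¬(south : SuspensionCell X) ≤ north := fun h => h

theorem north_ne_south : (north : SuspensionCell X) ≠ south := by simp

theorem cell_ne_north (c : X.Cell) : (cell c : SuspensionCell X) ≠ north := by simp

theorem cell_ne_south (c : X.Cell) : (cell c : SuspensionCell X) ≠ south := by simp

theorem north_lt_cell (c : X.Cell) : (north : SuspensionCell X) < cell c :=
  lt_of_le_of_ne trivial (by simp)

theorem south_lt_cell (c : X.Cell) : (south : SuspensionCell X) < cell c :=
  lt_of_le_of_ne trivial (by simp)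

theorem sum_eq (F : SuspensionCell X → ℤ) :
    ∑ x, F x = F .north + F .south + ∑ c, F (.cell c) := by
  let e : Bool ⊕ X.Cell ≃ SuspensionCell X :=
    { toFun := fun x => match x with
        | .inl true => .north
        | .inl false => .south
        | .inr c => .cell c
      invFun := fun x => match x with
        | .north => .inl true
        | .south => .inl false
        | .cell c => .inr c
      left_inv := fun x => by rcases x with (_ | _) | c <;> rfl
      right_inv := fun x => by cases x <;> rfl }
  rw [← e.sum_comp, Fintype.sum_sum_type, Fintype.sum_bool]
  rfl

end SuspensionCell

open Classical in
/-- The sign of a zero-dimensional cell, extended by one. -/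
noncomputable def signOrOne (X : SliceData S) (c : X.Cell) : ℤ :=
  if h : X.dim c = 0 then X.sign c h else 1

open Classical in
/-- The suspension of a colored complex: the complex with two vertices whose vertex complexes are
the given complex and its reverse. -/
noncomputable def suspension (X : SliceData S) : CyclicData S where
  Cell := SuspensionCell X
  dim := SuspensionCell.dim
  inc x y := match x, y with
    | .cell c, .cell d => -X.inc c d * X.signOrOne d
    | .cell c, .north => if X.dim c = 0 then X.signOrOne c else 0
    | .cell c, .south => if X.dim c = 0 then -X.signOrOne c else 0
    | _, _ => 0
  color x h := match x, h with
    | .cell c, _ => X.color c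
    | .north, h => absurd rfl h
    | .south, h => absurd rfl h
  cyc _ _ _ := False

open SuspensionCell

variable {X : SliceData S} {D : ℕ}

def northPole (X : SliceData S) : X.suspension.Vertex := ⟨SuspensionCell.north, rfl⟩

def southPole (X : SliceData S) : X.suspension.Vertex := ⟨SuspensionCell.south, rfl⟩

theorem eq_northPole_or (v : X.suspension.Vertex) : v = X.northPole ∨ v = X.southPole := by
  match v with
  | ⟨.north, _⟩ => exact Or.inl rfl
  | ⟨.south, _⟩ => exact Or.inr rfl
  | ⟨.cell c, h⟩ => exact absurd h (Nat.succ_ne_zero _)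

theorem northPole_ne_southPole : X.northPole ≠ X.southPole := fun h =>
  north_ne_south (congrArg Subtype.val h)

theorem compl_northPole : ({X.northPole} : Set X.suspension.Vertex)ᶜ = {X.southPole} := by
  ext v
  rcases eq_northPole_or v with rfl | rfl
  · simp [northPole_ne_southPole]
  · simp [northPole_ne_southPole.symm]

theorem IsSlice.signOrOne_eq (h : X.IsSlice D) (c : X.Cell) :
    X.signOrOne c = 1 ∨ X.signOrOne c = -1 := by
  unfold signOrOne
  split_ifs with hc
  · exact h.sign_eq c hc
  · exact Or.inl rfl

theorem signOrOne_of_ne {c : X.Cell} (h : X.dim c ≠ 0) : X.signOrOne c = 1 := dif_neg h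

theorem IsSlice.signOrOne_mul_self (h : X.IsSlice D) (c : X.Cell) :
    X.signOrOne c * X.signOrOne c = 1 := by
  rcases h.signOrOne_eq c with e | e <;> rw [e] <;> rfl

theorem Iio_cell (c : X.Cell) : Set.Iio (cell c : SuspensionCell X) =
    insert .north (insert .south (cell '' Set.Iio c)) := by
  ext x
  cases x with
  | north => simp [north_lt_cell]
  | south => simp [south_lt_cell]
  | cell d => simp [cell_lt_cell]

theorem ne_south_and_mem_Iio_cell (c : X.Cell) (x : SuspensionCell X) :
    x ≠ .south ∧ x ∈ Set.Iio (cell c) ↔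
      x ∈ (insert .north (cell '' Set.Iio c) : Set (SuspensionCell X)) := by
  rw [Iio_cell]
  cases x <;> simp

theorem ne_north_and_mem_Iio_cell (c : X.Cell) (x : SuspensionCell X) :
    x ≠ .north ∧ x ∈ Set.Iio (cell c) ↔
      x ∈ (insert .south (cell '' Set.Iio c) : Set (SuspensionCell X)) := by
  rw [Iio_cell]
  cases x <;> simp

theorem cell_embedding (T : Set X.Cell) : ∀ c ∈ T, ∀ d ∈ T,
    (cell c : SuspensionCell X) ≤ cell d ↔ c ≤ d := fun _ _ _ _ => Iff.rfl

theorem IsSlice.exists_homeomorph_sphere (h : X.IsSlice D) (c : X.Cell) :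
    Nonempty (realization (cell '' Set.Iio c : Set (SuspensionCell X)) ≃ₜ
      Metric.sphere (0 : EuclideanSpace ℝ (Fin (X.dim c))) 1) := by
  obtain ⟨-, g, -⟩ := (h.simple.ball c).exists_homeomorph_sphere Set.Iio_subset_Iic_self
  obtain ⟨e, -⟩ := exists_homeomorph_realization_image (cell_embedding (Set.Iio c))
  exact ⟨e.trans g⟩

/-- The boundary of the suspension of a cell is the suspension of the sphere that bounds the cell,
hence a sphere of one dimension more, and the new cell is the cone over it. -/
theorem IsSlice.suspension_isSimple (h : X.IsSlice D) : X.suspension.IsSimple (D + 1) where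
  dim_lt x y hxy := by
    match x, y, hxy with
    | .cell c, .cell d, hxy => exact Nat.succ_lt_succ (h.simple.dim_lt c d (cell_lt_cell.1 hxy))
    | .north, .cell d, _ => exact Nat.succ_pos _
    | .south, .cell d, _ => exact Nat.succ_pos _
    | .north, .north, hxy => exact absurd hxy (lt_irrefl _)
    | .south, .south, hxy => exact absurd hxy (lt_irrefl _)
    | .north, .south, hxy => exact absurd hxy.le not_north_le_south
    | .south, .north, hxy => exact absurd hxy.le not_south_le_north
    | .cell c, .north, hxy => exact absurd hxy.le not_cell_le_north
    | .cell c, .south, hxy => exact absurd hxy.le not_cell_le_south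
  ball x := by
    have hpt : ∀ p : SuspensionCell X, (∀ y, y ≤ p → y = p) →
        IsBallPair 0 (realization (Set.Iic p)) (realization (Set.Iio p)) := fun p hp => by
      have h1 : Set.Iic p = {p} := Set.Subset.antisymm hp (by simp)
      have h2 : Set.Iio p = ∅ := by
        ext y
        simp only [Set.mem_Iio, Set.mem_empty_iff_false, iff_false]
        exact fun hy => hy.ne (hp y hy.le)
      rw [h1, h2]
      exact isBallPair_point
    match x with
    | .north =>
      refine hpt .north fun y hy => ?_
      cases y with
      | north => rfl
      | south => exact absurd hy not_south_le_north
      | cell c => exact absurd hy not_cell_le_north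
    | .south =>
      refine hpt .south fun y hy => ?_
      cases y with
      | north => exact absurd hy not_north_le_south
      | south => rfl
      | cell c => exact absurd hy not_cell_le_south
    | .cell c =>
      obtain ⟨g⟩ := h.exists_homeomorph_sphere c
      obtain ⟨k⟩ := exists_homeomorph_suspension (p := (north : SuspensionCell X)) (q := .south)
        (by simp) (by simp) not_north_le_south not_south_le_north
        (by rintro _ ⟨d, -, rfl⟩; exact Or.inl (north_le_cell d))
        (by rintro _ ⟨d, -, rfl⟩; exact Or.inl (south_le_cell d)) g
      rw [← Iio_cell] at k
      have := isBallPair_cone (p := (cell c : SuspensionCell X)) (U := Set.Iio _)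
        (by simp) (fun u hu => Or.inr (le_of_lt hu)) k
      rwa [Set.Iio_insert] at this
  dim_le x := by
    match x with
    | .north => exact Nat.zero_le _
    | .south => exact Nat.zero_le _
    | .cell c => exact Nat.succ_le_succ (h.simple.dim_le c)
  pure x := by
    match x with
    | .north =>
      obtain ⟨c, -⟩ := h.connected.1
      obtain ⟨m, -, hm⟩ := h.simple.pure c
      exact ⟨.cell m, north_le_cell m, congrArg (· + 1) hm⟩
    | .south =>
      obtain ⟨c, -⟩ := h.connected.1
      obtain ⟨m, -, hm⟩ := h.simple.pure c
      exact ⟨.cell m, south_le_cell m, congrArg (· + 1) hm⟩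
    | .cell c =>
      obtain ⟨m, hcm, hm⟩ := h.simple.pure c
      exact ⟨.cell m, hcm, congrArg (· + 1) hm⟩

theorem IsSlice.suspension_isConnectedOn (h : X.IsSlice D) :
    X.suspension.IsConnectedOn Set.univ := by
  refine ⟨⟨X.northPole.1, trivial⟩, ?_⟩
  obtain ⟨c₀, -⟩ := h.connected.1
  have hcell : ∀ c, X.suspension.Linked Set.univ (cell c) X.northPole.1 := fun c =>
    Relation.ReflTransGen.single ⟨trivial, trivial, Or.inr (north_le_cell c)⟩
  have hn : ∀ x, X.suspension.Linked Set.univ x X.northPole.1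
    | .north => Relation.ReflTransGen.refl
    | .south => Relation.ReflTransGen.head ⟨trivial, trivial, Or.inl (south_le_cell c₀)⟩ (hcell c₀)
    | .cell c => hcell c
  exact fun x _ y _ => (hn x).trans (hn y).symm

theorem IsSlice.suspension_isOrientation (h : X.IsSlice D) : X.suspension.IsOrientation where
  facet x y hyx hd := by
    match x, y, hyx, hd with
    | .cell c, .cell d, hyx, hd =>
      change -X.inc c d * X.signOrOne d = 1 ∨ -X.inc c d * X.signOrOne d = -1
      rcases h.orientation.facet c d (cell_lt_cell.1 hyx) (Nat.succ_injective hd) with e | e <;>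
        rcases h.signOrOne_eq d with e' | e' <;> rw [e, e'] <;> simp
    | .cell c, .north, _, hd =>
      have hc : X.dim c = 0 := (Nat.succ_injective hd).symm
      change (if X.dim c = 0 then X.signOrOne c else 0) = 1 ∨ (if X.dim c = 0 then X.signOrOne c else 0) = -1
      rw [if_pos hc]
      exact h.signOrOne_eq c
    | .cell c, .south, _, hd =>
      have hc : X.dim c = 0 := (Nat.succ_injective hd).symm
      change (if X.dim c = 0 then -X.signOrOne c else 0) = 1 ∨
        (if X.dim c = 0 then -X.signOrOne c else 0) = -1
      rw [if_pos hc]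
      have := h.signOrOne_eq c
      omega
    | .north, y, _, hd => exact absurd hd (Nat.succ_ne_zero _)
    | .south, y, _, hd => exact absurd hd (Nat.succ_ne_zero _)
  not_facet x y hn := by
    match x, y, hn with
    | .cell c, .cell d, hn =>
      change -X.inc c d * X.signOrOne d = 0
      rw [h.orientation.not_facet c d fun hh => hn ⟨cell_lt_cell.2 hh.1, congrArg (· + 1) hh.2⟩]
      simp
    | .cell c, .north, hn =>
      exact if_neg fun hc => hn ⟨north_lt_cell c, by
        change 0 + 1 = X.dim c + 1; rw [hc]⟩
    | .cell c, .south, hn =>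
      exact if_neg fun hc => hn ⟨south_lt_cell c, by
        change 0 + 1 = X.dim c + 1; rw [hc]⟩
    | .north, y, _ => rfl
    | .south, y, _ => rfl
  edge x hx := by
    match x, hx with
    | .cell c, hx =>
      have hc : X.dim c = 0 := Nat.succ_injective hx
      refine (SuspensionCell.sum_eq fun y => X.suspension.inc (.cell c) y).trans ?_
      change (if X.dim c = 0 then X.signOrOne c else 0) +
        (if X.dim c = 0 then -X.signOrOne c else 0) + ∑ d, -X.inc c d * X.signOrOne d = 0
      rw [if_pos hc, if_pos hc, add_neg_cancel, zero_add]
      refine Finset.sum_eq_zero fun d _ => ?_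
      rw [h.orientation.not_facet c d fun hh => by omega]
      simp
  boundary_boundary x y hxy := by
    match x, y, hxy with
    | .cell c, .cell b, hxy =>
      have hcb : X.dim b + 2 = X.dim c := Nat.succ_injective ((add_right_comm _ _ _).trans hxy)
      refine (SuspensionCell.sum_eq fun z => X.suspension.inc (.cell c) z *
        X.suspension.inc z (.cell b)).trans ?_
      -- The two minus signs cancel. If `d` contributes, it has positive dimension and its sign
      -- factor is one; the factor of `b` does not depend on `d`.
      have e : ∀ d, -X.inc c d * X.signOrOne d * (-X.inc d b * X.signOrOne b) =
          X.inc c d * X.inc d b * X.signOrOne b := fun d => by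
        by_cases hd : X.dim d = 0
        · rw [h.orientation.not_facet d b fun hh => by omega]
          simp
        · rw [signOrOne_of_ne hd]; ring
      change _ * 0 + _ * 0 + ∑ d, -X.inc c d * X.signOrOne d * (-X.inc d b * X.signOrOne b) = 0
      rw [Finset.sum_congr rfl fun d _ => e d, ← Finset.sum_mul,
        h.orientation.boundary_boundary c b hcb]
      simp
    | .cell c, .north, hxy =>
      have hc : X.dim c = 1 := (Nat.succ_injective hxy).symm
      refine (SuspensionCell.sum_eq fun z => X.suspension.inc (.cell c) z *
        X.suspension.inc z .north).trans ?_
      -- The sign of a point occurs twice and squares to one, which leaves the relation between the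
      -- ends of the edge `c` of `X`.
      have e : ∀ d, -X.inc c d * X.signOrOne d * (if X.dim d = 0 then X.signOrOne d else 0) =
          -X.inc c d := fun d => by
        split_ifs with hd
        · rw [mul_assoc, h.signOrOne_mul_self, mul_one]
        · rw [h.orientation.not_facet c d fun hh => hd (by omega)]
          simp
      change _ * 0 + _ * 0 +
        ∑ d, -X.inc c d * X.signOrOne d * (if X.dim d = 0 then X.signOrOne d else 0) = 0
      rw [Finset.sum_congr rfl fun d _ => e d, Finset.sum_neg_distrib, h.orientation.edge c hc]
      simp
    | .cell c, .south, hxy =>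
      have hc : X.dim c = 1 := (Nat.succ_injective hxy).symm
      refine (SuspensionCell.sum_eq fun z => X.suspension.inc (.cell c) z *
        X.suspension.inc z .south).trans ?_
      have e : ∀ d, -X.inc c d * X.signOrOne d * (if X.dim d = 0 then -X.signOrOne d else 0) =
          X.inc c d := fun d => by
        split_ifs with hd
        · rw [mul_assoc, mul_neg, h.signOrOne_mul_self]; ring
        · rw [h.orientation.not_facet c d fun hh => hd (by omega)]
          simp
      change _ * 0 + _ * 0 +
        ∑ d, -X.inc c d * X.signOrOne d * (if X.dim d = 0 then -X.signOrOne d else 0) = 0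
      rw [Finset.sum_congr rfl fun d _ => e d, h.orientation.edge c hc]
      simp

theorem IsSlice.suspension_isCyclicComplex (h : X.IsSlice D) :
    X.suspension.IsCyclicComplex (D + 1) where
  simple := h.suspension_isSimple
  orientation := h.suspension_isOrientation
  color_inj x y hx hy _ hd hcol := by
    match x, y, hx, hy, hd, hcol with
    | .cell c, .cell d, _, _, hd, hcol =>
      rw [h.color_inj c d (Nat.succ_injective hd) hcol]
    | .north, _, hx, _, _, _ => exact absurd rfl hx
    | .south, _, hx, _, _, _ => exact absurd rfl hx
    | .cell c, .north, _, hy, _, _ => exact absurd rfl hy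
    | .cell c, .south, _, hy, _, _ => exact absurd rfl hy
  cyc_component _ _ _ h := h.elim
  cyc_rotate _ _ _ h := h
  cyc_asymm _ _ _ h := h.elim
  cyc_trans _ _ _ _ h _ := h
  cyc_total a b c hab hbc hac _ _ := by
    -- Two poles do not provide three different vertices.
    rcases eq_northPole_or a with rfl | rfl <;> rcases eq_northPole_or b with rfl | rfl <;>
      rcases eq_northPole_or c with rfl | rfl <;> exact absurd rfl (by assumption)

theorem cell_mem_crossing (c : X.Cell) : cell c ∈ X.suspension.crossing {X.northPole} :=
  CyclicData.mem_crossing_singleton_iff.2 ⟨Nat.succ_ne_zero _, north_le_cell c, X.southPole,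
    northPole_ne_southPole.symm, south_le_cell c⟩

/-- The cells met by the cut of the suspension are the cells of the given complex. -/
noncomputable def crossingEquiv (X : SliceData S) :
    X.Cell ≃o {x // x ∈ X.suspension.crossing {X.northPole}} where
  toEquiv := Equiv.ofBijective (fun c => ⟨cell c, cell_mem_crossing c⟩)
    ⟨fun c d h => SuspensionCell.cell.inj (congrArg Subtype.val h), fun ⟨x, hx⟩ => by
      match x, hx with
      | .north, hx => exact absurd rfl hx.1
      | .south, hx => exact absurd rfl hx.1
      | .cell c, hx => exact ⟨c, rfl⟩⟩
  map_rel_iff' := Iff.rfl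

/-- The cells between the poles form a copy of `X`. The poles divide the boundary of a suspended
cell into two cones over the sphere that bounds the original cell, and each side of the cut retains
a single pole. -/
theorem IsSlice.isCut_northPole (h : X.IsSlice D)
    (hdiv : X.suspension.IsCompatibleDivision {X.northPole}) :
    X.suspension.IsCut D {X.northPole} := by
  have hcr : ∀ c : X.Cell, X.suspension.crossing {X.northPole} ∩ Set.Iio (cell c) =
      (cell '' Set.Iio c : Set (SuspensionCell X)) := fun c => by
    ext x
    match x with
    | .north =>
      refine iff_of_false (fun hx => hx.1.1 rfl) ?_
      rintro ⟨d, -, hd⟩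
      exact cell_ne_north d hd
    | .south =>
      refine iff_of_false (fun hx => hx.1.1 rfl) ?_
      rintro ⟨d, -, hd⟩
      exact cell_ne_south d hd
    | .cell d =>
      constructor
      · exact fun hx => ⟨d, cell_lt_cell.1 hx.2, rfl⟩
      · rintro ⟨e, he, hed⟩
        rw [SuspensionCell.cell.inj hed] at he
        exact ⟨cell_mem_crossing d, cell_lt_cell.2 he⟩
  have hsn : ∀ x : SuspensionCell X, x ∈ X.suspension.side {X.northPole} ↔ x ≠ .south := by
    intro x
    match x with
    | .north => exact iff_of_true ⟨_, rfl, le_rfl⟩ north_ne_south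
    | .south =>
      refine iff_of_false ?_ (fun h => h rfl)
      rintro ⟨_, rfl, hle⟩
      exact not_north_le_south hle
    | .cell d => exact iff_of_true ⟨_, rfl, north_le_cell d⟩ (cell_ne_south d)
  have hss : ∀ x : SuspensionCell X, x ∈ X.suspension.side {X.northPole}ᶜ ↔ x ≠ .north := by
    intro x
    rw [compl_northPole]
    match x with
    | .south => exact iff_of_true ⟨_, rfl, le_rfl⟩ north_ne_south.symm
    | .north =>
      refine iff_of_false ?_ (fun h => h rfl)
      rintro ⟨_, rfl, hle⟩
      exact not_south_le_north hle
    | .cell d => exact iff_of_true ⟨_, rfl, south_le_cell d⟩ (cell_ne_north d)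
  have hsn' : ∀ c : X.Cell, X.suspension.side {X.northPole} ∩ Set.Iio (cell c) =
      (insert .north (cell '' Set.Iio c) : Set (SuspensionCell X)) := fun c => by
    exact Set.ext fun x => (and_congr (hsn x) Iff.rfl).trans (ne_south_and_mem_Iio_cell c x)
  have hss' : ∀ c : X.Cell, X.suspension.side {X.northPole}ᶜ ∩ Set.Iio (cell c) =
      (insert .south (cell '' Set.Iio c) : Set (SuspensionCell X)) := fun c => by
    exact Set.ext fun x => (and_congr (hss x) Iff.rfl).trans (ne_north_and_mem_Iio_cell c x)
  have hsingle : ∀ (T : Set X.suspension.Cell) (p : X.suspension.Cell), T = {p} →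
      X.suspension.IsConnectedOn T := by
    rintro _ p rfl
    refine ⟨⟨p, rfl⟩, ?_⟩
    rintro c rfl d rfl
    exact Relation.ReflTransGen.refl
  refine ⟨hdiv, ?_, ?_, ?_, ?_, ?_, ?_⟩
  · exact CellComplex.IsSimple.congr (X := X.toCellComplex)
      (Y := (X.suspension.cutComplex {X.northPole}).toCellComplex) X.crossingEquiv
      (fun c => rfl) h.simple
  · exact CellComplex.IsConnectedOn.map (X := X.toCellComplex)
      (Y := (X.suspension.cutComplex {X.northPole}).toCellComplex) X.crossingEquiv (T := Set.univ)
      (fun _ _ => trivial)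
      (fun y _ => ⟨X.crossingEquiv.symm y, trivial, X.crossingEquiv.apply_symm_apply y⟩)
      (fun _ _ _ _ h => Or.inl (X.crossingEquiv.le_iff_le.2 h)) h.connected
  · intro x hx
    match x, hx with
    | .north, hx => exact absurd rfl hx.1
    | .south, hx => exact absurd rfl hx.1
    | .cell c, hx =>
      obtain ⟨g⟩ := h.exists_homeomorph_sphere c
      have := isBallPair_cone (p := (north : SuspensionCell X)) (by simp)
        (by rintro _ ⟨d, -, rfl⟩; exact Or.inl (north_le_cell d)) g
      rw [← hsn', ← hcr] at this
      exact this
  · intro x hx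
    match x, hx with
    | .north, hx => exact absurd rfl hx.1
    | .south, hx => exact absurd rfl hx.1
    | .cell c, hx =>
      obtain ⟨g⟩ := h.exists_homeomorph_sphere c
      have := isBallPair_cone (p := (south : SuspensionCell X)) (by simp)
        (by rintro _ ⟨d, -, rfl⟩; exact Or.inl (south_le_cell d)) g
      rw [← hss', ← hcr] at this
      exact this
  · refine hsingle _ SuspensionCell.north ?_
    ext x
    exact (not_congr (hss x)).trans not_not
  · refine hsingle _ SuspensionCell.south ?_
    ext x
    refine Iff.trans ?_ ((not_congr (hsn x)).trans not_not)
    exact and_iff_right ⟨_, rfl, h.suspension_isConnectedOn.2 _ trivial _ trivial⟩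

/-- The suspension of a connected colored complex is a brane complex. -/
theorem IsSlice.suspension_isBrane (h : X.IsSlice D) : X.suspension.IsBrane D where
  toIsCyclicComplex := h.suspension_isCyclicComplex
  cut A hA := by
    have hcyc := h.suspension_isCyclicComplex
    have hconn := h.suspension_isConnectedOn
    -- With two vertices there are just two divisions, complementary to each other.
    have hcases : A = {X.northPole} ∨ A = {X.northPole}ᶜ := by
      obtain ⟨a, ha, b, hb, -⟩ := hA.rest
      rw [compl_northPole]
      rcases eq_northPole_or a with rfl | rfl <;> rcases eq_northPole_or b with rfl | rfl
      · exact absurd ha hb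
      · refine Or.inl (Set.ext fun v => ?_)
        rcases eq_northPole_or v with rfl | rfl
        · exact iff_of_true ha rfl
        · exact iff_of_false hb northPole_ne_southPole.symm
      · refine Or.inr (Set.ext fun v => ?_)
        rcases eq_northPole_or v with rfl | rfl
        · exact iff_of_false hb northPole_ne_southPole
        · exact iff_of_true ha rfl
      · exact absurd ha hb
    rcases hcases with rfl | rfl
    · exact h.isCut_northPole hA
    · have := hA.compl hcyc hconn
      rw [compl_compl] at this
      exact (h.isCut_northPole this).compl hcyc hconn

/-- The signs in the incidence numbers of the suspension undo those of `cutComplex`: the minus sign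
and the sign of a point each occur twice. -/
theorem IsSlice.iso_vertexComplex_northPole (h : X.IsSlice D) :
    X.Iso (X.suspension.vertexComplex X.northPole) := by
  have hs : ∀ c : X.Cell, X.suspension.endSign {X.northPole} (cell c) =
      if X.dim c = 0 then X.signOrOne c else 0 := fun c => CyclicData.endSign_singleton _ _ _
  refine ⟨X.crossingEquiv, fun c => rfl, fun c d => ?_, fun c => rfl, fun c hc h' => ?_⟩
  · change (- (-X.inc c d * X.signOrOne d) *
      if X.dim d + 1 = 1 then X.suspension.endSign {X.northPole} (cell d) else 1) = X.inc c d
    rw [hs]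
    by_cases hd : X.dim d = 0
    · rw [if_pos (by omega), if_pos hd]
      linear_combination X.inc c d * h.signOrOne_mul_self d
    · rw [if_neg (by omega), signOrOne_of_ne hd]
      ring
  · change X.suspension.endSign {X.northPole} (cell c) = X.sign c hc
    rw [hs, if_pos hc]
    exact dif_pos hc

end SliceData

/-- For every class `σ` there is a brane complex with two vertices of the classes `σ` and `σ*`. -/
theorem nonempty_compatibleComplex_star {D : ℕ} {S : Type u} (σ : CutType D S) :
    Nonempty (CompatibleComplex ![σ, σ.star]) := by
  classical
  obtain ⟨⟨X, hX⟩, rfl⟩ := Quotient.exists_rep σ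
  have hn := hX.iso_vertexComplex_northPole
  let Ω : BraneComplex D S := ⟨X.suspension, hX.suspension_isBrane⟩
  have hlabel : Function.Bijective (![X.northPole, X.southPole] : Fin 2 → Ω.Vertex) := by
    constructor
    · intro i j hij
      match i, j, hij with
      | 0, 0, _ => rfl
      | 1, 1, _ => rfl
      | 0, 1, hij => exact absurd hij SliceData.northPole_ne_southPole
      | 1, 0, hij => exact absurd hij.symm SliceData.northPole_ne_southPole
    · intro v
      rcases SliceData.eq_northPole_or v with rfl | rfl
      · exact ⟨0, rfl⟩
      · exact ⟨1, rfl⟩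
  refine ⟨{ complex := Ω
            connected := hX.suspension_isConnectedOn
            label := Equiv.ofBijective _ hlabel
            vertexType_label := fun i => ?_
            cyc_iff := fun i j k => ?_ }⟩
  · match i with
    | 0 => exact Quotient.sound (s := SliceData.isoSetoid D S) hn.symm
    | 1 =>
      refine Quotient.sound (s := SliceData.isoSetoid D S) ?_
      -- The south pole sees the same cut as the north pole, from the other side and hence reversed.
      have := CyclicData.cutComplex_compl_iso hX.suspension_isOrientation {X.northPole}
      rw [SliceData.compl_northPole] at this
      exact this.symm.trans hn.symm.reverse
  · refine iff_of_false (fun h => h) ?_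
    omega

/-! ### Rigidity and change of enumeration for compatible complexes -/

namespace CompatibleComplex

variable {D : ℕ} {S : Type u} {n : ℕ} {σ σ' : Fin n → CutType D S}

/-- Compatible complexes whose vertex complexes agree at all vertices with at most one exception
are isomorphic. -/
theorem exists_isom (m : CompatibleComplex σ) (m' : CompatibleComplex σ') (k : Fin n)
    (h : ∀ i, i ≠ k → σ i = σ' i) :
    ∃ φ : m.complex.1.Isom m'.complex.1, ∀ i, φ.vertex (m.label i) = m'.label i := by
  let M : CyclicData.VertexMatching D m.complex.1 m'.complex.1 :=
    { brane := m.complex.2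
      brane' := m'.complex.2
      connected := m.connected
      connected' := m'.connected
      equiv := m.label.symm.trans m'.label
      last := m.label k
      iso := fun q hq => by
        have hi : m.label.symm q ≠ k := fun e => hq (by rw [← e, m.label.apply_symm_apply])
        have e := ((m.vertexType_label (m.label.symm q)).trans (h _ hi)).trans
          (m'.vertexType_label _).symm
        rw [m.label.apply_symm_apply] at e
        exact Quotient.exact (s := SliceData.isoSetoid D S) e }
  have hM : ∀ i, M.equiv (m.label i) = m'.label i := fun i =>
    congrArg m'.label (m.label.symm_apply_apply i)
  obtain ⟨φ, hφ⟩ := M.exists_isom fun a b c => by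
    obtain ⟨i, rfl⟩ := m.label.surjective a
    obtain ⟨j, rfl⟩ := m.label.surjective b
    obtain ⟨k, rfl⟩ := m.label.surjective c
    rw [hM, hM, hM, m.cyc_iff, m'.cyc_iff]
  exact ⟨φ, fun i => by rw [hφ, hM]⟩

/-- The isomorphism provided by rigidity compares the exceptional vertices too. So all classes but
one determine the last; this is the source of the uniqueness of cut classes and of duals. -/
theorem class_unique (m : CompatibleComplex σ) (m' : CompatibleComplex σ') (k : Fin n)
    (h : ∀ i, i ≠ k → σ i = σ' i) : σ = σ' := by
  obtain ⟨φ, hφ⟩ := m.exists_isom m' k h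
  funext i
  rw [← m.vertexType_label, ← m'.vertexType_label, ← hφ i]
  exact BraneComplex.vertexType_eq (φ.vertexComplex_iso _)

/-- A cyclic change of the enumeration. -/
def relabel (m : CompatibleComplex σ) (ρ : Equiv.Perm (Fin n))
    (hρ : ∀ i j k : Fin n, (ρ i < ρ j ∧ ρ j < ρ k) ∨ (ρ j < ρ k ∧ ρ k < ρ i) ∨
      (ρ k < ρ i ∧ ρ i < ρ j) ↔ (i < j ∧ j < k) ∨ (j < k ∧ k < i) ∨ (k < i ∧ i < j))
    (hσ : ∀ i, σ (ρ i) = σ' i) : CompatibleComplex σ' where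
  complex := m.complex
  connected := m.connected
  label := ρ.trans m.label
  vertexType_label i := (m.vertexType_label (ρ i)).trans (hσ i)
  cyc_iff i j k := (m.cyc_iff _ _ _).trans (hρ i j k)

def swap {σ₁ σ₂ : CutType D S} (m : CompatibleComplex ![σ₁, σ₂]) : CompatibleComplex ![σ₂, σ₁] :=
  m.relabel (Equiv.swap 0 1) (by decide) (fun i => match i with | 0 => rfl | 1 => rfl)

def rotate {σ₁ σ₂ σ₃ σ₄ : CutType D S} (m : CompatibleComplex ![σ₁, σ₂, σ₃, σ₄]) :
    CompatibleComplex ![σ₄, σ₁, σ₂, σ₃] :=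
  m.relabel (finRotate 4).symm (by decide)
    (fun i => match i with | 0 => rfl | 1 => rfl | 2 => rfl | 3 => rfl)

end CompatibleComplex

namespace CutType

variable {D : ℕ} {S : Type u}

/-- The complex agrees at its first vertex with the one obtained by suspension, so by rigidity it
agrees at the second. -/
theorem eq_star_of_compatibleComplex {σ τ : CutType D S} (m : CompatibleComplex ![σ, τ]) :
    τ = σ.star := by
  obtain ⟨m'⟩ := nonempty_compatibleComplex_star σ
  refine congrFun (m.class_unique m' 1 fun i hi => ?_) 1
  match i, hi with
  | 0, _ => rfl
  | 1, hi => exact absurd rfl hi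

/-- Exchanging the two vertices of the suspension shows `σ` as the partner of `σ.star`. -/
theorem star_star (σ : CutType D S) : σ.star.star = σ := by
  obtain ⟨m⟩ := nonempty_compatibleComplex_star σ
  exact (eq_star_of_compatibleComplex m.swap).symm

end CutType

/-! ### The two halves of a compatible complex -/

namespace BraneComplex

variable {D : ℕ} {S : Type u} (Ω : BraneComplex D S)

/-- The half of a connected brane complex as a brane complex. -/
noncomputable def half (hconn : Ω.1.IsConnectedOn Set.univ) {A : Set Ω.Vertex}
    (hA : Ω.1.IsCompatibleDivision A) : BraneComplex D S :=
  ⟨Ω.1.half A, Ω.2.half hconn hA⟩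

/-- The class of the cut along a division, seen from the new vertex. -/
noncomputable def cutClass (hconn : Ω.1.IsConnectedOn Set.univ) {A : Set Ω.Vertex}
    (hA : Ω.1.IsCompatibleDivision A) : CutType D S :=
  (Ω.half hconn hA).vertexType ⟨CyclicData.HalfCell.apex, rfl⟩

variable {Ω}

theorem vertexType_plus (hconn : Ω.1.IsConnectedOn Set.univ) {A : Set Ω.Vertex}
    (hA : Ω.1.IsCompatibleDivision A) (h : (Ω.1.cutAlong A).IsBrane D) :
    (Ω.cutAlong A h).vertexType (Ω.plus A h) = Ω.cutClass hconn hA :=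
  vertexType_eq (Ω := Ω.cutAlong A h) (Ω' := Ω.half hconn hA)
    (CyclicData.inl_vertexComplex_iso (Ω.1.half A) (Ω.1.half Aᶜ)
      ⟨CyclicData.HalfCell.apex, rfl⟩).symm

/-- The new vertices of the two halves see the same cut from opposite sides. -/
theorem star_cutClass (hconn : Ω.1.IsConnectedOn Set.univ) {A : Set Ω.Vertex}
    (hA : Ω.1.IsCompatibleDivision A) (hA' : Ω.1.IsCompatibleDivision Aᶜ) :
    (Ω.cutClass hconn hA).star = Ω.cutClass hconn hA' := by
  have h := Ω.2.cutAlong hconn hA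
  rw [← vertexType_plus hconn hA h, Ω.vertexType_minus A h]
  exact vertexType_eq (Ω := Ω.cutAlong A h) (Ω' := Ω.half hconn hA')
    (CyclicData.inr_vertexComplex_iso (Ω.1.half A) (Ω.1.half Aᶜ)
      ⟨CyclicData.HalfCell.apex, rfl⟩).symm

theorem vertexType_collapseVertex (hconn : Ω.1.IsConnectedOn Set.univ) {A : Set Ω.Vertex}
    (hA : Ω.1.IsCompatibleDivision A) {q : Ω.Vertex} (hq : q ∈ A) :
    (Ω.half hconn hA).vertexType (CyclicData.collapseVertex A q) = Ω.vertexType q := by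
  have hs : q.1 ∈ Ω.1.side A := ⟨q, hq, le_rfl⟩
  have e : CyclicData.collapseVertex A q = ⟨.cell q.1 hs, q.2⟩ :=
    Subtype.ext (CyclicData.collapse_of_mem hs)
  rw [e]
  exact (vertexType_eq (Ω := Ω) (Ω' := Ω.half hconn hA)
    (CyclicData.half_vertexComplex_iso Ω.1 A q.1 hs q.2 hq)).symm

theorem collapseVertex_of_notMem {A : Set Ω.Vertex} {q : Ω.Vertex} (hq : q ∉ A) :
    CyclicData.collapseVertex A q = ⟨CyclicData.HalfCell.apex, rfl⟩ :=
  (CyclicData.mem_reps_iff Ω.2.simple (x := ⟨CyclicData.HalfCell.apex, rfl⟩)).1 hq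

end BraneComplex

namespace CompatibleComplex

variable {D : ℕ} {S : Type u} {n k : ℕ} {σ : Fin n → CutType D S}

/-- An enumeration of the vertices of the half on the side of `A`: the vertices in `A` and one
vertex outside `A`, which represents the new vertex, in the order of the enumeration of the
vertices of the whole complex. -/
structure HalfEnumeration (m : CompatibleComplex σ) (A : Set m.complex.Vertex) (k : ℕ) where
  index : Fin k → Fin n
  strictMono : StrictMono index
  new : Fin k
  mem_iff : ∀ i, m.label (index i) ∈ A ↔ i ≠ new
  exists_index : ∀ j, m.label j ∈ A → ∃ i, index i = j

variable {m : CompatibleComplex σ} {A : Set m.complex.Vertex}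

theorem HalfEnumeration.bijective (e : HalfEnumeration m A k)
    (hA : m.complex.1.IsCompatibleDivision A) :
    Function.Bijective fun i => CyclicData.collapseVertex A (m.label (e.index i)) := by
  have hs := m.complex.2.simple
  constructor
  · intro i j hij
    rcases (CyclicData.collapseVertex_eq_iff hs).1 hij with h | ⟨hi, hj⟩
    · exact e.strictMono.injective (m.label.injective h)
    · rw [e.mem_iff, not_not] at hi hj
      exact hi.trans hj.symm
  · intro x
    obtain ⟨v, rfl⟩ := CyclicData.collapseVertex_surjective hs hA x
    obtain ⟨j, rfl⟩ := m.label.surjective v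
    by_cases hj : m.label j ∈ A
    · obtain ⟨i, rfl⟩ := e.exists_index j hj
      exact ⟨i, rfl⟩
    · exact ⟨e.new, (CyclicData.collapseVertex_eq_iff hs).2
        (Or.inr ⟨fun h => (e.mem_iff _).1 h rfl, hj⟩)⟩

/-- The half of a compatible complex on the side of `A`. -/
noncomputable def half (hA : m.complex.1.IsCompatibleDivision A) (e : HalfEnumeration m A k)
    {σ' : Fin k → CutType D S} (hσ : ∀ i, i ≠ e.new → σ' i = σ (e.index i))
    (hnew : σ' e.new = m.complex.cutClass m.connected hA) : CompatibleComplex σ' where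
  complex := m.complex.half m.connected hA
  connected := hA.half_isConnectedOn m.complex.2.simple m.connected
  label := Equiv.ofBijective _ (e.bijective hA)
  vertexType_label i := by
    change (m.complex.half m.connected hA).vertexType
      (CyclicData.collapseVertex A (m.label (e.index i))) = σ' i
    by_cases hi : i = e.new
    · subst hi
      rw [hnew, BraneComplex.collapseVertex_of_notMem fun h => (e.mem_iff _).1 h rfl]
      rfl
    · rw [BraneComplex.vertexType_collapseVertex m.connected hA ((e.mem_iff i).2 hi), hσ i hi,
        m.vertexType_label]
  cyc_iff i j l := by
    have hinj := (e.bijective hA).1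
    by_cases h : i ≠ j ∧ i ≠ l ∧ j ≠ l
    · refine (CyclicData.half_cyc_collapse m.complex.2.toIsCyclicComplex m.connected hA
        (hinj.ne h.1) (hinj.ne h.2.1) (hinj.ne h.2.2)).trans ((m.cyc_iff _ _ _).trans ?_)
      simp only [e.strictMono.lt_iff_lt]
    · refine iff_of_false ?_ (by omega)
      rintro ⟨h1, h2, h3, -⟩
      exact h ⟨fun h => h1 (h ▸ rfl), fun h => h3 (h ▸ rfl), fun h => h2 (h ▸ rfl)⟩

end CompatibleComplex

/-! ### Families of vectors on the vertices of a compatible complex -/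

section Families

variable {D : ℕ} {S : Type u} {B : CutType D S → Type v}

/-- Vectors at corresponding vertices of different complexes lie in spaces attached to equal
classes. Heterogeneous equality compares them without composing transports. -/
theorem transport_heq {σ τ : CutType D S} (h : σ = τ) (x : B σ) : HEq (transport h x) x := by
  subst h; rfl

theorem heq_apply {ι : Type*} {σ : ι → CutType D S} (x : ∀ i, B (σ i)) {i j : ι} (h : i = j) :
    HEq (x i) (x j) := by
  subst h; rfl

namespace CompatibleComplex

variable {n : ℕ} {σ : Fin n → CutType D S}

/-- The family on the vertices of a compatible complex that corresponds to a family indexed by the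
enumeration. -/
noncomputable def family (m : CompatibleComplex σ) (x : ∀ i, B (σ i)) (q : m.complex.Vertex) :
    B (m.complex.vertexType q) :=
  transport ((m.vertexType_label (m.label.symm q)).symm.trans
    (congrArg m.complex.vertexType (m.label.apply_symm_apply q))) (x (m.label.symm q))

theorem family_heq (m : CompatibleComplex σ) (x : ∀ i, B (σ i)) {q : m.complex.Vertex} {i : Fin n}
    (h : m.label i = q) : HEq (m.family x q) (x i) :=
  (transport_heq _ _).trans (heq_apply x (by rw [← h, m.label.symm_apply_apply]))

theorem family_update (m : CompatibleComplex σ) [DecidableEq m.complex.Vertex]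
    (x : ∀ i, B (σ i)) (i : Fin n) (b : B (σ i)) :
    m.family (Function.update x i b) =
      Function.update (m.family x) (m.label i) (transport (m.vertexType_label i).symm b) := by
  funext q
  obtain ⟨j, rfl⟩ := m.label.surjective q
  by_cases h : j = i
  · subst h
    refine eq_of_heq ((m.family_heq _ rfl).trans ?_)
    simp only [Function.update_self]
    exact (transport_heq _ _).symm
  · refine eq_of_heq ((m.family_heq _ rfl).trans ?_)
    rw [Function.update_of_ne h, Function.update_of_ne (m.label.injective.ne h)]
    exact (m.family_heq x rfl).symm

end CompatibleComplex

end Families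

/-! ### Values on compatible complexes -/

section Evaluation

variable {𝕜 : Type w} [Field 𝕜] {D : ℕ} {S : Type u} {B : CutType D S → Type v}
  [∀ σ, AddCommGroup (B σ)] [∀ σ, Module 𝕜 (B σ)]

/-- Topological invariance in a usable form: the target family has to match the given vectors only
vertex by vertex. -/
theorem BraneTFT.eq_evalOn (F : BraneTFT 𝕜 B) {n : ℕ} {σ : Fin n → CutType D S}
    (m : CompatibleComplex σ) (x : ∀ i, B (σ i)) {Ω : BraneComplex D S}
    (φ : m.complex.1.Isom Ω.1) (y : ∀ q, B (Ω.vertexType q))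
    (hy : ∀ i, HEq (y (φ.vertex (m.label i))) (x i)) :
    F.Φ Ω (PiTensorProduct.tprod 𝕜 y) = evalOn F.Φ m x := by
  have e : pushFamily φ (m.family x) = y := by
    funext q
    obtain ⟨q, rfl⟩ := φ.vertex.surjective q
    obtain ⟨i, rfl⟩ := m.label.surjective q
    exact eq_of_heq ((transport_heq _ _).trans
      ((m.family_heq x (φ.vertex.symm_apply_apply _).symm).trans (hy i).symm))
  rw [← e]
  exact F.invariance m.complex Ω φ (m.family x)

/-- Complexes with the same classes in the same order are isomorphic by rigidity, and topological
invariance compares their values. The index `0` merely fills the place of the exceptional vertex. -/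
theorem BraneTFT.evalOn_eq (F : BraneTFT 𝕜 B) {n : ℕ} [NeZero n] {σ : Fin n → CutType D S}
    (m m' : CompatibleComplex σ) (x : ∀ i, B (σ i)) : evalOn F.Φ m' x = evalOn F.Φ m x := by
  obtain ⟨φ, hφ⟩ := m.exists_isom m' 0 fun _ _ => rfl
  exact F.eq_evalOn m x φ (m'.family x) fun i => m'.family_heq x (hφ i).symm

/-- The linear forms live on unordered tensor products, so the enumeration enters only through the
assignment of vectors to vertices. -/
theorem evalOn_relabel (Φ : ∀ Ω : BraneComplex D S, StateSpace 𝕜 B Ω →ₗ[𝕜] 𝕜) {n : ℕ}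
    {σ σ' : Fin n → CutType D S} (m : CompatibleComplex σ) (ρ : Equiv.Perm (Fin n)) (hρ)
    (hσ : ∀ i, σ (ρ i) = σ' i) (x : ∀ i, B (σ i)) (x' : ∀ i, B (σ' i))
    (hx : ∀ i, HEq (x' i) (x (ρ i))) :
    evalOn Φ (m.relabel ρ hρ hσ) x' = evalOn Φ m x := by
  have e : (m.relabel ρ hρ hσ).family x' = m.family x := by
    funext q
    obtain ⟨i, rfl⟩ := (m.relabel ρ hρ hσ).label.surjective q
    exact eq_of_heq (((m.relabel ρ hρ hσ).family_heq x' rfl).trans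
      ((hx i).trans (m.family_heq x rfl).symm))
  exact congrArg (fun y => Φ m.complex (PiTensorProduct.tprod 𝕜 y)) e

section Linearity

variable (Φ : ∀ Ω : BraneComplex D S, StateSpace 𝕜 B Ω →ₗ[𝕜] 𝕜) {n : ℕ}
  {σ : Fin n → CutType D S} (m : CompatibleComplex σ)

theorem evalOn_update_add (x : ∀ i, B (σ i)) (i : Fin n) (b b' : B (σ i)) :
    evalOn Φ m (Function.update x i (b + b')) =
      evalOn Φ m (Function.update x i b) + evalOn Φ m (Function.update x i b') := by
  classical
  change Φ _ (PiTensorProduct.tprod 𝕜 (m.family _)) =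
    Φ _ (PiTensorProduct.tprod 𝕜 (m.family _)) + Φ _ (PiTensorProduct.tprod 𝕜 (m.family _))
  simp only [m.family_update, transport_add, MultilinearMap.map_update_add, map_add]

theorem evalOn_update_smul (x : ∀ i, B (σ i)) (i : Fin n) (a : 𝕜) (b : B (σ i)) :
    evalOn Φ m (Function.update x i (a • b)) = a * evalOn Φ m (Function.update x i b) := by
  classical
  change Φ _ (PiTensorProduct.tprod 𝕜 (m.family _)) =
    a * Φ _ (PiTensorProduct.tprod 𝕜 (m.family _))
  simp only [m.family_update, transport_smul, MultilinearMap.map_update_smul, map_smul,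
    smul_eq_mul]

end Linearity

end Evaluation

/-! ### Cut invariance combined with multiplicativity -/

section Gluing

variable {𝕜 : Type w} [Field 𝕜] {D : ℕ} {S : Type u} {B : CutType D S → Type v}
  [∀ σ, AddCommGroup (B σ)] [∀ σ, Module 𝕜 (B σ)]

open Classical in
-- For a fixed `x` the value on the cut complex is linear in the inserted tensor. So it suffices
-- that it splits as a product on decomposable tensors; cut invariance then inserts `K τ`.
theorem BraneTFT.eq_contraction_of_cut (F : BraneTFT 𝕜 B) (Ω : BraneComplex D S)
    (hconn : Ω.1.IsConnectedOn Set.univ) (A : Set Ω.Vertex) (hA : Ω.1.IsCut D A)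
    (h : (Ω.1.cutAlong A).IsBrane D) (x : ∀ q, B (Ω.vertexType q)) {τ : CutType D S}
    (e : (Ω.cutAlong A h).vertexType (Ω.plus A h) = τ) (L : B τ →ₗ[𝕜] 𝕜) (R : B τ.star →ₗ[𝕜] 𝕜)
    (H : ∀ b b', F.Φ (Ω.cutAlong A h) (PiTensorProduct.tprod 𝕜 <|
      Function.update (Function.update (cutFamily Ω A h x) (Ω.plus A h) b) (Ω.minus A h)
        (transport (Ω.vertexType_minus A h) b')) =
      L (transport e b) * R (transport (congrArg CutType.star e) b')) :
    F.Φ Ω (PiTensorProduct.tprod 𝕜 x) = LinearMap.mul' 𝕜 𝕜 (TensorProduct.map L R (F.K τ)) := by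
  subst e
  rw [← F.cut_invariance Ω hconn A hA h x]
  have : F.Φ (Ω.cutAlong A h) ∘ₗ insertTensor 𝕜 Ω A h x =
      LinearMap.mul' 𝕜 𝕜 ∘ₗ TensorProduct.map L R := by
    refine TensorProduct.ext' fun b b' => ?_
    exact H b b'
  exact LinearMap.congr_fun this _

open CompatibleComplex in
/-- The value on a complex in terms of the values on the two halves. -/
theorem BraneTFT.evalOn_eq_contraction (F : BraneTFT 𝕜 B) {n k₁ k₂ : ℕ}
    {σ : Fin n → CutType D S} {σ₁ : Fin k₁ → CutType D S} {σ₂ : Fin k₂ → CutType D S}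
    (m : CompatibleComplex σ) {A : Set m.complex.Vertex}
    (hA : m.complex.1.IsCompatibleDivision A) (hA' : m.complex.1.IsCompatibleDivision Aᶜ)
    (e₁ : HalfEnumeration m A k₁) (e₂ : HalfEnumeration m Aᶜ k₂)
    (h₁ : ∀ i, i ≠ e₁.new → σ₁ i = σ (e₁.index i))
    (h₂ : ∀ i, i ≠ e₂.new → σ₂ i = σ (e₂.index i))
    (hn₁ : σ₁ e₁.new = m.complex.cutClass m.connected hA)
    (hn₂ : σ₂ e₂.new = m.complex.cutClass m.connected hA')
    (x : ∀ i, B (σ i)) (y : B (m.complex.cutClass m.connected hA) → ∀ i, B (σ₁ i))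
    (z : B (m.complex.cutClass m.connected hA).star → ∀ i, B (σ₂ i))
    (hy : ∀ b i, i ≠ e₁.new → HEq (y b i) (x (e₁.index i)))
    (hz : ∀ b i, i ≠ e₂.new → HEq (z b i) (x (e₂.index i)))
    (hyn : ∀ b, HEq (y b e₁.new) b) (hzn : ∀ b, HEq (z b e₂.new) b)
    (L : B (m.complex.cutClass m.connected hA) →ₗ[𝕜] 𝕜)
    (R : B (m.complex.cutClass m.connected hA).star →ₗ[𝕜] 𝕜)
    (hL : ∀ b, L b = evalOn F.Φ (half hA e₁ h₁ hn₁) (y b))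
    (hR : ∀ b, R b = evalOn F.Φ (half hA' e₂ h₂ hn₂) (z b)) :
    evalOn F.Φ m x = LinearMap.mul' 𝕜 𝕜
      (TensorProduct.map L R (F.K (m.complex.cutClass m.connected hA))) := by
  classical
  have h := m.complex.2.cutAlong m.connected hA
  refine F.eq_contraction_of_cut m.complex m.connected A (m.complex.2.cut A hA) h (m.family x)
    (BraneComplex.vertexType_plus m.connected hA h) L R fun b b' => ?_
  rw [hL, hR]
  -- The cut complex is by definition the disjoint union of the two halves. What remains is that the
  -- two families of vectors on its vertices coincide.
  refine Eq.trans ?_ (F.multiplicativity (m.complex.half m.connected hA)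
    (m.complex.half m.connected hA') h ((half hA e₁ h₁ hn₁).family (y _))
    ((half hA' e₂ h₂ hn₂).family (z _)))
  congr 2
  have hval₁ : ∀ (c : m.complex.1.Cell) (hc : c ∈ m.complex.1.side A)
      (h0 : m.complex.1.dim c = 0) b,
      HEq ((half hA e₁ h₁ hn₁).family (y b) ⟨.cell c hc, h0⟩) (m.family x ⟨c, h0⟩) := by
    intro c hc h0 b
    have hcA := m.complex.mem_of_mem_side hc h0
    obtain ⟨j, hj⟩ := m.label.surjective ⟨c, h0⟩
    obtain ⟨i, rfl⟩ := e₁.exists_index j (hj ▸ hcA)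
    refine ((half hA e₁ h₁ hn₁).family_heq (y b) (i := i) ?_).trans
      ((hy b i ((e₁.mem_iff i).1 (hj ▸ hcA))).trans (m.family_heq x hj).symm)
    change CyclicData.collapseVertex A (m.label (e₁.index i)) = _
    rw [hj]
    exact Subtype.ext (CyclicData.collapse_of_mem hc)
  have hval₂ : ∀ (c : m.complex.1.Cell) (hc : c ∈ m.complex.1.side Aᶜ)
      (h0 : m.complex.1.dim c = 0) b,
      HEq ((half hA' e₂ h₂ hn₂).family (z b) ⟨.cell c hc, h0⟩) (m.family x ⟨c, h0⟩) := by
    intro c hc h0 b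
    have hcA := m.complex.mem_of_mem_side hc h0
    obtain ⟨j, hj⟩ := m.label.surjective ⟨c, h0⟩
    obtain ⟨i, rfl⟩ := e₂.exists_index j (hj ▸ hcA)
    refine ((half hA' e₂ h₂ hn₂).family_heq (z b) (i := i) ?_).trans
      ((hz b i ((e₂.mem_iff i).1 (hj ▸ hcA))).trans (m.family_heq x hj).symm)
    change CyclicData.collapseVertex Aᶜ (m.label (e₂.index i)) = _
    rw [hj]
    exact Subtype.ext (CyclicData.collapse_of_mem hc)
  have hap₁ : ∀ b, HEq ((half hA e₁ h₁ hn₁).family (y b) ⟨.apex, rfl⟩) b := fun b =>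
    ((half hA e₁ h₁ hn₁).family_heq (y b) (BraneComplex.collapseVertex_of_notMem fun h =>
      (e₁.mem_iff _).1 h rfl)).trans (hyn b)
  have hap₂ : ∀ b, HEq ((half hA' e₂ h₂ hn₂).family (z b) ⟨.apex, rfl⟩) b := fun b =>
    ((half hA' e₂ h₂ hn₂).family_heq (z b) (BraneComplex.collapseVertex_of_notMem fun h =>
      (e₂.mem_iff _).1 h rfl)).trans (hzn b)
  funext q
  -- There are four kinds of vertices: the two new ones, which carry `b` and `b'`, and the old ones
  -- in either half, which keep their vectors.
  match q with
  | ⟨.inl .apex, hq⟩ =>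
    have hne : m.complex.plus A h ≠ m.complex.minus A h := fun e =>
      Sum.inl_ne_inr (congrArg Subtype.val e)
    refine (Function.update_of_ne hne _ _).trans ((Function.update_self _ _ _).trans ?_)
    exact eq_of_heq (((hap₁ _).trans (transport_heq _ b)).symm.trans (transport_heq _ _).symm)
  | ⟨.inr .apex, hq⟩ =>
    refine (Function.update_self (m.complex.minus A h) _ _).trans ?_
    exact eq_of_heq ((transport_heq _ _).trans
      (((hap₂ _).trans (transport_heq _ b')).symm.trans (transport_heq _ _).symm))
  | ⟨.inl (.cell c hc), h0⟩ =>
    refine (Function.update_of_ne (fun e => ?_) _ _).trans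
      ((Function.update_of_ne (fun e => ?_) _ _).trans ?_)
    · exact Sum.inl_ne_inr (congrArg Subtype.val e)
    · exact CyclicData.HalfCell.cell_ne_apex _ _ (Sum.inl_injective (congrArg Subtype.val e))
    · exact eq_of_heq ((transport_heq _ _).trans
        ((hval₁ c hc h0 _).symm.trans (transport_heq _ _).symm))
  | ⟨.inr (.cell c hc), h0⟩ =>
    refine (Function.update_of_ne (fun e => ?_) _ _).trans
      ((Function.update_of_ne (fun e => ?_) _ _).trans ?_)
    · exact CyclicData.HalfCell.cell_ne_apex _ _ (Sum.inr_injective (congrArg Subtype.val e))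
    · exact Sum.inr_ne_inl (congrArg Subtype.val e)
    · exact eq_of_heq ((transport_heq _ _).trans
        ((hval₂ c hc h0 _).symm.trans (transport_heq _ _).symm))

end Gluing

/-! ### Cutting off an initial segment of the vertices -/

namespace CompatibleComplex

variable {D : ℕ} {S : Type u} {n : ℕ} {σ : Fin n → CutType D S}

/-- The first `p` vertices. -/
def initialSegment (m : CompatibleComplex σ) (p : ℕ) : Set m.complex.Vertex :=
  {q | (m.label.symm q : ℕ) < p}

theorem label_mem_initialSegment (m : CompatibleComplex σ) {p : ℕ} (i : Fin n) :
    m.label i ∈ m.initialSegment p ↔ (i : ℕ) < p := by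
  rw [initialSegment, Set.mem_ofPred_eq, m.label.symm_apply_apply]

theorem isCompatibleDivision_initialSegment (m : CompatibleComplex σ) {p : ℕ} (h0 : 0 < p)
    (hp : p < n) : m.complex.1.IsCompatibleDivision (m.initialSegment p) where
  nonempty := ⟨m.label ⟨0, h0.trans hp⟩, (m.label_mem_initialSegment _).2 h0⟩
  component _ _ _ _ := m.connected.2 _ trivial _ trivial
  rest := ⟨m.label ⟨0, h0.trans hp⟩, (m.label_mem_initialSegment _).2 h0, m.label ⟨p, hp⟩,
    fun h => lt_irrefl p ((m.label_mem_initialSegment _).1 h), m.connected.2 _ trivial _ trivial⟩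
  compatible := by
    rintro ⟨a, ha, a', ha', b, hb, b', hb', h1, h2⟩
    obtain ⟨a, rfl⟩ := m.label.surjective a
    obtain ⟨a', rfl⟩ := m.label.surjective a'
    obtain ⟨b, rfl⟩ := m.label.surjective b
    obtain ⟨b', rfl⟩ := m.label.surjective b'
    rw [m.label_mem_initialSegment] at ha ha' hb hb'
    rw [m.cyc_iff] at h1 h2
    simp only [Fin.lt_def] at h1 h2
    -- Two indices below `p` and two indices not below `p` never alternate.
    omega

/-- The vertex number `p`, the first one beyond the segment, represents the contracted side, so the
new vertex comes last. -/
def initialEnumeration (m : CompatibleComplex σ) (p : ℕ) (hp : p + 1 ≤ n) :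
    HalfEnumeration m (m.initialSegment p) (p + 1) where
  index i := ⟨i, i.2.trans_le hp⟩
  strictMono _ _ h := h
  new := ⟨p, p.lt_succ_self⟩
  mem_iff i := by
    rw [m.label_mem_initialSegment, ne_eq, Fin.ext_iff]
    have := i.2
    dsimp only
    omega
  exists_index j hj := ⟨⟨j, Nat.lt_succ_of_lt ((m.label_mem_initialSegment j).1 hj)⟩, rfl⟩

/-- The segment that is cut off has `p + 1` vertices. Its last one, number `p`, represents the
contracted side, so the new vertex comes first. -/
def finalEnumeration (m : CompatibleComplex σ) (p k : ℕ) (hn : n = p + (k + 1)) :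
    HalfEnumeration m (m.initialSegment (p + 1))ᶜ (k + 1) where
  index i := ⟨p + i, by have := i.2; omega⟩
  strictMono _ _ h := Nat.add_lt_add_left h p
  new := ⟨0, k.succ_pos⟩
  mem_iff i := by
    rw [Set.mem_compl_iff, m.label_mem_initialSegment, ne_eq, Fin.ext_iff]
    dsimp only
    omega
  exists_index j hj := by
    rw [Set.mem_compl_iff, m.label_mem_initialSegment] at hj
    exact ⟨⟨j - p, by have := j.2; omega⟩, Fin.ext (by dsimp only; omega)⟩

end CompatibleComplex

/-! ### The bilinear and trilinear forms, class by class -/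

section Forms

variable {𝕜 : Type w} [Field 𝕜] {D : ℕ} {S : Type u} {B : CutType D S → Type v}

def quadFamily {σ₁ σ₂ σ₃ σ₄ : CutType D S} (x₁ : B σ₁) (x₂ : B σ₂) (x₃ : B σ₃) (x₄ : B σ₄) :
    ∀ i, B (![σ₁, σ₂, σ₃, σ₄] i)
  | 0 => x₁
  | 1 => x₂
  | 2 => x₃
  | 3 => x₄

section Update

variable {σ₁ σ₂ σ₃ : CutType D S}

/-- Writing a family as an update in one slot reduces linearity in this slot to that of the values;
the vector `x'` that is overwritten is arbitrary. -/
theorem pairFamily_eq_update_left (x x' : B σ₁) (y : B σ₂) :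
    pairFamily x y = Function.update (pairFamily x' y) 0 x := by
  funext i
  match i with
  | 0 => rfl
  | 1 => rfl

theorem pairFamily_eq_update_right (x : B σ₁) (y y' : B σ₂) :
    pairFamily x y = Function.update (pairFamily x y') 1 y := by
  funext i
  match i with
  | 0 => rfl
  | 1 => rfl

theorem tripleFamily_eq_update_left (x x' : B σ₁) (y : B σ₂) (z : B σ₃) :
    tripleFamily x y z = Function.update (tripleFamily x' y z) 0 x := by
  funext i
  match i with
  | 0 => rfl
  | 1 => rfl
  | 2 => rfl

theorem tripleFamily_eq_update_middle (x : B σ₁) (y y' : B σ₂) (z : B σ₃) :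
    tripleFamily x y z = Function.update (tripleFamily x y' z) 1 y := by
  funext i
  match i with
  | 0 => rfl
  | 1 => rfl
  | 2 => rfl

theorem tripleFamily_eq_update_right (x : B σ₁) (y : B σ₂) (z z' : B σ₃) :
    tripleFamily x y z = Function.update (tripleFamily x y z') 2 z := by
  funext i
  match i with
  | 0 => rfl
  | 1 => rfl
  | 2 => rfl

end Update

variable [∀ σ, AddCommGroup (B σ)] [∀ σ, Module 𝕜 (B σ)]

namespace CompatibleComplex

variable {σ₁ σ₂ σ₃ : CutType D S} (F : BraneTFT 𝕜 B)

/-- The bilinear form given by a complex with two vertices. -/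
noncomputable def pairing (m : CompatibleComplex ![σ₁, σ₂]) : B σ₁ →ₗ[𝕜] B σ₂ →ₗ[𝕜] 𝕜 :=
  LinearMap.mk₂ 𝕜 (fun x y => evalOn F.Φ m (pairFamily x y))
    (fun x x' y => by
      rw [pairFamily_eq_update_left _ 0 y, pairFamily_eq_update_left x 0 y,
        pairFamily_eq_update_left x' 0 y]
      exact evalOn_update_add F.Φ m _ 0 x x')
    (fun a x y => by
      rw [pairFamily_eq_update_left _ 0 y, pairFamily_eq_update_left x 0 y]
      exact evalOn_update_smul F.Φ m _ 0 a x)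
    (fun x y y' => by
      rw [pairFamily_eq_update_right x _ 0, pairFamily_eq_update_right x y 0,
        pairFamily_eq_update_right x y' 0]
      exact evalOn_update_add F.Φ m _ 1 y y')
    (fun a x y => by
      rw [pairFamily_eq_update_right x _ 0, pairFamily_eq_update_right x y 0]
      exact evalOn_update_smul F.Φ m _ 1 a y)

/-- The trilinear form given by a complex with three vertices. -/
noncomputable def tripling (m : CompatibleComplex ![σ₁, σ₂, σ₃]) :
    B σ₁ →ₗ[𝕜] B σ₂ →ₗ[𝕜] B σ₃ →ₗ[𝕜] 𝕜 :=
  LinearMap.mk₂ 𝕜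
    (fun x y =>
      { toFun := fun z => evalOn F.Φ m (tripleFamily x y z)
        map_add' := fun z z' => by
          rw [tripleFamily_eq_update_right x y _ 0, tripleFamily_eq_update_right x y z 0,
            tripleFamily_eq_update_right x y z' 0]
          exact evalOn_update_add F.Φ m _ 2 z z'
        map_smul' := fun a z => by
          rw [tripleFamily_eq_update_right x y _ 0, tripleFamily_eq_update_right x y z 0]
          exact evalOn_update_smul F.Φ m _ 2 a z })
    (fun x x' y => by
      ext z
      change evalOn F.Φ m (tripleFamily (x + x') y z) =
        evalOn F.Φ m (tripleFamily x y z) + evalOn F.Φ m (tripleFamily x' y z)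
      rw [tripleFamily_eq_update_left _ 0 y, tripleFamily_eq_update_left x 0 y,
        tripleFamily_eq_update_left x' 0 y]
      exact evalOn_update_add F.Φ m _ 0 x x')
    (fun a x y => by
      ext z
      change evalOn F.Φ m (tripleFamily (a • x) y z) = a * evalOn F.Φ m (tripleFamily x y z)
      rw [tripleFamily_eq_update_left _ 0 y, tripleFamily_eq_update_left x 0 y]
      exact evalOn_update_smul F.Φ m _ 0 a x)
    (fun x y y' => by
      ext z
      change evalOn F.Φ m (tripleFamily x (y + y') z) =
        evalOn F.Φ m (tripleFamily x y z) + evalOn F.Φ m (tripleFamily x y' z)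
      rw [tripleFamily_eq_update_middle x _ 0, tripleFamily_eq_update_middle x y 0,
        tripleFamily_eq_update_middle x y' 0]
      exact evalOn_update_add F.Φ m _ 1 y y')
    (fun a x y => by
      ext z
      change evalOn F.Φ m (tripleFamily x (a • y) z) = a * evalOn F.Φ m (tripleFamily x y z)
      rw [tripleFamily_eq_update_middle x _ 0, tripleFamily_eq_update_middle x y 0]
      exact evalOn_update_smul F.Φ m _ 1 a y)

end CompatibleComplex

namespace BraneTFT

variable (F : BraneTFT 𝕜 B) {σ₁ σ₂ σ₃ σ₄ : CutType D S}

open Classical in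
/-- The bilinear form on `B σ₁ × B σ₂`. -/
noncomputable def pairing (σ₁ σ₂ : CutType D S) : B σ₁ →ₗ[𝕜] B σ₂ →ₗ[𝕜] 𝕜 :=
  if h : Nonempty (CompatibleComplex ![σ₁, σ₂]) then h.some.pairing F else 0

open Classical in
/-- The trilinear form on `B σ₁ × B σ₂ × B σ₃`. -/
noncomputable def tripling (σ₁ σ₂ σ₃ : CutType D S) : B σ₁ →ₗ[𝕜] B σ₂ →ₗ[𝕜] B σ₃ →ₗ[𝕜] 𝕜 :=
  if h : Nonempty (CompatibleComplex ![σ₁, σ₂, σ₃]) then h.some.tripling F else 0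

/-- The complex chosen in the definition may be replaced by any other one, since the value does not
depend on it. -/
theorem pairing_apply (m : CompatibleComplex ![σ₁, σ₂]) (x : B σ₁) (y : B σ₂) :
    F.pairing σ₁ σ₂ x y = evalOn F.Φ m (pairFamily x y) := by
  have h : Nonempty (CompatibleComplex ![σ₁, σ₂]) := ⟨m⟩
  rw [pairing, dif_pos h]
  exact F.evalOn_eq m h.some (pairFamily x y)

theorem pairing_of_isEmpty (h : IsEmpty (CompatibleComplex ![σ₁, σ₂])) :
    F.pairing σ₁ σ₂ = 0 := dif_neg (not_nonempty_iff.2 h)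

theorem tripling_apply (m : CompatibleComplex ![σ₁, σ₂, σ₃]) (x : B σ₁) (y : B σ₂) (z : B σ₃) :
    F.tripling σ₁ σ₂ σ₃ x y z = evalOn F.Φ m (tripleFamily x y z) := by
  have h : Nonempty (CompatibleComplex ![σ₁, σ₂, σ₃]) := ⟨m⟩
  rw [tripling, dif_pos h]
  exact F.evalOn_eq m h.some (tripleFamily x y z)

theorem tripling_of_isEmpty (h : IsEmpty (CompatibleComplex ![σ₁, σ₂, σ₃])) :
    F.tripling σ₁ σ₂ σ₃ = 0 := dif_neg (not_nonempty_iff.2 h)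

/-- Two vertices have no cyclic order to respect, so they may be enumerated either way. -/
theorem pairing_comm (x : B σ₁) (y : B σ₂) : F.pairing σ₁ σ₂ x y = F.pairing σ₂ σ₁ y x := by
  by_cases h : Nonempty (CompatibleComplex ![σ₁, σ₂])
  · obtain ⟨m⟩ := h
    rw [F.pairing_apply m, F.pairing_apply m.swap]
    symm
    refine evalOn_relabel F.Φ m _ _ _ _ _ fun i => ?_
    match i with
    | 0 => exact HEq.rfl
    | 1 => exact HEq.rfl
  · have h' : IsEmpty (CompatibleComplex ![σ₂, σ₁]) := ⟨fun m => h ⟨m.swap⟩⟩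
    rw [F.pairing_of_isEmpty (not_nonempty_iff.1 h), F.pairing_of_isEmpty h']
    rfl

end BraneTFT

end Forms

/-! ### Cutting a complex with four vertices -/

section CutFour

variable {D : ℕ} {S : Type u} {σ₁ σ₂ σ₃ σ₄ : CutType D S}

open CompatibleComplex

/-- The first of the two complexes suffices: its third class is determined by `σ₁` and `σ₂`. -/
theorem IsCutClass.unique {τ τ' : CutType D S} (h : IsCutClass σ₁ σ₂ σ₃ σ₄ τ)
    (h' : IsCutClass σ₁ σ₂ σ₃ σ₄ τ') : τ = τ' := by
  obtain ⟨⟨m⟩, -⟩ := h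
  obtain ⟨⟨m'⟩, -⟩ := h'
  refine congrFun (m.class_unique m' 2 fun i hi => ?_) 2
  match i, hi with
  | 0, _ => rfl
  | 1, _ => rfl
  | 2, hi => exact absurd rfl hi

namespace CompatibleComplex

theorem division_two (m : CompatibleComplex ![σ₁, σ₂, σ₃, σ₄]) :
    m.complex.1.IsCompatibleDivision (m.initialSegment 2) :=
  m.isCompatibleDivision_initialSegment (by omega) (by omega)

theorem division_two_compl (m : CompatibleComplex ![σ₁, σ₂, σ₃, σ₄]) :
    m.complex.1.IsCompatibleDivision (m.initialSegment 2)ᶜ :=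
  m.division_two.compl m.complex.2.toIsCyclicComplex m.connected

/-- The class of the cut that separates the first two of four vertices from the other two. -/
noncomputable def middleClass (m : CompatibleComplex ![σ₁, σ₂, σ₃, σ₄]) : CutType D S :=
  m.complex.cutClass m.connected m.division_two

theorem firstHalf_class (m : CompatibleComplex ![σ₁, σ₂, σ₃, σ₄]) (i : Fin 3)
    (hi : i ≠ (m.initialEnumeration 2 (by omega)).new) :
    ![σ₁, σ₂, m.middleClass] i =
      ![σ₁, σ₂, σ₃, σ₄] ((m.initialEnumeration 2 (by omega)).index i) :=
  match i, hi with
  | 0, _ => rfl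
  | 1, _ => rfl
  | 2, hi => absurd rfl hi

theorem secondHalf_class (m : CompatibleComplex ![σ₁, σ₂, σ₃, σ₄]) (i : Fin 3)
    (hi : i ≠ (m.finalEnumeration 1 2 rfl).new) :
    ![m.middleClass.star, σ₃, σ₄] i = ![σ₁, σ₂, σ₃, σ₄] ((m.finalEnumeration 1 2 rfl).index i) :=
  match i, hi with
  | 0, hi => absurd rfl hi
  | 1, _ => rfl
  | 2, _ => rfl

/-- The half of a complex with four vertices that contains the first two. -/
noncomputable def firstHalf (m : CompatibleComplex ![σ₁, σ₂, σ₃, σ₄]) :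
    CompatibleComplex ![σ₁, σ₂, m.middleClass] :=
  half m.division_two (m.initialEnumeration 2 (by omega)) m.firstHalf_class rfl

/-- The half of a complex with four vertices that contains the last two. -/
noncomputable def secondHalf (m : CompatibleComplex ![σ₁, σ₂, σ₃, σ₄]) :
    CompatibleComplex ![m.middleClass.star, σ₃, σ₄] :=
  half m.division_two_compl (m.finalEnumeration 1 2 rfl) m.secondHalf_class
    (BraneComplex.star_cutClass m.connected m.division_two m.division_two_compl)

theorem isCutClass_middleClass (m : CompatibleComplex ![σ₁, σ₂, σ₃, σ₄]) :
    IsCutClass σ₁ σ₂ σ₃ σ₄ m.middleClass :=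
  ⟨⟨m.firstHalf⟩, ⟨m.secondHalf⟩⟩

end CompatibleComplex

variable {𝕜 : Type w} [Field 𝕜] {B : CutType D S → Type v}
  [∀ σ, AddCommGroup (B σ)] [∀ σ, Module 𝕜 (B σ)]

/-- The cut between the second and the third vertex leaves two complexes with three vertices each,
whose values are trilinear forms; they are joined by `K τ`. -/
theorem BraneTFT.evalOn_quadFamily (F : BraneTFT 𝕜 B) (m : CompatibleComplex ![σ₁, σ₂, σ₃, σ₄])
    {τ : CutType D S} (hτ : IsCutClass σ₁ σ₂ σ₃ σ₄ τ) (x₁ : B σ₁) (x₂ : B σ₂) (x₃ : B σ₃)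
    (x₄ : B σ₄) :
    evalOn F.Φ m (quadFamily x₁ x₂ x₃ x₄) = LinearMap.mul' 𝕜 𝕜 (TensorProduct.map
      (F.tripling σ₁ σ₂ τ x₁ x₂) (((F.tripling τ.star σ₃ σ₄).flip x₃).flip x₄) (F.K τ)) := by
  -- By uniqueness the given class is the class of the actual cut.
  obtain rfl : τ = m.middleClass := hτ.unique m.isCutClass_middleClass
  refine F.evalOn_eq_contraction m m.division_two m.division_two_compl
    (m.initialEnumeration 2 (by omega)) (m.finalEnumeration 1 2 rfl) m.firstHalf_class
    m.secondHalf_class rfl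
    (BraneComplex.star_cutClass m.connected m.division_two m.division_two_compl)
    (quadFamily x₁ x₂ x₃ x₄) (fun b => tripleFamily x₁ x₂ b) (fun b => tripleFamily b x₃ x₄)
    ?_ ?_ (fun b => HEq.rfl) (fun b => HEq.rfl) _ _ (fun b => F.tripling_apply m.firstHalf _ _ _)
    (fun b => F.tripling_apply m.secondHalf _ _ _)
  · intro b i hi
    match i, hi with
    | 0, _ => exact HEq.rfl
    | 1, _ => exact HEq.rfl
    | 2, hi => exact absurd rfl hi
  · intro b i hi
    match i, hi with
    | 0, hi => exact absurd rfl hi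
    | 1, _ => exact HEq.rfl
    | 2, _ => exact HEq.rfl

end CutFour

/-! ### Cutting a complex with two vertices: `K` inverts the pairing -/

section CutTwo

variable {D : ℕ} {S : Type u} {σ τ : CutType D S}

open CompatibleComplex

namespace CompatibleComplex

theorem division_one (m : CompatibleComplex ![σ, τ]) :
    m.complex.1.IsCompatibleDivision (m.initialSegment 1) :=
  m.isCompatibleDivision_initialSegment (by omega) (by omega)

theorem division_one_compl (m : CompatibleComplex ![σ, τ]) :
    m.complex.1.IsCompatibleDivision (m.initialSegment 1)ᶜ :=
  m.division_one.compl m.complex.2.toIsCyclicComplex m.connected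

/-- The half still has a first vertex of class `σ`, so by rigidity its second class cannot differ
from `τ`. -/
theorem cutClass_division_one (m : CompatibleComplex ![σ, τ]) :
    m.complex.cutClass m.connected m.division_one = τ := by
  have h : ∀ i, i ≠ (m.initialEnumeration 1 (by omega)).new →
      ![σ, m.complex.cutClass m.connected m.division_one] i =
        ![σ, τ] ((m.initialEnumeration 1 (by omega)).index i) := fun i hi =>
    match i, hi with
    | 0, _ => rfl
    | 1, hi => absurd rfl hi
  refine congrFun ((half m.division_one (m.initialEnumeration 1 (by omega)) h rfl).class_unique m
    1 h) 1

end CompatibleComplex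

variable {𝕜 : Type w} [Field 𝕜] {B : CutType D S → Type v}
  [∀ σ, AddCommGroup (B σ)] [∀ σ, Module 𝕜 (B σ)]

/-- Cutting between the two vertices gives two complexes with two vertices again, so the pairing is
expressed through itself and `K τ`. This equation is what determines `K τ`. -/
theorem BraneTFT.pairing_eq_contraction (F : BraneTFT 𝕜 B) (m : CompatibleComplex ![σ, τ])
    (x : B σ) (y : B τ) :
    F.pairing σ τ x y = LinearMap.mul' 𝕜 𝕜 (TensorProduct.map
      (F.pairing σ τ x) ((F.pairing τ.star τ).flip y) (F.K τ)) := by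
  -- The class of the cut equals `τ` only propositionally; a variable `κ` in its place avoids
  -- transporting `K`.
  have key : ∀ κ, κ = m.complex.cutClass m.connected m.division_one →
      F.pairing σ τ x y = LinearMap.mul' 𝕜 𝕜 (TensorProduct.map
        (F.pairing σ κ x) ((F.pairing κ.star τ).flip y) (F.K κ)) := by
    rintro _ rfl
    rw [F.pairing_apply m]
    have h₁ : ∀ i, i ≠ (m.initialEnumeration 1 (by omega)).new →
        ![σ, m.complex.cutClass m.connected m.division_one] i =
          ![σ, τ] ((m.initialEnumeration 1 (by omega)).index i) := fun i hi =>
      match i, hi with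
      | 0, _ => rfl
      | 1, hi => absurd rfl hi
    have h₂ : ∀ i, i ≠ (m.finalEnumeration 0 1 rfl).new →
        ![(m.complex.cutClass m.connected m.division_one).star, τ] i =
          ![σ, τ] ((m.finalEnumeration 0 1 rfl).index i) := fun i hi =>
      match i, hi with
      | 0, hi => absurd rfl hi
      | 1, _ => rfl
    refine F.evalOn_eq_contraction m m.division_one m.division_one_compl
      (m.initialEnumeration 1 (by omega)) (m.finalEnumeration 0 1 rfl) h₁ h₂ rfl
      (BraneComplex.star_cutClass m.connected m.division_one m.division_one_compl)
      (pairFamily x y) (fun b => pairFamily x b) (fun b => pairFamily b y)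
      ?_ ?_ (fun b => HEq.rfl) (fun b => HEq.rfl) _ _ (fun b => F.pairing_apply _ _ _)
      (fun b => F.pairing_apply _ _ _)
    · intro b i hi
      match i, hi with
      | 0, _ => exact HEq.rfl
      | 1, hi => exact absurd rfl hi
    · intro b i hi
      match i, hi with
      | 0, hi => exact absurd rfl hi
      | 1, _ => exact HEq.rfl
  exact key τ m.cutClass_division_one.symm

/-- `K τ` is inverse to the bilinear form on `B τ × B τ*`. -/
theorem BraneTFT.pairing_eq_contraction_K (F : BraneTFT 𝕜 B) (x : B τ) (y : B τ.star) :
    F.pairing τ τ.star x y = LinearMap.mul' 𝕜 𝕜 (TensorProduct.map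
      ((F.pairing τ τ.star).flip y) (F.pairing τ τ.star x) (F.K τ)) := by
  obtain ⟨m⟩ := nonempty_compatibleComplex_star τ
  -- `K τ` appears when the second vertex has class `τ`, so the complex is used with its vertices
  -- exchanged; symmetry of the pairing then restores the order of the arguments.
  rw [F.pairing_comm, F.pairing_eq_contraction m.swap]
  congr 3
  · ext b
    exact F.pairing_comm _ _
  · ext b
    exact F.pairing_comm _ _

/-- The suspension supplies a complex with two vertices for every class, so the second axiom applies
to each `τ`. -/
theorem BraneTFT.pairing_nondegenerate (F : BraneTFT 𝕜 B) (τ : CutType D S) :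
    (F.pairing τ τ.star).Nondegenerate := by
  obtain ⟨m⟩ := nonempty_compatibleComplex_star τ
  obtain ⟨h₁, h₂⟩ := F.nondegenerate _ _ m
  refine ⟨fun x hx => h₁ x fun y => ?_, fun y hy => h₂ y fun x => ?_⟩
  · rw [← F.pairing_apply m, hx]
  · rw [← F.pairing_apply m, hy]

end CutTwo

/-! ### Contraction with the inverse of a bilinear form -/

section LinearAlgebra

variable {𝕜 : Type*} [Field 𝕜] {V W : Type*} [AddCommGroup V] [Module 𝕜 V] [AddCommGroup W]
  [Module 𝕜 W] {n : ℕ}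

/-- A vector in the left kernel of the Gram matrix is orthogonal to a basis, hence zero. The matrix
is square because both bases have `n` elements, so this is enough. -/
theorem isUnit_gram {β : V →ₗ[𝕜] W →ₗ[𝕜] 𝕜} (hβ : β.SeparatingLeft)
    (b : Module.Basis (Fin n) 𝕜 V) (b' : Module.Basis (Fin n) 𝕜 W) :
    IsUnit (Matrix.of fun i j => β (b i) (b' j)) := by
  rw [← Matrix.vecMul_injective_iff_isUnit]
  refine (injective_iff_map_eq_zero
    (Matrix.vecMulLinear (Matrix.of fun i j => β (b i) (b' j)))).2 fun v hv => ?_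
  have h : ∑ i, v i • b i = 0 := by
    refine hβ _ fun y => LinearMap.congr_fun (b'.ext fun j => ?_ : β (∑ i, v i • b i) = 0) y
    simpa [Matrix.vecMul, dotProduct] using congrFun hv j
  exact funext (Fintype.linearIndependent_iff.1 b.linearIndependent v h)

theorem mul'_map_eq_sum (b : Module.Basis (Fin n) 𝕜 V) (b' : Module.Basis (Fin n) 𝕜 W)
    (κ : V ⊗[𝕜] W) (L : V →ₗ[𝕜] 𝕜) (R : W →ₗ[𝕜] 𝕜) :
    LinearMap.mul' 𝕜 𝕜 (TensorProduct.map L R κ) =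
      ∑ i, ∑ j, L (b i) * (b.tensorProduct b').repr κ (i, j) * R (b' j) := by
  conv_lhs => rw [← (b.tensorProduct b').sum_repr κ]
  rw [Fintype.sum_prod_type]
  simp only [map_sum, map_smul, Module.Basis.tensorProduct_apply, TensorProduct.map_tmul,
    LinearMap.mul'_apply, smul_eq_mul]
  refine Finset.sum_congr rfl fun i _ => Finset.sum_congr rfl fun j _ => ?_
  ring

/-- An element of `V ⊗ W` that reproduces a non-degenerate bilinear form has the inverse of the
Gram matrix as its matrix. -/
theorem mul'_map_eq_contraction {β : V →ₗ[𝕜] W →ₗ[𝕜] 𝕜} (hβ : β.SeparatingLeft) (κ : V ⊗[𝕜] W)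
    (hκ : ∀ x y, β x y = LinearMap.mul' 𝕜 𝕜 (TensorProduct.map (β.flip y) (β x) κ))
    (b : Module.Basis (Fin n) 𝕜 V) (b' : Module.Basis (Fin n) 𝕜 W)
    (L : V →ₗ[𝕜] 𝕜) (R : W →ₗ[𝕜] 𝕜) :
    LinearMap.mul' 𝕜 𝕜 (TensorProduct.map L R κ) =
      ∑ i, ∑ j, L (b i) * (Matrix.of fun i j => β (b i) (b' j))⁻¹ j i * R (b' j) := by
  have hG := isUnit_gram hβ b b'
  rw [mul'_map_eq_sum b b']
  set G := Matrix.of fun i j => β (b i) (b' j)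
  set k := Matrix.of fun i j => (b.tensorProduct b').repr κ (i, j)
  -- This is `hκ` on basis vectors, with `k` the coefficient matrix of `κ`. The first factor of `κ`
  -- meets the second argument of the form, which produces the transpose.
  have h1 : G * k.transpose * G = G := by
    ext r l
    refine Eq.trans ?_ (hκ (b r) (b' l)).symm
    rw [mul'_map_eq_sum b b', Matrix.mul_apply]
    simp only [Matrix.mul_apply, Finset.sum_mul]
    refine Finset.sum_congr rfl fun i _ => Finset.sum_congr rfl fun j _ => ?_
    change β (b r) (b' j) * (b.tensorProduct b').repr κ (i, j) * β (b i) (b' l) =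
      β (b i) (b' l) * (b.tensorProduct b').repr κ (i, j) * β (b r) (b' j)
    ring
  -- As `G` is invertible it can be cancelled on the right, so `k.transpose` is its inverse; this
  -- accounts for the order `j i` of the indices.
  have h2 : G * k.transpose = 1 := hG.mul_right_cancel (h1.trans (one_mul G).symm)
  rw [Matrix.inv_eq_right_inv h2]
  rfl

end LinearAlgebra

/-! ### The forms on the direct sum -/

section DirectSumForms

variable {𝕜 : Type w} [Field 𝕜] {D : ℕ} {S : Type u} {B : CutType D S → Type v}
  [∀ σ, AddCommGroup (B σ)] [∀ σ, Module 𝕜 (B σ)] {M : Type*} [AddCommGroup M] [Module 𝕜 M]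

open Classical in
/-- The bilinear map on the direct sum with given components. -/
noncomputable def bilinearSum (f : ∀ σ τ, B σ →ₗ[𝕜] B τ →ₗ[𝕜] M) :
    (⨁ σ, B σ) →ₗ[𝕜] (⨁ σ, B σ) →ₗ[𝕜] M :=
  DirectSum.toModule 𝕜 _ _ fun σ =>
    (DirectSum.toModule 𝕜 _ _ fun τ => (f σ τ).flip).flip

theorem bilinearSum_incl (f : ∀ σ τ, B σ →ₗ[𝕜] B τ →ₗ[𝕜] M) {σ τ : CutType D S} (x : B σ)
    (y : B τ) : bilinearSum f (incl 𝕜 B σ x) (incl 𝕜 B τ y) = f σ τ x y := by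
  rw [bilinearSum, incl, incl, DirectSum.toModule_lof, LinearMap.flip_apply,
    DirectSum.toModule_lof, LinearMap.flip_apply]

open Classical in
/-- The trilinear form on the direct sum with given components. -/
noncomputable def trilinearSum (f : ∀ σ τ υ, B σ →ₗ[𝕜] B τ →ₗ[𝕜] B υ →ₗ[𝕜] 𝕜) :
    (⨁ σ, B σ) →ₗ[𝕜] (⨁ σ, B σ) →ₗ[𝕜] (⨁ σ, B σ) →ₗ[𝕜] 𝕜 :=
  bilinearSum fun σ τ => LinearMap.mk₂ 𝕜
    (fun x y => DirectSum.toModule 𝕜 _ _ fun υ => f σ τ υ x y)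
    (fun x x' y => by ext; simp) (fun a x y => by ext; simp)
    (fun x y y' => by ext; simp) (fun a x y => by ext; simp)

theorem trilinearSum_incl (f : ∀ σ τ υ, B σ →ₗ[𝕜] B τ →ₗ[𝕜] B υ →ₗ[𝕜] 𝕜) {σ τ υ : CutType D S}
    (x : B σ) (y : B τ) (z : B υ) :
    trilinearSum f (incl 𝕜 B σ x) (incl 𝕜 B τ y) (incl 𝕜 B υ z) = f σ τ υ x y z := by
  rw [trilinearSum, bilinearSum_incl]
  classical exact DirectSum.toModule_lof 𝕜 υ z

open Classical in
-- When a single summand pairs with `B τ`, the form sees only one component of `x`; this reduces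
-- non-degeneracy on the sum to the summands.
theorem bilinearSum_apply_incl {f : ∀ σ τ, B σ →ₗ[𝕜] B τ →ₗ[𝕜] M} {σ τ : CutType D S}
    (hf : ∀ ρ, ρ ≠ σ → f ρ τ = 0) (x : ⨁ σ, B σ) (y : B τ) :
    bilinearSum f x (incl 𝕜 B τ y) = f σ τ (x σ) y := by
  induction x using DirectSum.induction_on with
  | zero => simp
  | of ρ x =>
    refine (bilinearSum_incl f x y).trans ?_
    by_cases h : ρ = σ
    · subst h
      rw [DirectSum.of_eq_same]
    · rw [hf ρ h, DirectSum.of_eq_of_ne _ _ _ (Ne.symm h)]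
      simp
  | add x x' hx hx' => simp [hx, hx']

open Classical in
theorem bilinearSum_incl_apply {f : ∀ σ τ, B σ →ₗ[𝕜] B τ →ₗ[𝕜] M} {σ τ : CutType D S}
    (hf : ∀ ρ, ρ ≠ τ → f σ ρ = 0) (x : B σ) (y : ⨁ σ, B σ) :
    bilinearSum f (incl 𝕜 B σ x) y = f σ τ x (y τ) := by
  induction y using DirectSum.induction_on with
  | zero => simp
  | of ρ y =>
    refine (bilinearSum_incl f x y).trans ?_
    by_cases h : ρ = τ
    · subst h
      rw [DirectSum.of_eq_same]
    · rw [hf ρ h, DirectSum.of_eq_of_ne _ _ _ (Ne.symm h)]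
      simp
  | add y y' hy hy' => simp [hy, hy']

end DirectSumForms

/-! ### The colored Frobenius algebra of a theory -/

section Frobenius

variable {𝕜 : Type w} [Field 𝕜] {D : ℕ} {S : Type u} {B : CutType D S → Type v}
  [∀ σ, AddCommGroup (B σ)] [∀ σ, Module 𝕜 (B σ)] (F : BraneTFT 𝕜 B)
  {σ₁ σ₂ σ₃ σ₄ τ : CutType D S}

theorem BraneTFT.pairing_eq_zero {σ τ : CutType D S} (h : τ ≠ σ.star) : F.pairing σ τ = 0 :=
  F.pairing_of_isEmpty ⟨fun m => h (CutType.eq_star_of_compatibleComplex m)⟩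

/-- The summand of `σ` pairs only with that of `σ.star`, and this pairing is non-degenerate. So
every component of a vector in the kernel vanishes. -/
theorem BraneTFT.bilinearSum_pairing_nondegenerate :
    (bilinearSum F.pairing).Nondegenerate := by
  constructor
  · intro x hx
    refine DFinsupp.ext fun σ => (F.pairing_nondegenerate σ).1 _ fun y => ?_
    refine (bilinearSum_apply_incl (fun ρ hρ => F.pairing_eq_zero fun h => hρ ?_) x y).symm.trans
      (hx _)
    rw [← CutType.star_star ρ, ← h, CutType.star_star]
  · intro y hy
    refine DFinsupp.ext fun σ => ?_
    -- On the right the component at `σ` is tested against the summand of `σ.star`, so `σ` has to be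
    -- written as a dual.
    rw [← CutType.star_star σ]
    refine (F.pairing_nondegenerate σ.star).2 _ fun x => ?_
    exact (bilinearSum_incl_apply (fun ρ hρ => F.pairing_eq_zero hρ) x y).symm.trans (hy _)

/-- The inverse Gram matrix is the matrix of `K τ`, so the contraction is the value obtained by
cutting; in particular it does not depend on the bases. -/
theorem BraneTFT.contraction_eq (m : CompatibleComplex ![σ₁, σ₂, σ₃, σ₄])
    (hτ : IsCutClass σ₁ σ₂ σ₃ σ₄ τ) {n : ℕ} (b : Module.Basis (Fin n) 𝕜 (B τ))
    (b' : Module.Basis (Fin n) 𝕜 (B τ.star)) (x₁ : B σ₁) (x₂ : B σ₂) (x₃ : B σ₃) (x₄ : B σ₄) :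
    contraction (bilinearSum F.pairing) (trilinearSum F.tripling)
      (incl 𝕜 B σ₁ x₁) (incl 𝕜 B σ₂ x₂) (incl 𝕜 B σ₃ x₃) (incl 𝕜 B σ₄ x₄)
      (fun i => incl 𝕜 B τ (b i)) (fun j => incl 𝕜 B τ.star (b' j)) =
    evalOn F.Φ m (quadFamily x₁ x₂ x₃ x₄) := by
  rw [F.evalOn_quadFamily m hτ, mul'_map_eq_contraction (F.pairing_nondegenerate τ).1 (F.K τ)
    F.pairing_eq_contraction_K b b', contraction]
  simp only [trilinearSum_incl, bilinearSum_incl, LinearMap.flip_apply]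

theorem BraneTFT.evalOn_rotate (m : CompatibleComplex ![σ₁, σ₂, σ₃, σ₄]) (x₁ : B σ₁) (x₂ : B σ₂)
    (x₃ : B σ₃) (x₄ : B σ₄) :
    evalOn F.Φ m.rotate (quadFamily x₄ x₁ x₂ x₃) = evalOn F.Φ m (quadFamily x₁ x₂ x₃ x₄) := by
  refine evalOn_relabel F.Φ m _ _ _ _ _ fun i => ?_
  match i with
  | 0 => exact HEq.rfl
  | 1 => exact HEq.rfl
  | 2 => exact HEq.rfl
  | 3 => exact HEq.rfl

theorem BraneTFT.isColoredFrobeniusAlgebra :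
    IsColoredFrobeniusAlgebra (bilinearSum F.pairing) (trilinearSum F.tripling) where
  nondegenerate := F.bilinearSum_pairing_nondegenerate
  pair_eq_zero σ₁ σ₂ h x y := by
    rw [bilinearSum_incl, F.pairing_eq_zero fun e => h (by rw [e, CutType.star_star])]
    rfl
  triple_eq_zero σ₁ σ₂ σ₃ h x y z := by
    rw [trilinearSum_incl, F.tripling_of_isEmpty h]
    rfl
  associativity := by
    rintro σ₁ σ₂ σ₃ σ₄ ⟨m⟩ τ υ hτ hυ _ _ b b' c c' x₁ x₂ x₃ x₄
    -- Both sides are the value of the same complex on the same vectors, cut in two different ways.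
    rw [F.contraction_eq m hτ, F.contraction_eq m.rotate hυ, F.evalOn_rotate]

end Frobenius

end BraneTheory

/-! ### The theorem -/

open BraneTheory

theorem theorem3p1 {𝕜 : Type w} [Field 𝕜] [CharZero 𝕜] {D : ℕ} {S : Type u}
    (B : CutType D S → Type v) [∀ σ, AddCommGroup (B σ)] [∀ σ, Module 𝕜 (B σ)]
    [∀ σ, FiniteDimensional 𝕜 (B σ)] (F : BraneTFT 𝕜 B) :
    (∀ σ₁ σ₂ σ₃ σ₄ : CutType D S, Nonempty (CompatibleComplex ![σ₁, σ₂, σ₃, σ₄]) →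
      ∃! τ : CutType D S, IsCutClass σ₁ σ₂ σ₃ σ₄ τ) ∧
    ∃ (β : (⨁ σ, B σ) →ₗ[𝕜] (⨁ σ, B σ) →ₗ[𝕜] 𝕜)
      (t : (⨁ σ, B σ) →ₗ[𝕜] (⨁ σ, B σ) →ₗ[𝕜] (⨁ σ, B σ) →ₗ[𝕜] 𝕜),
      (∀ (σ₁ σ₂ : CutType D S) (m : CompatibleComplex ![σ₁, σ₂]) (x : B σ₁) (y : B σ₂),
        β (incl 𝕜 B σ₁ x) (incl 𝕜 B σ₂ y) = evalOn F.Φ m (pairFamily x y)) ∧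
      (∀ σ₁ σ₂ : CutType D S, IsEmpty (CompatibleComplex ![σ₁, σ₂]) →
        ∀ (x : B σ₁) (y : B σ₂), β (incl 𝕜 B σ₁ x) (incl 𝕜 B σ₂ y) = 0) ∧
      (∀ (σ₁ σ₂ σ₃ : CutType D S) (m : CompatibleComplex ![σ₁, σ₂, σ₃])
        (x : B σ₁) (y : B σ₂) (z : B σ₃),
        t (incl 𝕜 B σ₁ x) (incl 𝕜 B σ₂ y) (incl 𝕜 B σ₃ z) =
          evalOn F.Φ m (tripleFamily x y z)) ∧
      IsColoredFrobeniusAlgebra β t := by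
  refine ⟨?_, bilinearSum F.pairing, trilinearSum F.tripling, ?_, ?_, ?_,
    F.isColoredFrobeniusAlgebra⟩
  · rintro σ₁ σ₂ σ₃ σ₄ ⟨m⟩
    exact ⟨m.middleClass, m.isCutClass_middleClass, fun τ hτ =>
      hτ.unique m.isCutClass_middleClass⟩
  · intro σ₁ σ₂ m x y
    rw [bilinearSum_incl, F.pairing_apply m]
  · intro σ₁ σ₂ h x y
    rw [bilinearSum_incl, F.pairing_of_isEmpty h]
    rfl
  · intro σ₁ σ₂ σ₃ m x y z
    rw [trilinearSum_incl, F.tripling_apply m]
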